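/- Let $k\ge 2$ be an integer and let $B$ be the UHF algebra of type $k^\infty$, i.e. a unital $C^*$-algebra that is the closure of an increasing union of unital $*$-subalgebras $B_n\cong M_{k^n}(\mathbb C)$. Let $\tau$ be the unique tracial state of $B$. For bounded sequences $(x_n),(y_n)$ in $B$ write $(x_n)_n=(y_n)_n$ if $\|x_n-y_n\|\to 0$, i.e. if they agree in $B^\infty=\ell^\infty(\mathbb N,B)/c_0(B)$, and write $(x_n)_n\in B_\infty=B^\infty\cap B'$ if $\|x_nb-bx_n\|\to0$ for every $b\in B$ (central sequence). Let $\beta$ be an automorphism of $B$ with the Rohlin property: for every $N\in\mathbb N$ there are finitely many integers $h_1,\dots,h_m\ge N$ such that for every finite $F\subset B$ and $\varepsilon>0$ there are projections $e_{i,j}\in B$ ($1\le i\le m$, $0\le j<h_i$) with $\sum_{i,j}e_{i,j}=1$, $\|\beta(e_{i,j})-e_{i,j+1}\|<\varepsilon$ (where $e_{i,h_i}=e_{i,0}$) and $\|xe_{i,j}-e_{i,j}x\|<\varepsilon$ for all $x\in F$ and all $i,j$. For a unitary $u\in B$ connected to $1$ by a piecewise continuously differentiable path $\xi:[0,1]\to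 U(B)$, $\xi(0)=1$, $\xi(1)=u$, let $$\Delta_\tau(u)=\frac1{2\pi\sqrt{-1}}\int_0^1\tau(\dot\xi(t)\xi(t)^*)\,dt+\tau(K_0(B))\in\mathbb R/\tau(K_0(B))$$ be the de la Harpe–Skandalis determinant, where $\tau(K_0(B))\subset\mathbb R$ is the subgroup generated by the values of the unnormalized trace $\mathrm{Tr}\otimes\tau$ on the projections of $M_r(B)$, $r\in\mathbb N$. Let $u_n\in B$, $n\in\mathbb N$, be unitaries with $(u_n)_n\in B_\infty$ and $\Delta_\tau(u_n)=0$ for every $n\in\mathbb N$. Then there are unitaries $v_n\in B$, $n\in\mathbb N$, such that $(v_n)_n\in B_\infty$, $$(v_n\beta(v_n)^*)_n=(u_n)_n,$$ and, for every $n\in\mathbb N$, the spectrum of $v_n\beta(v_n)^*u_n^*$ does not contain $-1$ and $\tau\bigl(\log(v_n\beta(v_n)^*u_n^*)\bigr)=0$, where $\log$ is the principal branch on the complement of the closed negative real half-line. -/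

import Mathlib

/-!
The trace of the logarithm is additive on unitaries close to `1`. Summing it over the increments of
a chain of unitaries with small steps computes the determinant, and the value of a closed chain lies
in `2πi ℤ[1/k]`, because on a matrix subalgebra its exponential is a determinant.

Rohlin towers turn an almost central `u` into an approximate coboundary `v β(v)* ≈ u`: along a tower
of height `h` one moves from `1` to the inverse of the cocycle `u β(u) ⋯ β^(h-1)(u)` by an
exponential path of speed `π / h`, which stays in the commutant of a large matrix subalgebra.
Since `Δ_τ(u) = 0` and `τ` is `β`-invariant, the trace of `log (v β(v)* u*)` is then `2πi r` with a
small `r ∈ ℤ[1/k]`.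

To remove `r`, take a projection `p` almost orthogonal to its first translates under `β`. The
unitary `y = exp (i ∑ j, (2π (j + 1) / n) β^j(p))` has `y β(y)*` close to `1`, as the
coefficient jumps by `2π / n` at each step and by the invisible amount `2π` at the end; the trace
of `log (y β(y)*)` is `2πi τ(p)`. Multiplying `v` by `y` or `y*` with `τ(p) = |r|` makes the trace
vanish, and a diagonal argument over finite subsets and tolerances produces the sequence `v n`.
-/

open scoped ComplexOrder

namespace RohlinUHF

/-- `B` is a UHF algebra of type (rank) `k^∞`: it is the closure of the union of an increasing
sequence of unital `*`-subalgebras, the `n`-th of which is isomorphic to the algebra of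
`k^n × k^n` complex matrices. -/
def IsUHFPow (k : ℕ) (B : Type*) [CStarAlgebra B] : Prop :=
  ∃ φ : ∀ n : ℕ, Matrix (Fin (k ^ n)) (Fin (k ^ n)) ℂ →⋆ₐ[ℂ] B,
    (∀ n, Function.Injective (φ n)) ∧
    (∀ n, Set.range (φ n) ⊆ Set.range (φ (n + 1))) ∧
    Dense (⋃ n, Set.range (φ n))

/-- Tracial states of a unital C*-algebra: positive unital linear functionals with the trace
property. -/
structure IsTracialState {B : Type*} [CStarAlgebra B] (τ : B →ₗ[ℂ] ℂ) : Prop where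
  nonneg : ∀ a, 0 ≤ τ (star a * a)
  map_one : τ 1 = 1
  map_mul_comm : ∀ a b, τ (a * b) = τ (b * a)

/-- The Rohlin property of an automorphism `α` of a unital C*-algebra: for every `k` there are
`h 0, …, h (m - 1) ≥ k` such that, for every finite subset `F` and every `ε > 0`, there is a partition
of unity by projections `e i j`, `i < m`, `j < h i`, which almost commute with `F` and which `α`
almost permutes cyclically within each of the `m` towers.
(Projections with sum `1` are mutually orthogonal.) -/
def HasRohlinProperty {B : Type*} [CStarAlgebra B] (α : B ≃⋆ₐ[ℂ] B) : Prop :=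
  ∀ k : ℕ, ∃ (m : ℕ) (h : Fin m → ℕ), (∀ i, k ≤ h i) ∧
    ∀ (F : Finset B) (ε : ℝ), 0 < ε → ∃ e : Fin m → ℕ → B,
      (∀ i, ∀ j < h i, IsStarProjection (e i j)) ∧
      ∑ i, ∑ j ∈ Finset.range (h i), e i j = 1 ∧
      (∀ i, ∀ j < h i, ‖α (e i j) - e i ((j + 1) % h i)‖ < ε) ∧
      (∀ i, ∀ j < h i, ∀ x ∈ F, ‖x * e i j - e i j * x‖ < ε)

/-- `x` and `y` define the same element of `B^∞ = ℓ^∞(ℕ, B) / c₀(B)`. -/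
def SeqEq {B : Type*} [CStarAlgebra B] (x y : ℕ → B) : Prop :=
  Filter.Tendsto (fun n => ‖x n - y n‖) Filter.atTop (nhds 0)

/-- `(x n)` is a bounded sequence whose class in `B^∞ = ℓ^∞(ℕ, B) / c₀(B)` commutes with every
constant sequence, that is, it belongs to the central sequence algebra `B_∞ = B^∞ ∩ B'`. -/
def IsCentralSequence {B : Type*} [CStarAlgebra B] (x : ℕ → B) : Prop :=
  (∃ C : ℝ, ∀ n, ‖x n‖ ≤ C) ∧ ∀ b : B, SeqEq (fun n => x n * b) (fun n => b * x n)

/-- The subgroup `τ(K₀(B))` of `ℝ`, generated by the (unnormalized) traces of the projections in the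
matrix algebras over `B`. These traces are real, so taking the real part loses nothing. -/
def traceK0 {B : Type*} [CStarAlgebra B] (τ : B →ₗ[ℂ] ℂ) : AddSubgroup ℝ :=
  AddSubgroup.closure
    {r : ℝ | ∃ (n : ℕ) (p : Matrix (Fin n) (Fin n) B),
      IsStarProjection p ∧ r = (∑ i, τ (p i i)).re}

/-- `ξ` restricts to a piecewise continuously differentiable path `[0,1] → U(B)`. -/
def IsUnitaryPath {B : Type*} [CStarAlgebra B] (ξ : ℝ → B) : Prop :=
  (∀ t ∈ Set.Icc (0 : ℝ) 1, ξ t ∈ unitary B) ∧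
  ∃ (N : ℕ) (s : ℕ → ℝ), s 0 = 0 ∧ s N = 1 ∧
    ∀ i < N, s i < s (i + 1) ∧ ContDiffOn ℝ 1 ξ (Set.Icc (s i) (s (i + 1)))

/-- The number `(2πi)⁻¹ ∫₀¹ τ(ξ'(t) ξ(t)*) dt` of a path of unitaries. It is real, as `ξ' ξ*` is
skew-adjoint, so taking the real part loses nothing. -/
noncomputable def pathDet {B : Type*} [CStarAlgebra B] (τ : B →ₗ[ℂ] ℂ) (ξ : ℝ → B) : ℝ :=
  ((2 * Real.pi * Complex.I)⁻¹ * ∫ t in (0 : ℝ)..1, τ (deriv ξ t * star (ξ t))).re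

/-- `HasDeterminant τ u d`: the unitary `u` is joined to `1` by a piecewise continuously
differentiable path of unitaries (so `u ∈ U₀(B)`), and `d` is the de la Harpe–Skandalis determinant
`Δ_τ(u) ∈ ℝ / τ(K₀(B))`, the class of the number `pathDet τ ξ` of such a path `ξ`. -/
def HasDeterminant {B : Type*} [CStarAlgebra B] (τ : B →ₗ[ℂ] ℂ) (u : unitary B)
    (d : ℝ ⧸ traceK0 τ) : Prop :=
  ∃ ξ : ℝ → B, IsUnitaryPath ξ ∧ ξ 0 = 1 ∧ ξ 1 = u ∧
    d = QuotientAddGroup.mk (pathDet τ ξ)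

/-- The domain of the standard logarithm on normal elements: the spectrum avoids the closed negative
real half-line. -/
def InLogDomain {B : Type*} [CStarAlgebra B] (a : B) : Prop :=
  IsStarNormal a ∧ spectrum ℂ a ⊆ Complex.slitPlane

/-- `log a` through the continuous functional calculus, with the principal branch of `log`. -/
noncomputable def clog {B : Type*} [CStarAlgebra B] (a : B) : B :=
  cfc Complex.log a

end RohlinUHF

namespace RohlinUHF

section TraceLog

/-- A functional is tracial if it does not see the order of the factors of a product. This is stated
for functions, so that it applies to linear functionals with or without a topology. -/
def IsTracial {A : Type*} [Mul A] (T : A → ℂ) : Prop :=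
  ∀ a b, T (a * b) = T (b * a)

lemma IsTracial.map_units_conj {A : Type*} [Monoid A] {T : A → ℂ} (hT : IsTracial T) (c : Aˣ)
    (a : A) : T (c * a * ↑c⁻¹) = T a := by
  rw [hT, Units.inv_mul_cancel_left]

lemma sub_eq_sub_of_hasDerivWithinAt_eq {E : Type*} [NormedAddCommGroup E] [NormedSpace ℝ E]
    {f g f' : ℝ → E} {a b : ℝ} (hab : a ≤ b)
    (hf : ∀ t ∈ Set.Icc a b, HasDerivWithinAt f (f' t) (Set.Icc a b) t)
    (hg : ∀ t ∈ Set.Icc a b, HasDerivWithinAt g (f' t) (Set.Icc a b) t) :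
    f b - f a = g b - g a := by
  have hdiff := norm_image_sub_le_of_norm_deriv_le_segment' (f := f - g) (f' := fun _ ↦ 0) (C := 0)
    (fun t ht ↦ ((hf t ht).sub (hg t ht)).congr_deriv (sub_self _)) (by simp) b
    (Set.right_mem_Icc.2 hab)
  rw [zero_mul, norm_le_zero_iff, Pi.sub_apply, Pi.sub_apply] at hdiff
  rw [← sub_eq_zero, ← hdiff]
  abel

variable {A : Type*} [NormedRing A]

lemma norm_pow_le_max_norm_one_mul (a : A) (n : ℕ) : ‖a ^ n‖ ≤ max ‖(1 : A)‖ 1 * ‖a‖ ^ n := by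
  rcases n.eq_zero_or_pos with rfl | hn
  · simp
  · exact (norm_pow_le' a hn).trans
      (le_mul_of_one_le_left (pow_nonneg (norm_nonneg a) n) (le_max_right _ _))

lemma norm_mul_sub_one_le (a b : A) :
    ‖a * b - 1‖ ≤ (1 + ‖a - 1‖) * (1 + ‖b - 1‖) - 1 := by
  calc ‖a * b - 1‖ = ‖(a - 1) + (b - 1) + (a - 1) * (b - 1)‖ := by congr 1; noncomm_ring
    _ ≤ ‖a - 1‖ + ‖b - 1‖ + ‖a - 1‖ * ‖b - 1‖ :=
      (norm_add_le _ _).trans (add_le_add (norm_add_le _ _) (norm_mul_le _ _))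
    _ = (1 + ‖a - 1‖) * (1 + ‖b - 1‖) - 1 := by ring

lemma isUnit_of_norm_sub_one_lt [CompleteSpace A] {a : A} (ha : ‖a - 1‖ < 1) : IsUnit a := by
  simpa using isUnit_one_sub_of_norm_lt_one (x := 1 - a) (by rwa [norm_sub_rev])

variable [NormedAlgebra ℂ A]

/-- The trace `T (log a)` of the logarithm of `a`, defined by the power series of the logarithm
at `1`. It is meaningful for `‖a - 1‖ < 1`. -/
noncomputable def traceLog (T : A →L[ℂ] ℂ) (a : A) : ℂ :=
  -∑' n : ℕ, ((n : ℂ) + 1)⁻¹ * T ((1 - a) ^ (n + 1))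

@[simp]
lemma traceLog_one (T : A →L[ℂ] ℂ) : traceLog T 1 = 0 := by
  simp [traceLog]

lemma traceLog_units_conj {T : A →L[ℂ] ℂ} (hT : IsTracial T) (c : Aˣ) (a : A) :
    traceLog T (c * a * ↑c⁻¹) = traceLog T a := by
  have hpow (n : ℕ) : T ((1 - c * a * ↑c⁻¹) ^ n) = T ((1 - a) ^ n) := by
    rw [← hT.map_units_conj c ((1 - a) ^ n), ← Units.conj_pow]
    simp [mul_sub, sub_mul]
  simp only [traceLog, hpow]

lemma norm_traceLog_le (T : A →L[ℂ] ℂ) {a : A} (ha : ‖a - 1‖ < 1) :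
    ‖traceLog T a‖ ≤ ‖T‖ * ‖a - 1‖ / (1 - ‖a - 1‖) := by
  have hgeom : HasSum (fun n : ℕ ↦ ‖T‖ * ‖a - 1‖ * ‖a - 1‖ ^ n)
      (‖T‖ * ‖a - 1‖ / (1 - ‖a - 1‖)) :=
    (hasSum_geometric_of_lt_one (norm_nonneg _) ha).mul_left _
  rw [traceLog, norm_neg]
  refine tsum_of_norm_bounded hgeom fun n ↦ ?_
  have hcoeff : ‖((n : ℂ) + 1)⁻¹‖ ≤ 1 := by
    rw [← Nat.cast_succ, norm_inv, Complex.norm_natCast]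
    exact inv_le_one_of_one_le₀ (mod_cast n.succ_pos)
  calc ‖((n : ℂ) + 1)⁻¹ * T ((1 - a) ^ (n + 1))‖
      ≤ 1 * (‖T‖ * ‖1 - a‖ ^ (n + 1)) := by
        rw [norm_mul]
        gcongr
        exact T.le_opNorm_of_le (norm_pow_le' _ n.succ_pos)
    _ = ‖T‖ * ‖a - 1‖ * ‖a - 1‖ ^ n := by rw [norm_sub_rev 1 a]; ring

/-- Under a tracial functional the `n + 1` terms of the noncommutative power rule coincide, which
cancels the coefficient `(n + 1)⁻¹`. -/
lemma hasFDerivAt_traceLog_term {T : A →L[ℂ] ℂ} (hT : IsTracial T) (n : ℕ) (x : A) :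
    HasFDerivAt (fun x : A ↦ ((n : ℂ) + 1)⁻¹ * T ((1 - x) ^ (n + 1)))
      (-(T ∘L ContinuousLinearMap.mul ℂ A ((1 - x) ^ n))) x := by
  have hpow : HasFDerivAt (fun x : A ↦ (1 - x) ^ (n + 1)) _ x :=
    HasFDerivAt.pow' ((hasFDerivAt_id (𝕜 := ℂ) x).const_sub 1) (n + 1)
  refine ((T.hasFDerivAt.comp x hpow).const_mul ((n : ℂ) + 1)⁻¹).congr_fderiv ?_
  ext y
  have hterm : ∀ i ∈ Finset.range (n + 1),
      -T ((1 - x) ^ (n - i) * y * (1 - x) ^ i) = -T ((1 - x) ^ n * y) := by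
    intro i hi
    rw [hT, ← mul_assoc, ← pow_add, Nat.add_sub_cancel' (by simpa [Nat.lt_succ_iff] using hi)]
  have hn : (n : ℂ) + 1 ≠ 0 := n.cast_add_one_ne_zero
  simp only [map_sum, ContinuousLinearMap.comp_apply, sum_apply, smul_eq_mul,
    smul_apply, neg_apply, MulOpposite.smul_eq_mul_unop, MulOpposite.unop_op,
    ContinuousLinearMap.mul_apply', ContinuousLinearMap.id_apply,
    Nat.pred_eq_sub_one, add_tsub_cancel_right, id_eq, map_neg, neg_mul, mul_neg]
  rw [Finset.sum_congr rfl hterm]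
  simp [hn]

lemma norm_lineMap_one_sub_one_le (b : A) {t : ℝ} (ht : t ∈ Set.Icc (0 : ℝ) 1) :
    ‖AffineMap.lineMap 1 b t - 1‖ ≤ ‖b - 1‖ := by
  rw [← dist_eq_norm, dist_lineMap_left, dist_eq_norm, norm_sub_rev, Real.norm_of_nonneg ht.1]
  exact mul_le_of_le_one_left (norm_nonneg _) ht.2

variable [CompleteSpace A] {T : A →L[ℂ] ℂ}

theorem hasFDerivAt_traceLog (hT : IsTracial T) {x : A} (hx : ‖x - 1‖ < 1) :
    HasFDerivAt (traceLog T) (T ∘L ContinuousLinearMap.mul ℂ A (Ring.inverse x)) x := by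
  obtain ⟨r, hxr, hr1⟩ := exists_between hx
  have hr0 : 0 < r := (norm_nonneg _).trans_lt hxr
  have hbound (n : ℕ) (y : A) (hy : y ∈ Metric.ball (1 : A) r) :
      ‖-(T ∘L ContinuousLinearMap.mul ℂ A ((1 - y) ^ n))‖ ≤ ‖T‖ * (max ‖(1 : A)‖ 1 * r ^ n) := by
    rw [mem_ball_iff_norm'] at hy
    rw [norm_neg]
    refine (ContinuousLinearMap.opNorm_comp_le _ _).trans ?_
    gcongr
    refine (ContinuousLinearMap.opNorm_mul_apply_le ℂ A _).trans
      ((norm_pow_le_max_norm_one_mul _ n).trans ?_)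
    gcongr
  have hsum : HasFDerivAt (fun x : A ↦ ∑' n : ℕ, ((n : ℂ) + 1)⁻¹ * T ((1 - x) ^ (n + 1)))
      (∑' n : ℕ, -(T ∘L ContinuousLinearMap.mul ℂ A ((1 - x) ^ n))) x :=
    hasFDerivAt_tsum_of_isPreconnected
      (((summable_geometric_of_lt_one hr0.le hr1).mul_left _).mul_left _)
      Metric.isOpen_ball Metric.isPreconnected_ball
      (fun n y _ ↦ hasFDerivAt_traceLog_term hT n y) hbound
      (Metric.mem_ball_self hr0) (by simp) (by rwa [mem_ball_iff_norm])
  have hneumann : HasSum (fun n : ℕ ↦ (1 - x) ^ n) (Ring.inverse x) := by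
    simpa using hasSum_geom_series_inverse (1 - x) (by rwa [norm_sub_rev])
  have hderiv := ((ContinuousLinearMap.compL ℂ A A ℂ T) ∘L
    ContinuousLinearMap.mul ℂ A).hasSum hneumann
  refine hsum.neg.congr_fderiv ?_
  rw [tsum_neg, neg_neg]
  exact hderiv.tsum_eq

lemma hasDerivWithinAt_traceLog_comp (hT : IsTracial T) {ξ : ℝ → A} {ξ' : A} {t : ℝ} {s : Set ℝ}
    (hξ : HasDerivWithinAt ξ ξ' s t) (h1 : ‖ξ t - 1‖ < 1) :
    HasDerivWithinAt (fun t ↦ traceLog T (ξ t)) (T (Ring.inverse (ξ t) * ξ')) s t :=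
  ((hasFDerivAt_traceLog hT h1).restrictScalars ℝ).comp_hasDerivWithinAt t hξ

lemma hasDerivWithinAt_traceLog_lineMap (hT : IsTracial T) {b : A} (hb : ‖b - 1‖ < 1) {t : ℝ}
    (ht : t ∈ Set.Icc (0 : ℝ) 1) :
    HasDerivWithinAt (fun t ↦ traceLog T (AffineMap.lineMap 1 b t))
      (T (Ring.inverse (AffineMap.lineMap 1 b t) * (b - 1))) (Set.Icc 0 1) t :=
  hasDerivWithinAt_traceLog_comp hT AffineMap.hasDerivWithinAt_lineMap
    ((norm_lineMap_one_sub_one_le b ht).trans_lt hb)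

theorem traceLog_mul (hT : IsTracial T) {a b : A}
    (hab : (1 + ‖a - 1‖) * (1 + ‖b - 1‖) < 2) :
    traceLog T (a * b) = traceLog T a + traceLog T b := by
  have ha : ‖a - 1‖ < 1 := by nlinarith [norm_nonneg (a - 1), norm_nonneg (b - 1)]
  have hb : ‖b - 1‖ < 1 := by nlinarith [norm_nonneg (a - 1), norm_nonneg (b - 1)]
  have hderiv : ∀ t ∈ Set.Icc (0 : ℝ) 1,
      HasDerivWithinAt (fun t ↦ traceLog T (a * AffineMap.lineMap 1 b t))
        (T (Ring.inverse (AffineMap.lineMap 1 b t) * (b - 1))) (Set.Icc 0 1) t := by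
    intro t ht
    have hbt := norm_lineMap_one_sub_one_le b ht
    have habt : ‖a * AffineMap.lineMap 1 b t - 1‖ < 1 := by
      refine (norm_mul_sub_one_le a _).trans_lt ?_
      nlinarith [norm_nonneg (a - 1)]
    refine (hasDerivWithinAt_traceLog_comp hT
      (AffineMap.hasDerivWithinAt_lineMap.const_mul a) habt).congr_deriv ?_
    obtain ⟨c, rfl⟩ := isUnit_of_norm_sub_one_lt ha
    obtain ⟨d, hd⟩ := isUnit_of_norm_sub_one_lt (hbt.trans_lt hb)
    rw [← hd, ← Units.val_mul, Ring.inverse_unit, Ring.inverse_unit, mul_inv_rev, Units.val_mul,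
      mul_assoc, Units.inv_mul_cancel_left]
  have hint := sub_eq_sub_of_hasDerivWithinAt_eq zero_le_one hderiv
    fun t ht ↦ hasDerivWithinAt_traceLog_lineMap hT hb ht
  simp only [AffineMap.lineMap_apply_one, AffineMap.lineMap_apply_zero, mul_one, traceLog_one,
    sub_zero] at hint
  linear_combination hint

theorem traceLog_exp (hT : IsTracial T) {h : A}
    (hh : ∀ t ∈ Set.Icc (0 : ℝ) 1, ‖NormedSpace.exp (t • h) - 1‖ < 1) :
    traceLog T (NormedSpace.exp h) = T h := by
  have hderiv : ∀ t ∈ Set.Icc (0 : ℝ) 1,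
      HasDerivWithinAt (fun t : ℝ ↦ traceLog T (NormedSpace.exp (t • h))) (T h)
        (Set.Icc 0 1) t := by
    intro t ht
    refine (hasDerivWithinAt_traceLog_comp hT
      (hasDerivAt_exp_smul_const (𝕂 := ℝ) h t).hasDerivWithinAt (hh t ht)).congr_deriv ?_
    rw [Ring.inverse_mul_cancel_left _ _ (isUnit_of_norm_sub_one_lt (hh t ht))]
  have hlin (t : ℝ) : HasDerivWithinAt (fun t : ℝ ↦ (t : ℂ) * T h) (T h) (Set.Icc 0 1) t := by
    simpa using ((hasDerivAt_id t).ofReal_comp.mul_const (T h)).hasDerivWithinAt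
  simpa using sub_eq_sub_of_hasDerivWithinAt_eq zero_le_one hderiv fun t _ ↦ hlin t

end TraceLog

section Exponential

variable {B : Type*} [CStarAlgebra B]

/-- The element `exp (i t a)`; for self-adjoint `a` this is the one-parameter group of unitaries
generated by `a`. Unlike `selfAdjoint.expUnitary` it takes values in `B`. -/
noncomputable def expI (a : B) (t : ℝ) : B := NormedSpace.exp (t • (Complex.I • a))

@[simp]
lemma expI_zero (a : B) : expI a 0 = 1 := by simp [expI, NormedSpace.exp_zero]

lemma expI_mem_unitary {a : B} (ha : IsSelfAdjoint a) (t : ℝ) : expI a t ∈ unitary B := by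
  let _ : NormedAlgebra ℚ B := .restrictScalars ℚ ℂ B
  refine NormedSpace.exp_mem_unitary_of_mem_skewAdjoint ?_
  rw [skewAdjoint.mem_iff, star_smul, star_smul, ha.star_eq]
  simp

lemma hasDerivAt_expI (a : B) (t : ℝ) : HasDerivAt (expI a) (Complex.I • a * expI a t) t :=
  hasDerivAt_exp_smul_const' (𝕂 := ℝ) (Complex.I • a) t

lemma star_expI {a : B} (ha : IsSelfAdjoint a) (t : ℝ) : star (expI a t) = expI a (-t) := by
  rw [expI, expI, NormedSpace.star_exp, star_smul, star_smul, ha.star_eq]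
  simp

lemma commute_expI_self (a : B) (t : ℝ) : Commute (expI a t) a :=
  (((Commute.refl a).smul_left _).smul_left _).exp_left

lemma norm_I_smul (a : B) : ‖Complex.I • a‖ = ‖a‖ := by simp [norm_smul]

lemma norm_expI_sub_expI_le {a : B} (ha : IsSelfAdjoint a) (s t : ℝ) :
    ‖expI a s - expI a t‖ ≤ ‖a‖ * |s - t| := by
  refine convex_univ.norm_image_sub_le_of_norm_hasDerivWithin_le (f := expI a)
    (fun r _ ↦ (hasDerivAt_expI a r).hasDerivWithinAt) (fun r _ ↦ ?_) (Set.mem_univ t)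
    (Set.mem_univ s)
  rw [CStarRing.norm_mul_mem_unitary _ (expI_mem_unitary ha r), norm_I_smul]

lemma norm_expI_sub_one_le {a : B} (ha : IsSelfAdjoint a) {t : ℝ} (ht : t ∈ Set.Icc (0 : ℝ) 1) :
    ‖expI a t - 1‖ ≤ ‖a‖ := by
  have hlip := norm_expI_sub_expI_le ha t 0
  rw [expI_zero, sub_zero, abs_of_nonneg ht.1] at hlip
  exact hlip.trans (mul_le_of_le_one_right (norm_nonneg _) ht.2)

lemma norm_expI_commutator_le {a : B} (ha : IsSelfAdjoint a) (f : B) {t : ℝ}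
    (ht : t ∈ Set.Icc (0 : ℝ) 1) : ‖expI a t * f - f * expI a t‖ ≤ ‖a * f - f * a‖ := by
  have hderiv (t : ℝ) : HasDerivAt (fun t ↦ expI a t * f * expI a (-t))
      (expI a t * (Complex.I • (a * f - f * a)) * expI a (-t)) t := by
    refine (((hasDerivAt_expI a t).mul_const f).mul
      ((hasDerivAt_expI a (-t)).scomp t (hasDerivAt_neg t))).congr_deriv ?_
    simp only [Function.comp_apply, smul_mul_assoc, mul_smul_comm, neg_smul, one_smul, mul_neg,
      mul_sub, sub_mul, smul_sub]
    rw [← mul_assoc (expI a t) a f, (commute_expI_self a t).eq, ← sub_eq_add_neg]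
    simp only [mul_assoc]
  have hconj := norm_image_sub_le_of_norm_deriv_le_segment' (C := ‖a * f - f * a‖)
    (fun t _ ↦ (hderiv t).hasDerivWithinAt)
    (fun t _ ↦ by
      rw [CStarRing.norm_mul_mem_unitary _ (expI_mem_unitary ha _),
        CStarRing.norm_mem_unitary_mul _ (expI_mem_unitary ha _), norm_I_smul]) t ht
  simp only [expI_zero, one_mul, neg_zero, mul_one, sub_zero] at hconj
  rw [← CStarRing.norm_mul_mem_unitary _ (expI_mem_unitary ha (-t)), sub_mul, mul_assoc f,
    ← star_expI ha, Unitary.mul_star_self_of_mem (expI_mem_unitary ha t), mul_one, star_expI ha]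
  exact hconj.trans (mul_le_of_le_one_right (norm_nonneg _) ht.2)

lemma norm_mul_commutator_le {u v : B} (hu : u ∈ unitary B) (hv : v ∈ unitary B) (f : B) :
    ‖u * v * f - f * (u * v)‖ ≤ ‖u * f - f * u‖ + ‖v * f - f * v‖ := by
  calc ‖u * v * f - f * (u * v)‖ = ‖(u * f - f * u) * v + u * (v * f - f * v)‖ := by
        congr 1; noncomm_ring
    _ ≤ ‖u * f - f * u‖ + ‖v * f - f * v‖ := by
      rw [← CStarRing.norm_mul_mem_unitary (u * f - f * u) hv,
        ← CStarRing.norm_mem_unitary_mul (v * f - f * v) hu]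
      exact norm_add_le _ _

lemma expI_two_pi_smul_of_isStarProjection {q : B} (hq : IsStarProjection q) :
    expI ((2 * Real.pi : ℝ) • q) 1 = 1 := by
  obtain ⟨hspec, _⟩ := isStarProjection_iff_spectrum_subset_and_isStarNormal.1 hq
  have hsmul : (1 : ℝ) • Complex.I • (2 * Real.pi : ℝ) • q = (2 * Real.pi * Complex.I) • q := by
    rw [one_smul, smul_comm, ← Complex.coe_smul, smul_smul]
    push_cast
    rfl
  rw [expI, hsmul, ← CFC.exp_eq_normedSpace_exp (𝕜 := ℂ), ← cfc_comp_smul _ _ q,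
    ← cfc_const_one ℂ q]
  refine cfc_congr fun z hz ↦ ?_
  rcases hspec hz with rfl | rfl
  · simp
  · simp [← Complex.exp_eq_exp_ℂ, Complex.exp_two_pi_mul_I]

theorem traceLog_expI {T : B →L[ℂ] ℂ} (hT : IsTracial T) {a : B} (ha : IsSelfAdjoint a)
    (ha1 : ‖a‖ < 1) : traceLog T (expI a 1) = Complex.I * T a := by
  rw [expI, one_smul, traceLog_exp hT, map_smul, smul_eq_mul]
  exact fun t ht ↦ (norm_expI_sub_one_le ha ht).trans_lt ha1

lemma norm_commutator_list_sum_le {a : B} {η : ℝ} :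
    ∀ {l : List B}, (∀ b ∈ l, ‖a * b - b * a‖ ≤ η) → ‖a * l.sum - l.sum * a‖ ≤ l.length * η
  | [], _ => by simp
  | b :: l, hl => by
    rw [List.forall_mem_cons] at hl
    calc ‖a * (b :: l).sum - (b :: l).sum * a‖
        = ‖(a * b - b * a) + (a * l.sum - l.sum * a)‖ := by
          rw [List.sum_cons]; congr 1; noncomm_ring
      _ ≤ η + l.length * η := norm_add_le_of_le hl.1 (norm_commutator_list_sum_le hl.2)
      _ = (b :: l).length * η := by push_cast [List.length_cons]; ring

lemma list_prod_expI_mem_unitary {l : List B} (hl : ∀ a ∈ l, IsSelfAdjoint a) (t : ℝ) :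
    (l.map (expI · t)).prod ∈ unitary B :=
  list_prod_mem fun x hx ↦ by
    obtain ⟨a, ha, rfl⟩ := List.mem_map.1 hx
    exact expI_mem_unitary (hl a ha) t

/-- When the generators almost commute, the product of the one-parameter groups is almost the
one-parameter group of the sum; a tracial functional sees no difference in the logarithmic
derivative. -/
lemma exists_hasDerivAt_list_prod_expI {T : B →L[ℂ] ℂ} (hT : IsTracial T) {η t : ℝ}
    (ht : t ∈ Set.Icc (0 : ℝ) 1) :
    ∀ {l : List B}, (∀ a ∈ l, IsSelfAdjoint a) → (∀ a ∈ l, ∀ b ∈ l, ‖a * b - b * a‖ ≤ η) →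
      ∃ d, HasDerivAt (fun t ↦ (l.map (expI · t)).prod) (Complex.I • d) t ∧
        ‖d - l.sum * (l.map (expI · t)).prod‖ ≤ l.length.choose 2 * η ∧
        T (star (l.map (expI · t)).prod * d) = T l.sum
  | [], _, _ => ⟨0, by simpa using hasDerivAt_const t (1 : B), by simp, by simp⟩
  | a :: l, hl, hcomm => by
    simp only [List.forall_mem_cons] at hl hcomm
    obtain ⟨d, hderiv, hnorm, htrace⟩ := exists_hasDerivAt_list_prod_expI hT ht hl.2
      fun b hb ↦ (hcomm.2 b hb).2
    set e := expI a t
    have he : e ∈ unitary B := expI_mem_unitary hl.1 t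
    have hea : e * a = a * e := commute_expI_self a t
    set p := (l.map (expI · t)).prod
    have hpu : p ∈ unitary B := list_prod_expI_mem_unitary hl.2 t
    simp only [List.map_cons, List.prod_cons, List.sum_cons, List.length_cons]
    refine ⟨a * e * p + e * d, ?_, ?_, ?_⟩
    · refine ((hasDerivAt_expI a t).mul hderiv).congr_deriv ?_
      rw [smul_add, mul_smul_comm, smul_mul_assoc, smul_mul_assoc]
    · have hsum : ‖e * l.sum - l.sum * e‖ ≤ l.length * η :=
        (norm_expI_commutator_le hl.1 _ ht).trans (norm_commutator_list_sum_le hcomm.1.2)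
      calc ‖a * e * p + e * d - (a + l.sum) * (e * p)‖
          = ‖(e * l.sum - l.sum * e) * p + e * (d - l.sum * p)‖ := by congr 1; noncomm_ring
        _ ≤ l.length * η + l.length.choose 2 * η := by
          refine norm_add_le_of_le ?_ ?_
          · rwa [CStarRing.norm_mul_mem_unitary _ hpu]
          · rwa [CStarRing.norm_mem_unitary_mul _ he]
        _ = (l.length + 1).choose 2 * η := by
          rw [Nat.choose_succ_succ' l.length 1, Nat.choose_one_right]; push_cast; ring
    · calc T (star (e * p) * (a * e * p + e * d))
          = T (star p * (star e * e) * a * p + star p * (star e * e) * d) := by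
            rw [← hea, star_mul]; congr 1; noncomm_ring
        _ = T (star p * (a * p)) + T (star p * d) := by
            rw [Unitary.star_mul_self_of_mem he, mul_one, mul_assoc, map_add]
        _ = T (a + l.sum) := by
            rw [hT, mul_assoc, Unitary.mul_star_self_of_mem hpu, mul_one, htrace, map_add]

theorem traceLog_list_prod_expI {T : B →L[ℂ] ℂ} (hT : IsTracial T) {l : List B}
    (hl : ∀ a ∈ l, IsSelfAdjoint a) (hsum : l.sum = 0) {η : ℝ} (hη : l.length.choose 2 * η < 1)
    (hcomm : ∀ a ∈ l, ∀ b ∈ l, ‖a * b - b * a‖ ≤ η) :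
    ‖(l.map (expI · 1)).prod - 1‖ ≤ l.length.choose 2 * η ∧
      traceLog T (l.map (expI · 1)).prod = 0 := by
  choose! d hderiv hnorm htrace using
    fun t ht ↦ exists_hasDerivAt_list_prod_expI (t := t) hT ht hl hcomm
  simp only [hsum, zero_mul, sub_zero, map_zero] at hnorm htrace
  have hC : 0 ≤ l.length.choose 2 * η := (norm_nonneg _).trans (hnorm 0 (by simp))
  have hzero : (l.map (expI · 0)).prod = 1 := by simp
  have hnear : ∀ t ∈ Set.Icc (0 : ℝ) 1,
      ‖(l.map (expI · t)).prod - 1‖ ≤ l.length.choose 2 * η := by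
    intro t ht
    have hseg := norm_image_sub_le_of_norm_deriv_le_segment'
      (fun t ht ↦ (hderiv t ht).hasDerivWithinAt)
      (fun t ht ↦ by rw [norm_I_smul]; exact hnorm t ⟨ht.1, ht.2.le⟩) t ht
    rw [hzero, sub_zero] at hseg
    exact hseg.trans (mul_le_of_le_one_right hC ht.2)
  refine ⟨hnear 1 (by simp), ?_⟩
  have hconst : ∀ t ∈ Set.Icc (0 : ℝ) 1,
      HasDerivWithinAt (fun t ↦ traceLog T (l.map (expI · t)).prod) 0 (Set.Icc 0 1) t := by
    intro t ht
    refine (hasDerivWithinAt_traceLog_comp hT (hderiv t ht).hasDerivWithinAt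
      ((hnear t ht).trans_lt hη)).congr_deriv ?_
    have hinv : Ring.inverse (l.map (expI · t)).prod = star (l.map (expI · t)).prod :=
      Ring.inverse_unit (Unitary.toUnits ⟨_, list_prod_expI_mem_unitary hl t⟩)
    rw [hinv, mul_smul_comm, map_smul, htrace t ht, smul_zero]
  simpa only [hzero, traceLog_one, sub_zero, sub_self] using
    sub_eq_sub_of_hasDerivWithinAt_eq zero_le_one hconst
      fun t _ ↦ hasDerivWithinAt_const t (Set.Icc (0 : ℝ) 1) (0 : ℂ)

end Exponential

section FunctionalCalculus

variable {B : Type*} [CStarAlgebra B] {S : StarSubalgebra ℂ B}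

lemma cfc_real_mem (hS : IsClosed (S : Set B)) {a : B} (ha : a ∈ S) (f : ℝ → ℝ) : cfc f a ∈ S :=
  have : IsClosed (S : Set B) := hS
  cfc_mem (𝕜 := ℝ) (𝕜' := ℂ) f ha

lemma cfc_complex_mem (hS : IsClosed (S : Set B)) {a : B} (ha : a ∈ S) (f : ℂ → ℂ) :
    cfc f a ∈ S :=
  have : IsClosed (S : Set B) := hS
  cfc_mem (𝕜 := ℂ) (𝕜' := ℂ) f ha

lemma exists_mem_expI_eq (hS : IsClosed (S : Set B)) {w : B} (hw : w ∈ unitary B) (hwS : w ∈ S)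
    (hfin : (spectrum ℂ w).Finite) :
    ∃ a ∈ S, IsSelfAdjoint a ∧ ‖a‖ ≤ Real.pi ∧ expI a 1 = w := by
  have harg : ContinuousOn (fun z : ℂ ↦ (z.arg : ℂ)) (spectrum ℂ w) := hfin.continuousOn _
  have hnormal : IsStarNormal w := isStarNormal_of_mem_unitary hw
  refine ⟨_, cfc_complex_mem hS hwS _, .cfc_arg w,
    Unitary.norm_argSelfAdjoint_le_pi ⟨w, hw⟩, ?_⟩
  rw [expI, one_smul, ← CFC.exp_eq_normedSpace_exp (𝕜 := ℂ), Function.comp_def,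
    ← cfc_comp_smul .., ← cfc_comp' ..]
  conv_rhs => rw [← cfc_id' ℂ w]
  refine cfc_congr fun z hz ↦ ?_
  have hz1 : ‖z‖ = 1 := spectrum.norm_eq_one_of_unitary hw hz
  have hpolar := Complex.norm_mul_exp_arg_mul_I z
  rwa [hz1, Complex.ofReal_one, one_mul, mul_comm, Complex.exp_eq_exp_ℂ] at hpolar

lemma abs_sub_one_le_of_mem_spectrum {b : B} (hb : IsSelfAdjoint b) {y : ℝ}
    (hy : y ∈ spectrum ℝ b) : |y - 1| ≤ ‖b - 1‖ := by
  have hcfc : cfc (fun y : ℝ ↦ y - 1) b = b - 1 := by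
    rw [cfc_sub (fun y ↦ y) (fun _ ↦ 1) b, cfc_id' ℝ b, cfc_const_one ℝ b]
  have hnorm := norm_apply_le_norm_cfc (fun y : ℝ ↦ y - 1) b hy
  rwa [hcfc, Real.norm_eq_abs] at hnorm

lemma abs_inv_sqrt_sub_one_le {y : ℝ} (hy : 1 / 2 ≤ y) : |(√y)⁻¹ - 1| ≤ |y - 1| := by
  have hsq : √y * √y = y := Real.mul_self_sqrt (by linarith)
  have hsqrt : 1 / 2 ≤ √y := Real.le_sqrt_of_sq_le (by linarith)
  have hfactor : (√y)⁻¹ - 1 = (1 - y) * (√y * (1 + √y))⁻¹ := by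
    field_simp
    linear_combination -hsq
  rw [hfactor, abs_mul, abs_sub_comm]
  refine mul_le_of_le_one_right (abs_nonneg _) ?_
  rw [abs_of_pos (by positivity)]
  exact inv_le_one_of_one_le₀ (by linarith)

lemma exists_isSelfAdjoint_mem_conj_eq_one (hS : IsClosed (S : Set B)) {b : B} (hbS : b ∈ S)
    (hb : IsSelfAdjoint b) (hb1 : ‖b - 1‖ ≤ 1 / 2) :
    ∃ c ∈ S, IsSelfAdjoint c ∧ c * b * c = 1 ∧ ‖c - 1‖ ≤ ‖b - 1‖ := by
  have hspec : ∀ y ∈ spectrum ℝ b, 1 / 2 ≤ y := fun y hy ↦ by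
    have := (abs_le.1 ((abs_sub_one_le_of_mem_spectrum hb hy).trans hb1)).1
    linarith
  let f : ℝ → ℝ := fun y ↦ (√y)⁻¹
  have hf : ContinuousOn f (spectrum ℝ b) :=
    Real.continuous_sqrt.continuousOn.inv₀ fun y hy ↦
      (Real.sqrt_pos.2 (by linarith [hspec y hy])).ne'
  refine ⟨cfc f b, cfc_real_mem hS hbS f, cfc_predicate f b, ?_, ?_⟩
  · have hcfc : cfc (fun y ↦ f y * y * f y) b = cfc f b * b * cfc f b := by
      rw [cfc_mul (fun y ↦ f y * y) f b, cfc_mul f (fun y ↦ y) b, cfc_id' ℝ b]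
    rw [← hcfc, ← cfc_const_one ℝ b]
    refine cfc_congr fun y hy ↦ ?_
    have hy0 := hspec y hy
    have hsq : √y * √y = y := Real.mul_self_sqrt (by linarith)
    have hne : √y ≠ 0 := (Real.sqrt_pos.2 (by linarith)).ne'
    simp only [f]
    field_simp
    linear_combination -hsq
  · have hcfc : cfc (fun y ↦ f y - 1) b = cfc f b - 1 := by
      rw [cfc_sub f (fun _ ↦ 1) b, cfc_const_one ℝ b]
    rw [← hcfc]
    exact norm_cfc_le (norm_nonneg _) fun y hy ↦
      (abs_inv_sqrt_sub_one_le (hspec y hy)).trans (abs_sub_one_le_of_mem_spectrum hb hy)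

/-- The unitary is the polar part `x (x* x)^(-1/2)` of `x`. -/
lemma exists_unitary_mem_near_of_isUnit (hS : IsClosed (S : Set B)) {x : B} (hxS : x ∈ S)
    (hx : IsUnit x) (hx1 : ‖star x * x - 1‖ ≤ 1 / 2) :
    ∃ w ∈ unitary B, w ∈ S ∧ ‖w - x‖ ≤ ‖x‖ * ‖star x * x - 1‖ := by
  obtain ⟨c, hcS, hc, hconj, hc1⟩ := exists_isSelfAdjoint_mem_conj_eq_one hS
    (mul_mem (star_mem hxS) hxS) (.star_mul_self x) hx1
  have hcunit : IsUnit c := isUnit_of_norm_sub_one_lt (by linarith)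
  refine ⟨x * c, (hx.mul hcunit).mem_unitary_of_star_mul_self ?_, mul_mem hxS hcS, ?_⟩
  · rw [star_mul, hc.star_eq, ← hconj]
    simp only [mul_assoc]
  · calc ‖x * c - x‖ = ‖x * (c - 1)‖ := by rw [mul_sub, mul_one]
      _ ≤ ‖x‖ * ‖star x * x - 1‖ := norm_mul_le_of_le le_rfl hc1

lemma norm_le_one_of_mem_unitary {u : B} (hu : u ∈ unitary B) : ‖u‖ ≤ 1 := by
  have hone := CStarRing.norm_mul_mem_unitary 1 hu
  rw [one_mul] at hone
  exact hone.trans_le (IsStarProjection.one B).norm_le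

lemma isUnit_of_norm_sub_unitary_lt {x u : B} (hu : u ∈ unitary B) (hxu : ‖x - u‖ < 1) :
    IsUnit x := by
  have hunit : IsUnit (x * star u) := isUnit_of_norm_sub_one_lt <| by
    rwa [← Unitary.mul_star_self_of_mem hu, ← sub_mul,
      CStarRing.norm_mul_mem_unitary _ (Unitary.star_mem hu)]
  have := hunit.mul (Unitary.toUnits ⟨u, hu⟩).isUnit
  rwa [Unitary.val_toUnits_apply, mul_assoc, Unitary.star_mul_self_of_mem hu, mul_one] at this

lemma norm_star_mul_self_sub_one_le {x u : B} (hu : u ∈ unitary B) :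
    ‖star x * x - 1‖ ≤ (‖x‖ + 1) * ‖x - u‖ := by
  calc ‖star x * x - 1‖ = ‖star x * (x - u) + star (x - u) * u‖ := by
        rw [star_sub, mul_sub, sub_mul, Unitary.star_mul_self_of_mem hu, sub_add_sub_cancel]
    _ ≤ ‖x‖ * ‖x - u‖ + ‖x - u‖ := by
        refine norm_add_le_of_le ?_ ?_
        · simpa only [norm_star] using norm_mul_le (star x) (x - u)
        · rw [CStarRing.norm_mul_mem_unitary _ hu, norm_star]
    _ = (‖x‖ + 1) * ‖x - u‖ := by ring

lemma exists_unitary_mem_near (hS : IsClosed (S : Set B)) {x u : B} (hxS : x ∈ S)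
    (hu : u ∈ unitary B) {δ : ℝ} (hδ : δ ≤ 1 / 8) (hxu : ‖x - u‖ ≤ δ) :
    ∃ w ∈ unitary B, w ∈ S ∧ ‖w - u‖ ≤ 4 * δ := by
  have hδ0 : 0 ≤ δ := (norm_nonneg _).trans hxu
  have hx : ‖x‖ ≤ 1 + δ := by
    have : ‖u‖ ≤ 1 := norm_le_one_of_mem_unitary hu
    linarith [norm_le_norm_add_norm_sub' x u]
  have hx1 : ‖star x * x - 1‖ ≤ 17 / 8 * δ := by
    refine (norm_star_mul_self_sub_one_le hu).trans ?_
    gcongr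
    linarith
  obtain ⟨w, hw, hwS, hwx⟩ := exists_unitary_mem_near_of_isUnit hS hxS
    (isUnit_of_norm_sub_unitary_lt hu (by linarith)) (by linarith)
  refine ⟨w, hw, hwS, ?_⟩
  calc ‖w - u‖ ≤ ‖w - x‖ + ‖x - u‖ := norm_sub_le_norm_sub_add_norm_sub _ _ _
    _ ≤ (1 + δ) * (17 / 8 * δ) + δ := by
      gcongr
      exact hwx.trans (by gcongr)
    _ ≤ 4 * δ := by nlinarith

lemma continuousOn_ite_lt_of_notMem {s : Set ℝ} {c : ℝ} (hc : c ∉ s) :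
    ContinuousOn (fun y : ℝ ↦ if c < y then (1 : ℝ) else 0) s := by
  have hfrontier : ∀ y ∈ s, y ∉ frontier {y : ℝ | c < y} := fun y hy hyc ↦ by
    rw [show {y : ℝ | c < y} = Set.Ioi c from rfl, frontier_Ioi, Set.mem_singleton_iff] at hyc
    exact hc (hyc ▸ hy)
  exact ContinuousOn.if' (fun y hy ↦ (hfrontier y hy.1 hy.2).elim)
    (fun y hy ↦ (hfrontier y hy.1 hy.2).elim) continuousOn_const continuousOn_const

lemma abs_ite_lt_sub_le (y : ℝ) : |(if 1 / 2 < y then 1 else 0) - y| ≤ 2 * |y * y - y| := by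
  rw [show y * y - y = y * (y - 1) by ring, abs_mul]
  split_ifs with h
  · have := le_abs_self y
    rw [abs_sub_comm]
    nlinarith [abs_nonneg (y - 1)]
  · have := neg_le_abs (y - 1)
    rw [zero_sub, abs_neg]
    nlinarith [abs_nonneg y]

/-- The projection is the spectral projection of `b` for the interval `(1/2, ∞)`. -/
lemma exists_isStarProjection_mem_near_of_isSelfAdjoint (hS : IsClosed (S : Set B)) {b : B}
    (hbS : b ∈ S) (hb : IsSelfAdjoint b) (hb1 : ‖b * b - b‖ < 1 / 4) :
    ∃ q ∈ S, IsStarProjection q ∧ ‖q - b‖ ≤ 2 * ‖b * b - b‖ := by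
  have hspec : ∀ y ∈ spectrum ℝ b, |y * y - y| ≤ ‖b * b - b‖ := fun y hy ↦ by
    have hcfc : cfc (fun y : ℝ ↦ y * y - y) b = b * b - b := by
      rw [cfc_sub (fun y ↦ y * y) (fun y ↦ y) b, cfc_mul (fun y ↦ y) (fun y ↦ y) b, cfc_id' ℝ b]
    have hnorm := norm_apply_le_norm_cfc (fun y : ℝ ↦ y * y - y) b hy
    rwa [hcfc, Real.norm_eq_abs] at hnorm
  have hgap : 1 / 2 ∉ spectrum ℝ b := fun h ↦ by
    have := (hspec _ h).trans_lt hb1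
    norm_num [abs_of_neg] at this
  let f : ℝ → ℝ := fun y ↦ if 1 / 2 < y then 1 else 0
  have hf : ContinuousOn f (spectrum ℝ b) := continuousOn_ite_lt_of_notMem hgap
  refine ⟨cfc f b, cfc_real_mem hS hbS f, ⟨?_, cfc_predicate f b⟩, ?_⟩
  · rw [IsIdempotentElem, ← cfc_mul f f b]
    exact cfc_congr fun y _ ↦ by simp [f]
  · have hcfc : cfc (fun y ↦ f y - y) b = cfc f b - b := by
      rw [cfc_sub f (fun y ↦ y) b, cfc_id' ℝ b]
    rw [← hcfc]
    refine norm_cfc_le (by positivity) fun y hy ↦ (abs_ite_lt_sub_le y).trans ?_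
    gcongr
    exact hspec y hy

lemma norm_mul_self_sub_self_le {b p : B} (hp : IsStarProjection p) :
    ‖b * b - b‖ ≤ (‖b‖ + 2) * ‖b - p‖ := by
  have hp1 : ‖p‖ ≤ 1 := hp.norm_le
  calc ‖b * b - b‖ = ‖b * (b - p) + (b - p) * p - (b - p)‖ := by
        rw [mul_sub, sub_mul, hp.isIdempotentElem.eq]; congr 1; abel
    _ ≤ ‖b‖ * ‖b - p‖ + ‖b - p‖ * 1 + ‖b - p‖ := by
        refine norm_sub_le_of_le (norm_add_le_of_le (norm_mul_le _ _) ?_) le_rfl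
        exact norm_mul_le_of_le le_rfl hp1
    _ = (‖b‖ + 2) * ‖b - p‖ := by ring

lemma exists_isStarProjection_mem_near (hS : IsClosed (S : Set B)) {a p : B} (ha : a ∈ S)
    (hp : IsStarProjection p) {δ : ℝ} (hδ : δ ≤ 1 / 32) (hap : ‖a - p‖ ≤ δ) :
    ∃ q ∈ S, IsStarProjection q ∧ ‖q - p‖ ≤ 9 * δ := by
  have : 0 ≤ δ := (norm_nonneg _).trans hap
  set b : B := (realPart a : B)
  have hb : IsSelfAdjoint b := (realPart a).2
  have hbS : b ∈ S := by
    rw [show b = _ from realPart_apply_coe a, ← Complex.coe_smul]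
    exact SMulMemClass.smul_mem _ (add_mem ha (star_mem ha))
  have hbp : ‖b - p‖ ≤ δ := by
    rw [← hp.isSelfAdjoint.coe_realPart, ← AddSubgroupClass.coe_sub, ← map_sub]
    exact (realPart.norm_le _).trans hap
  have hbnorm : ‖b‖ ≤ 1 + δ := by
    have : ‖p‖ ≤ 1 := hp.norm_le
    linarith [norm_le_norm_add_norm_sub' b p]
  have hb2 : ‖b * b - b‖ ≤ 4 * δ := by
    refine (norm_mul_self_sub_self_le hp).trans ?_
    gcongr
    linarith
  obtain ⟨q, hqS, hq, hqb⟩ := exists_isStarProjection_mem_near_of_isSelfAdjoint hS hbS hb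
    (by linarith)
  exact ⟨q, hqS, hq, by linarith [norm_sub_le_norm_sub_add_norm_sub q b p]⟩

lemma exists_units_mul_eq_mul_of_norm_sub_lt {p q : B} (hp : IsStarProjection p)
    (hq : IsStarProjection q) (hpq : ‖p - q‖ < 1 / 2) : ∃ z : Bˣ, p * z = z * q := by
  have hpp := hp.isIdempotentElem.eq
  have hqq := hq.isIdempotentElem.eq
  have hunit : IsUnit (p * q + (1 - p) * (1 - q)) := by
    refine isUnit_of_norm_sub_one_lt ?_
    calc ‖p * q + (1 - p) * (1 - q) - 1‖ = ‖p * (q - p) + (1 - p) * (p - q)‖ := by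
          simp only [mul_sub, sub_mul, mul_one, one_mul, hpp]; congr 1; abel
      _ ≤ 1 * ‖p - q‖ + 1 * ‖p - q‖ := by
          refine norm_add_le_of_le ?_ (norm_mul_le_of_le hp.one_sub.norm_le le_rfl)
          exact norm_mul_le_of_le hp.norm_le (norm_sub_rev q p).le
      _ < 1 := by linarith
  obtain ⟨z, hz⟩ := hunit
  refine ⟨z, ?_⟩
  rw [hz]
  simp only [mul_sub, sub_mul, mul_add, add_mul, mul_one, one_mul, mul_assoc, hqq]
  simp only [← mul_assoc, hpp]
  abel

lemma map_eq_of_isStarProjection_near {T : B → ℂ} (hT : IsTracial T) {p q : B}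
    (hp : IsStarProjection p) (hq : IsStarProjection q) (hpq : ‖p - q‖ < 1 / 2) : T p = T q := by
  obtain ⟨z, hz⟩ := exists_units_mul_eq_mul_of_norm_sub_lt hp hq hpq
  rw [← hT.map_units_conj z q, ← hz, Units.mul_inv_cancel_right]

section Orthogonal

variable {ι : Type*} [Fintype ι] {e : ι → B}

lemma mul_eq_zero_of_sum_eq_one (he : ∀ i, IsStarProjection (e i)) (hsum : ∑ i, e i = 1) {i j : ι}
    (hij : i ≠ j) : e j * e i = 0 := by
  classical
  let _ := CStarAlgebra.spectralOrder B
  have := CStarAlgebra.spectralOrderedRing B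
  have hsq (l : ι) : star (e l * e i) * (e l * e i) = e i * e l * e i := by
    rw [star_mul, (he l).isSelfAdjoint.star_eq, (he i).isSelfAdjoint.star_eq, mul_assoc,
      ← mul_assoc (e l) (e l), (he l).isIdempotentElem.eq, mul_assoc]
  have htotal : ∑ l, star (e l * e i) * (e l * e i) = e i := by
    simp_rw [hsq]
    rw [← Finset.sum_mul, ← Finset.mul_sum, hsum, mul_one, (he i).isIdempotentElem.eq]
  have hothers : ∑ l ∈ Finset.univ.erase i, star (e l * e i) * (e l * e i) = 0 := by
    rw [← Finset.add_sum_erase _ _ (Finset.mem_univ i), hsq i, (he i).isIdempotentElem.eq,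
      (he i).isIdempotentElem.eq] at htotal
    exact left_eq_add.1 htotal.symm
  rw [Finset.sum_eq_zero_iff_of_nonneg fun l _ ↦ star_mul_self_nonneg _] at hothers
  exact (CStarRing.star_mul_self_eq_zero_iff _).1 (hothers j (by simp [hij.symm]))

lemma mul_sum_conj (he : ∀ i, IsStarProjection (e i)) (hsum : ∑ i, e i = 1) (a : ι → B) (i : ι) :
    e i * ∑ j, e j * a j * e j = e i * a i * e i := by
  rw [Finset.mul_sum, Finset.sum_eq_single i]
  · rw [← mul_assoc, ← mul_assoc, (he i).isIdempotentElem.eq]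
  · intro j _ hj
    rw [← mul_assoc, ← mul_assoc, mul_eq_zero_of_sum_eq_one he hsum hj, zero_mul, zero_mul]
  · simp

lemma star_sum_conj_mul_self (he : ∀ i, IsStarProjection (e i)) (hsum : ∑ i, e i = 1)
    (a : ι → B) :
    star (∑ i, e i * a i * e i) * ∑ i, e i * a i * e i =
      ∑ i, e i * (star (e i * a i) * (e i * a i)) * e i := by
  set x := ∑ i, e i * a i * e i with hx
  calc star x * x = ∑ i, star x * (e i * e i) * x := by
        simp_rw [(he _).isIdempotentElem.eq]
        rw [← Finset.sum_mul, ← Finset.mul_sum, hsum, mul_one]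
    _ = ∑ i, star (e i * x) * (e i * x) := by
        refine Finset.sum_congr rfl fun i _ ↦ ?_
        rw [star_mul, (he i).isSelfAdjoint.star_eq]
        simp only [mul_assoc]
    _ = ∑ i, e i * (star (e i * a i) * (e i * a i)) * e i := by
        refine Finset.sum_congr rfl fun i _ ↦ ?_
        rw [hx, mul_sum_conj he hsum, star_mul (e i * a i), (he i).isSelfAdjoint.star_eq]
        simp only [mul_assoc]

lemma norm_sum_conj_le (he : ∀ i, IsStarProjection (e i)) (hsum : ∑ i, e i = 1) (a : ι → B)
    {c : ℝ} (hc : 0 ≤ c) (ha : ∀ i, ‖a i‖ ≤ c) : ‖∑ i, e i * a i * e i‖ ≤ c := by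
  let _ := CStarAlgebra.spectralOrder B
  have := CStarAlgebra.spectralOrderedRing B
  have hscalar : algebraMap ℝ B (c ^ 2) = ∑ i, e i * algebraMap ℝ B (c ^ 2) * e i := by
    simp_rw [← Algebra.commutes, mul_assoc, (he _).isIdempotentElem.eq]
    rw [← Finset.mul_sum, hsum, mul_one]
  have hle : star (∑ i, e i * a i * e i) * ∑ i, e i * a i * e i ≤ algebraMap ℝ B (c ^ 2) := by
    rw [star_sum_conj_mul_self he hsum, hscalar]
    refine Finset.sum_le_sum fun i _ ↦ ?_
    have hnorm : ‖e i * a i‖ ≤ c := by simpa using norm_mul_le_of_le (he i).norm_le (ha i)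
    have hsq : star (e i * a i) * (e i * a i) ≤ algebraMap ℝ B (c ^ 2) :=
      CStarAlgebra.star_mul_le_algebraMap_norm_sq.trans
        (algebraMap_mono B (pow_le_pow_left₀ (norm_nonneg _) hnorm 2))
    simpa only [(he i).isSelfAdjoint.star_eq] using star_left_conjugate_le_conjugate hsq (e i)
  have hsq := (CStarAlgebra.norm_le_iff_le_algebraMap _ (by positivity)
    (star_mul_self_nonneg _)).2 hle
  rw [CStarRing.norm_star_mul_self, ← sq] at hsq
  exact (sq_le_sq₀ (norm_nonneg _) hc).1 hsq

end Orthogonal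

end FunctionalCalculus

section Matrices

open Matrix

variable {n : Type*} [Fintype n]

lemma exists_natCast_eq_trace_of_isIdempotentElem {q : Matrix n n ℂ} (hq : IsIdempotentElem q) :
    ∃ r : ℕ, q.trace = r := by
  classical
  have hproj := LinearMap.IsIdempotentElem.isProj_range _ (hq.map (toLinAlgEquiv' (R := ℂ)))
  exact ⟨_, (trace_toLin'_eq q).symm.trans hproj.trace⟩

lemma trace_conjStarAlgAut [DecidableEq n] (U : unitary (Matrix n n ℂ)) (q : Matrix n n ℂ) :
    (Unitary.conjStarAlgAut ℂ _ U q).trace = q.trace := by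
  rw [Unitary.conjStarAlgAut_apply, trace_mul_cycle, Unitary.coe_star_mul_self, one_mul]

lemma exists_eq_conjStarAlgAut_diagonal_indicator [DecidableEq n] {e : Matrix n n ℂ}
    (he : IsStarProjection e) :
    ∃ (U : unitary (Matrix n n ℂ)) (s : Finset n),
      e = Unitary.conjStarAlgAut ℂ _ U (diagonal ((s : Set n).indicator 1)) := by
  have hherm : e.IsHermitian := he.isSelfAdjoint
  refine ⟨hherm.eigenvectorUnitary, Finset.univ.filter (hherm.eigenvalues · = 1), ?_⟩
  conv_lhs => rw [hherm.spectral_theorem]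
  congr 2
  ext i
  rcases he.isIdempotentElem.spectrum_subset ℝ (hherm.eigenvalues_mem_spectrum_real i) with h | h
  · simp [h]
  · simp_all

lemma isStarProjection_diagonal_indicator [DecidableEq n] (s : Set n) :
    IsStarProjection (diagonal (s.indicator 1) : Matrix n n ℂ) := by
  classical
  refine ⟨?_, ?_⟩
  · rw [IsIdempotentElem, diagonal_mul_diagonal]
    congr 1
    ext i
    simp [Set.indicator_apply]
  · rw [isSelfAdjoint_iff, star_eq_conjTranspose, diagonal_conjTranspose]
    congr 1
    ext i
    simp [Set.indicator_apply, apply_ite]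

lemma exists_isStarProjection_mul_eq_trace_eq {e : Matrix n n ℂ} (he : IsStarProjection e)
    {r j : ℕ} (hr : e.trace = r) (hj : j ≤ r) :
    ∃ p : Matrix n n ℂ, IsStarProjection p ∧ p * e = p ∧ p.trace = j := by
  classical
  have trace_indicator (s : Finset n) : (diagonal ((s : Set n).indicator (1 : n → ℂ))).trace =
      s.card := by
    simp [Set.indicator_apply]
  obtain ⟨U, s, rfl⟩ := exists_eq_conjStarAlgAut_diagonal_indicator he
  rw [trace_conjStarAlgAut, trace_indicator, Nat.cast_inj] at hr
  obtain ⟨t, hts, htj⟩ := Finset.exists_subset_card_eq (hr ▸ hj)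
  refine ⟨Unitary.conjStarAlgAut ℂ _ U (diagonal ((t : Set n).indicator 1)),
    (isStarProjection_diagonal_indicator _).map _, ?_, ?_⟩
  · rw [← map_mul, diagonal_mul_diagonal]
    congr 2
    ext i
    have := @hts i
    simp only [Set.indicator_apply, Finset.mem_coe, Pi.one_apply]
    split_ifs <;> simp_all
  · rw [trace_conjStarAlgAut, trace_indicator, htj]

end Matrices

/-- A presentation of `B` as a UHF algebra of type `k^∞`: the data whose existence `IsUHFPow k B`
asserts. -/
structure UHFSystem (k : ℕ) (B : Type*) [CStarAlgebra B] where
  φ : ∀ n : ℕ, Matrix (Fin (k ^ n)) (Fin (k ^ n)) ℂ →⋆ₐ[ℂ] B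
  two_le : 2 ≤ k
  injective : ∀ n, Function.Injective (φ n)
  range_subset_succ : ∀ n, Set.range (φ n) ⊆ Set.range (φ (n + 1))
  dense : Dense (⋃ n, Set.range (φ n))

namespace UHFSystem

variable {B : Type*} [CStarAlgebra B] {k : ℕ} (Φ : UHFSystem k B)

include Φ in
lemma pow_pos (n : ℕ) : 0 < k ^ n := Nat.pow_pos (by linarith [Φ.two_le])

section Subalgebras

/-- The `n`-th matrix subalgebra. -/
def alg (n : ℕ) : StarSubalgebra ℂ B := (Φ.φ n).range

lemma alg_mono : Monotone Φ.alg := monotone_nat_of_le_succ Φ.range_subset_succ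

lemma isClosed_alg (n : ℕ) : IsClosed (Φ.alg n : Set B) :=
  Submodule.closed_of_finiteDimensional (LinearMap.range (Φ.φ n).toAlgHom.toLinearMap)

lemma exists_near (x : B) {ε : ℝ} (hε : 0 < ε) : ∃ l, ∃ y ∈ Φ.alg l, ‖y - x‖ < ε := by
  obtain ⟨y, hyx, hy⟩ := Metric.dense_iff.1 Φ.dense x ε hε
  obtain ⟨l, hl⟩ := Set.mem_iUnion.1 hy
  exact ⟨l, y, hl, by rwa [Metric.mem_ball, dist_eq_norm] at hyx⟩

lemma exists_unitary_near {u : B} (hu : u ∈ unitary B) {ε : ℝ} (hε : 0 < ε) :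
    ∃ l₀, ∀ l ≥ l₀, ∃ w ∈ unitary B, w ∈ Φ.alg l ∧ ‖w - u‖ < ε := by
  obtain ⟨l, y, hy, hyu⟩ := Φ.exists_near u (show 0 < min (1 / 8) (ε / 5) by positivity)
  obtain ⟨w, hw, hwl, hwu⟩ := exists_unitary_mem_near (Φ.isClosed_alg l) hy hu
    (min_le_left _ (ε / 5)) hyu.le
  refine ⟨l, fun l' hl' ↦ ⟨w, hw, Φ.alg_mono hl' hwl, hwu.trans_lt ?_⟩⟩
  linarith [min_le_right (1 / 8) (ε / 5)]

lemma finite_spectrum {l : ℕ} {x : B} (hx : x ∈ Φ.alg l) : (spectrum ℂ x).Finite := by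
  obtain ⟨M, rfl⟩ := hx
  exact M.finite_spectrum.subset (AlgHom.spectrum_apply_subset (Φ.φ l) M)

/-- The commutant of the `m`-th matrix subalgebra. -/
def comm (m : ℕ) : StarSubalgebra ℂ B := StarSubalgebra.centralizer ℂ (Φ.alg m : Set B)

lemma mem_comm {m : ℕ} {x : B} : x ∈ Φ.comm m ↔ ∀ a ∈ Φ.alg m, a * x = x * a := by
  rw [comm, StarSubalgebra.mem_centralizer_iff]
  exact ⟨fun h a ha ↦ (h a ha).1, fun h a ha ↦ ⟨h a ha, h _ (star_mem ha)⟩⟩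

lemma isClosed_comm (m : ℕ) : IsClosed (Φ.comm m : Set B) := by
  have hinter : (Φ.comm m : Set B) = ⋂ a ∈ Φ.alg m, {x | a * x = x * a} := by
    ext x
    simp only [SetLike.mem_coe, mem_comm, Set.mem_iInter, Set.mem_ofPred_eq]
  rw [hinter]
  refine isClosed_biInter fun a _ ↦ isClosed_eq ?_ ?_ <;> fun_prop

lemma isClosed_alg_inf_comm (l m : ℕ) :
    IsClosed ((Φ.alg l ⊓ Φ.comm m : StarSubalgebra ℂ B) : Set B) :=
  (Φ.isClosed_alg l).inter (Φ.isClosed_comm m)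

end Subalgebras

section MatrixUnits

/-- The matrix units of the `m`-th matrix subalgebra. -/
def matrixUnit (m : ℕ) (i j : Fin (k ^ m)) : B := Φ.φ m (Matrix.single i j 1)

lemma matrixUnit_mul_matrixUnit (m : ℕ) (i j l : Fin (k ^ m)) :
    Φ.matrixUnit m i j * Φ.matrixUnit m j l = Φ.matrixUnit m i l := by
  simp [matrixUnit, ← map_mul]

lemma matrixUnit_mul_matrixUnit_of_ne (m : ℕ) {i j j' l : Fin (k ^ m)} (h : j ≠ j') :
    Φ.matrixUnit m i j * Φ.matrixUnit m j' l = 0 := by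
  rw [matrixUnit, matrixUnit, ← map_mul, Matrix.single_mul_single_of_ne (h := h), map_zero]

lemma star_matrixUnit (m : ℕ) (i j : Fin (k ^ m)) :
    star (Φ.matrixUnit m i j) = Φ.matrixUnit m j i := by
  rw [matrixUnit, matrixUnit, ← map_star, Matrix.star_eq_conjTranspose,
    Matrix.conjTranspose_single, star_one]

lemma sum_matrixUnit (m : ℕ) : ∑ i, Φ.matrixUnit m i i = 1 := by
  simp only [matrixUnit, ← map_sum, Matrix.sum_single_one, map_one]

lemma isStarProjection_matrixUnit (m : ℕ) (i : Fin (k ^ m)) :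
    IsStarProjection (Φ.matrixUnit m i i) :=
  ⟨Φ.matrixUnit_mul_matrixUnit m i i i, Φ.star_matrixUnit m i i⟩

lemma norm_matrixUnit_le (m : ℕ) (i j : Fin (k ^ m)) : ‖Φ.matrixUnit m i j‖ ≤ 1 := by
  have hcstar := CStarRing.norm_star_mul_self (x := Φ.matrixUnit m i j)
  rw [star_matrixUnit, matrixUnit_mul_matrixUnit] at hcstar
  nlinarith [(Φ.isStarProjection_matrixUnit m j).norm_le, norm_nonneg (Φ.matrixUnit m i j)]

lemma map_eq_sum_matrixUnit (m : ℕ) (M : Matrix (Fin (k ^ m)) (Fin (k ^ m)) ℂ) :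
    Φ.φ m M = ∑ i, ∑ j, M i j • Φ.matrixUnit m i j := by
  conv_lhs => rw [Matrix.matrix_eq_sum_single M]
  simp only [map_sum, matrixUnit, ← map_smul, Matrix.smul_single, smul_eq_mul, mul_one]

lemma mem_comm_of_matrixUnit {m : ℕ} {x : B}
    (h : ∀ i j, Φ.matrixUnit m i j * x = x * Φ.matrixUnit m i j) : x ∈ Φ.comm m := by
  rw [mem_comm]
  rintro _ ⟨M, rfl⟩
  change Φ.φ m M * x = x * Φ.φ m M
  simp only [map_eq_sum_matrixUnit, Finset.sum_mul, Finset.mul_sum, smul_mul_assoc,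
    mul_smul_comm, h]

lemma matrixUnit_mem_alg {m l : ℕ} (h : m ≤ l) (i j : Fin (k ^ m)) :
    Φ.matrixUnit m i j ∈ Φ.alg l :=
  Φ.alg_mono h ⟨_, rfl⟩

/-- The index of the first row. -/
def zero (m : ℕ) : Fin (k ^ m) := ⟨0, Φ.pow_pos m⟩

lemma matrixUnit_level_zero (i j : Fin (k ^ 0)) : Φ.matrixUnit 0 i j = 1 := by
  have : Subsingleton (Fin (k ^ 0)) := (finCongr (pow_zero k)).subsingleton
  rw [← Φ.sum_matrixUnit 0, Fintype.sum_subsingleton _ i, Subsingleton.elim j i]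

end MatrixUnits

section Spread

/-- The map `x ↦ ∑ i, e_{i0} x e_{0i}` of `B` onto the commutant of the `m`-th matrix subalgebra,
where `e_{ij}` are the matrix units of that subalgebra. -/
noncomputable def spread (m : ℕ) : B →ₗ[ℂ] B :=
  ∑ i, LinearMap.mulLeft ℂ (Φ.matrixUnit m i (Φ.zero m)) ∘ₗ
    LinearMap.mulRight ℂ (Φ.matrixUnit m (Φ.zero m) i)

lemma spread_apply (m : ℕ) (x : B) :
    Φ.spread m x = ∑ i, Φ.matrixUnit m i (Φ.zero m) * x * Φ.matrixUnit m (Φ.zero m) i := by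
  simp [spread, mul_assoc]

lemma spread_mem_comm (m : ℕ) (x : B) : Φ.spread m x ∈ Φ.comm m := by
  refine Φ.mem_comm_of_matrixUnit fun i j ↦ ?_
  rw [spread_apply, Finset.mul_sum, Finset.sum_mul,
    Finset.sum_eq_single_of_mem j (Finset.mem_univ j),
    Finset.sum_eq_single_of_mem i (Finset.mem_univ i)]
  · simp only [← mul_assoc, matrixUnit_mul_matrixUnit]
    simp only [mul_assoc, matrixUnit_mul_matrixUnit]
  · intro l _ hl
    rw [mul_assoc, matrixUnit_mul_matrixUnit_of_ne _ _ hl, mul_zero]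
  · intro l _ hl
    rw [← mul_assoc, ← mul_assoc, matrixUnit_mul_matrixUnit_of_ne _ _ hl.symm, zero_mul, zero_mul]

lemma spread_mem_alg {m l : ℕ} (h : m ≤ l) {x : B} (hx : x ∈ Φ.alg l) : Φ.spread m x ∈ Φ.alg l := by
  rw [spread_apply]
  exact sum_mem fun i _ ↦
    mul_mem (mul_mem (Φ.matrixUnit_mem_alg h _ _) hx) (Φ.matrixUnit_mem_alg h _ _)

lemma norm_spread_le (m : ℕ) (x : B) : ‖Φ.spread m x‖ ≤ (k : ℝ) ^ m * ‖x‖ := by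
  have hterm (i) :
      ‖Φ.matrixUnit m i (Φ.zero m) * x * Φ.matrixUnit m (Φ.zero m) i‖ ≤ ‖x‖ := by
    refine (norm_mul_le_of_le (norm_mul_le_of_le (Φ.norm_matrixUnit_le ..) le_rfl)
      (Φ.norm_matrixUnit_le ..)).trans_eq ?_
    ring
  rw [spread_apply]
  exact (norm_sum_le_of_le _ fun i _ ↦ hterm i).trans_eq (by simp)

lemma norm_spread_sub_le (m : ℕ) (x : B) {δ : ℝ}
    (h : ∀ i, ‖x * Φ.matrixUnit m (Φ.zero m) i - Φ.matrixUnit m (Φ.zero m) i * x‖ ≤ δ) :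
    ‖Φ.spread m x - x‖ ≤ (k : ℝ) ^ m * δ := by
  have hsub : Φ.spread m x - x = ∑ i, Φ.matrixUnit m i (Φ.zero m) *
      (x * Φ.matrixUnit m (Φ.zero m) i - Φ.matrixUnit m (Φ.zero m) i * x) := by
    simp only [mul_sub, ← mul_assoc, matrixUnit_mul_matrixUnit, Finset.sum_sub_distrib]
    rw [← Finset.sum_mul, sum_matrixUnit, one_mul, spread_apply]
  rw [hsub]
  refine (norm_sum_le_of_le _ fun i _ ↦
    norm_mul_le_of_le (Φ.norm_matrixUnit_le ..) (h i)).trans_eq (by simp)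

lemma exists_near_mem_comm (m : ℕ) (x : B) {η : ℝ} (hη : 0 < η)
    (h : ∀ i, ‖x * Φ.matrixUnit m (Φ.zero m) i - Φ.matrixUnit m (Φ.zero m) i * x‖ ≤
      η / 2 / (k : ℝ) ^ m) :
    ∃ l ≥ m, ∃ y ∈ Φ.alg l ⊓ Φ.comm m, ‖y - x‖ ≤ η := by
  have hk : (0 : ℝ) < (k : ℝ) ^ m := by exact_mod_cast Φ.pow_pos m
  obtain ⟨l, y, hy, hyx⟩ := Φ.exists_near x (show 0 < η / 2 / (k : ℝ) ^ m by positivity)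
  refine ⟨max l m, le_max_right _ _, Φ.spread m y, ⟨Φ.spread_mem_alg (le_max_right _ _)
    (Φ.alg_mono (le_max_left _ _) hy), Φ.spread_mem_comm m y⟩, ?_⟩
  calc ‖Φ.spread m y - x‖ = ‖Φ.spread m (y - x) + (Φ.spread m x - x)‖ := by
        rw [map_sub, sub_add_sub_cancel]
    _ ≤ (k : ℝ) ^ m * (η / 2 / (k : ℝ) ^ m) + (k : ℝ) ^ m * (η / 2 / (k : ℝ) ^ m) :=
        norm_add_le_of_le ((Φ.norm_spread_le m _).trans (by gcongr)) (Φ.norm_spread_sub_le m x h)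
    _ = η := by field_simp; ring

lemma exists_mem_comm_norm_expI_sub_le (m : ℕ) {η : ℝ} (hη : 0 < η) : ∃ δ > 0, ∀ u ∈ unitary B,
    (∀ i, ‖u * Φ.matrixUnit m (Φ.zero m) i - Φ.matrixUnit m (Φ.zero m) i * u‖ ≤ δ) →
    ∃ a ∈ Φ.comm m, IsSelfAdjoint a ∧ ‖a‖ ≤ Real.pi ∧ ‖expI a 1 - u‖ ≤ η := by
  have hk : (0 : ℝ) < (k : ℝ) ^ m := by exact_mod_cast Φ.pow_pos m
  have hη' : 0 < min (1 / 8) (η / 4) := by positivity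
  refine ⟨min (1 / 8) (η / 4) / 2 / (k : ℝ) ^ m, by positivity, fun u hu h ↦ ?_⟩
  obtain ⟨l, -, y, hy, hyu⟩ := Φ.exists_near_mem_comm m u hη' h
  obtain ⟨w, hw, hwS, hwu⟩ := exists_unitary_mem_near (Φ.isClosed_alg_inf_comm l m) hy hu
    (min_le_left _ _) hyu
  obtain ⟨a, haS, ha, haπ, rfl⟩ := exists_mem_expI_eq (Φ.isClosed_alg_inf_comm l m) hw hwS
    (Φ.finite_spectrum hwS.1)
  exact ⟨a, haS.2, ha, haπ, by linarith [min_le_right (1 / 8) (η / 4)]⟩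

end Spread

section Trace

variable {T : B →ₗ[ℂ] ℂ}

lemma trace_matrixUnit_of_ne (hT : IsTracial T) {l : ℕ} {i j : Fin (k ^ l)} (hij : i ≠ j) :
    T (Φ.matrixUnit l i j) = 0 := by
  rw [← Φ.matrixUnit_mul_matrixUnit l i i j, hT, matrixUnit_mul_matrixUnit_of_ne _ _ hij.symm,
    map_zero]

lemma trace_matrixUnit_self (hT : IsTracial T) (h1 : T 1 = 1) (l : ℕ) (i : Fin (k ^ l)) :
    T (Φ.matrixUnit l i i) = ((k : ℂ) ^ l)⁻¹ := by
  have heq (j) : T (Φ.matrixUnit l j j) = T (Φ.matrixUnit l i i) := by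
    rw [← Φ.matrixUnit_mul_matrixUnit l j i j, hT, matrixUnit_mul_matrixUnit]
  have hsum := congrArg T (Φ.sum_matrixUnit l)
  simp only [map_sum, heq, h1, Finset.sum_const, Finset.card_univ, Fintype.card_fin, nsmul_eq_mul,
    Nat.cast_pow] at hsum
  exact eq_inv_of_mul_eq_one_right hsum

lemma trace_map (hT : IsTracial T) (h1 : T 1 = 1) (l : ℕ)
    (M : Matrix (Fin (k ^ l)) (Fin (k ^ l)) ℂ) : T (Φ.φ l M) = M.trace / (k : ℂ) ^ l := by
  rw [map_eq_sum_matrixUnit, map_sum, Matrix.trace, Finset.sum_div]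
  refine Finset.sum_congr rfl fun i _ ↦ ?_
  rw [map_sum, Finset.sum_eq_single_of_mem i (Finset.mem_univ i) fun j _ hj ↦ by
    rw [map_smul, Φ.trace_matrixUnit_of_ne hT hj.symm, smul_zero]]
  rw [map_smul, Φ.trace_matrixUnit_self hT h1, smul_eq_mul, div_eq_mul_inv, Matrix.diag_apply]

include Φ in
lemma trace_unique {T' : B →ₗ[ℂ] ℂ} (hT : IsTracial T) (h1 : T 1 = 1) (hc : Continuous T)
    (hT' : IsTracial T') (h1' : T' 1 = 1) (hc' : Continuous T') : T = T' := by
  refine DFunLike.coe_injective (Continuous.ext_on Φ.dense hc hc' fun x hx ↦ ?_)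
  obtain ⟨l, M, rfl⟩ := Set.mem_iUnion.1 hx
  rw [Φ.trace_map hT h1, Φ.trace_map hT' h1']

lemma exists_mem_alg_isStarProjection_mul_eq (hT : IsTracial T) (h1 : T 1 = 1) {l : ℕ} {e : B}
    (he : IsStarProjection e) (hel : e ∈ Φ.alg l) {j : ℕ}
    (hj : (j : ℝ) / (k : ℝ) ^ l ≤ (T e).re) :
    ∃ p ∈ Φ.alg l, IsStarProjection p ∧ p * e = p ∧ T p = j / (k : ℂ) ^ l := by
  have hk : (0 : ℝ) < (k : ℝ) ^ l := by exact_mod_cast Φ.pow_pos l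
  obtain ⟨M, rfl⟩ := hel
  change _ ≤ (T (Φ.φ l M)).re at hj
  have hM : IsStarProjection M := ⟨Φ.injective l (by rw [map_mul]; exact he.isIdempotentElem),
    Φ.injective l (by rw [map_star]; exact he.isSelfAdjoint)⟩
  obtain ⟨r, hr⟩ := exists_natCast_eq_trace_of_isIdempotentElem hM.isIdempotentElem
  have hre : (T (Φ.φ l M)).re = r / (k : ℝ) ^ l := by
    rw [Φ.trace_map hT h1, hr]
    norm_cast
    rw [Complex.div_natCast_re, Complex.natCast_re]
  rw [hre, div_le_div_iff_of_pos_right hk, Nat.cast_le] at hj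
  obtain ⟨P, hP, hPM, hPtrace⟩ := exists_isStarProjection_mul_eq_trace_eq hM hr hj
  refine ⟨Φ.φ l P, ⟨P, rfl⟩, hP.map _, ?_, by rw [Φ.trace_map hT h1, hPtrace]⟩
  change Φ.φ l P * Φ.φ l M = _
  rw [← map_mul, hPM]

end Trace

end UHFSystem

/-- The subgroup `ℤ[1/k]` of `ℝ`, which is `τ(K₀(B))` for the trace `τ` of a UHF algebra `B` of type
`k^∞`. -/
def kAdic (k : ℕ) : AddSubgroup ℝ where
  carrier := {r | ∃ (l : ℕ) (z : ℤ), r * (k : ℝ) ^ l = z}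
  zero_mem' := ⟨0, 0, by simp⟩
  add_mem' := by
    rintro a b ⟨l, z, h⟩ ⟨l', z', h'⟩
    refine ⟨l + l', z * k ^ l' + z' * k ^ l, ?_⟩
    push_cast
    rw [← h, ← h']
    ring
  neg_mem' := by
    rintro a ⟨l, z, h⟩
    exact ⟨l, -z, by push_cast; rw [← h]; ring⟩

lemma natCast_div_pow_mem_kAdic (k r l : ℕ) : (r / (k : ℝ) ^ l : ℝ) ∈ kAdic k := by
  rcases eq_or_ne ((k : ℝ) ^ l) 0 with h | h
  · rw [h, div_zero]
    exact zero_mem _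
  · exact ⟨l, r, by rw [div_mul_cancel₀ _ h, Int.cast_natCast]⟩

lemma exists_natCast_eq_sum_trace_of_isIdempotentElem {ι n : Type*} [Fintype ι] [Fintype n]
    {M : Matrix ι ι (Matrix n n ℂ)} (hM : IsIdempotentElem M) :
    ∃ r : ℕ, ∑ i, (M i i).trace = r := by
  obtain ⟨r, hr⟩ :=
    exists_natCast_eq_trace_of_isIdempotentElem (hM.map (Matrix.compRingEquiv ι n ℂ))
  refine ⟨r, hr ▸ ?_⟩
  simp [Matrix.trace, Fintype.sum_prod_type]

lemma IsTracial.sum_diag {B : Type*} [NonUnitalCStarAlgebra B] {T : B →ₗ[ℂ] ℂ} (hT : IsTracial T)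
    (ι : Type*) [Fintype ι] : IsTracial fun x : CStarMatrix ι ι B ↦ ∑ i, T (x i i) := by
  intro x y
  simp only [CStarMatrix.mul_apply, map_sum]
  rw [Finset.sum_comm]
  exact Finset.sum_congr rfl fun i _ ↦ Finset.sum_congr rfl fun j _ ↦ hT _ _

lemma hasDerivAt_det_one_add_smul {n : Type*} [Fintype n] [DecidableEq n] (D : Matrix n n ℂ) :
    HasDerivAt (fun z : ℂ ↦ (1 + z • D).det) D.trace 0 := by
  have heval (z : ℂ) : (1 + z • D).det =
      (1 + (Polynomial.X : Polynomial ℂ) • D.map Polynomial.C).det.eval z := by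
    rw [← Polynomial.coe_evalRingHom, RingHom.map_det]
    congr 1
    ext i j
    by_cases hij : i = j <;> simp [hij, mul_comm z]
  simp only [heval, ← Matrix.derivative_det_one_add_X_smul D]
  exact Polynomial.hasDerivAt _ _

lemma hasDerivAt_det_lineMap {n : Type*} [Fintype n] [DecidableEq n] {A : Matrix n n ℂ} {t : ℝ}
    (h : IsUnit (AffineMap.lineMap 1 A t)) :
    HasDerivAt (fun s : ℝ ↦ (AffineMap.lineMap 1 A s).det)
      ((AffineMap.lineMap 1 A t).det * ((AffineMap.lineMap 1 A t)⁻¹ * (A - 1)).trace) t := by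
  set Q : Matrix n n ℂ := AffineMap.lineMap 1 A t with hQ
  have hdet : IsUnit Q.det := (Matrix.isUnit_iff_isUnit_det _).1 h
  have hfactor (s : ℝ) : (AffineMap.lineMap 1 A s).det =
      Q.det * (1 + (↑(s - t) : ℂ) • (Q⁻¹ * (A - 1))).det := by
    rw [← Matrix.det_mul, mul_add, mul_one, mul_smul_comm, ← mul_assoc,
      Matrix.mul_nonsing_inv _ hdet, one_mul, hQ]
    congr 1
    rw [AffineMap.lineMap_apply_module', AffineMap.lineMap_apply_module', Complex.coe_smul]
    module
  have hshift : HasDerivAt (fun s : ℝ ↦ (↑(s - t) : ℂ)) 1 t := by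
    exact_mod_cast ((hasDerivAt_id t).sub_const t).ofReal_comp
  have h0 := hasDerivAt_det_one_add_smul (Q⁻¹ * (A - 1))
  rw [← Complex.ofReal_zero, ← sub_self t] at h0
  simp only [hfactor]
  exact ((h0.comp t hshift).congr_deriv (mul_one _)).const_mul _

namespace UHFSystem

variable {B : Type*} [CStarAlgebra B] {k : ℕ} (Φ : UHFSystem k B)

section TraceK0

variable (ι : Type*) [Fintype ι] [DecidableEq ι] [PartialOrder B] [StarOrderedRing B]

/-- The algebra of `ι × ι` matrices with entries in the `l`-th matrix subalgebra. It is taken inside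
`CStarMatrix`, whose norm is that of the C⋆-algebra of `ι × ι` matrices over `B`. -/
noncomputable def matrixAlg (l : ℕ) : StarSubalgebra ℂ (CStarMatrix ι ι B) where
  carrier := {x | ∀ i j, x i j ∈ Φ.alg l}
  mul_mem' {x y} hx hy i j := by
    rw [CStarMatrix.mul_apply]
    exact sum_mem fun s _ ↦ mul_mem (hx i s) (hy s j)
  add_mem' hx hy i j := add_mem (hx i j) (hy i j)
  algebraMap_mem' r i j := by
    rw [CStarMatrix.algebraMap_apply]
    split_ifs
    · exact algebraMap_mem _ r
    · exact zero_mem _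
  star_mem' {x} hx i j := by
    rw [CStarMatrix.star_apply]
    exact star_mem (hx j i)

lemma isClosed_matrixAlg (l : ℕ) : IsClosed (Φ.matrixAlg ι l : Set (CStarMatrix ι ι B)) := by
  have hcont (i j : ι) : Continuous fun x : CStarMatrix ι ι B ↦ x i j :=
    (continuous_apply_apply i j : Continuous fun x : ι → ι → B ↦ x i j)
  have hinter : (Φ.matrixAlg ι l : Set (CStarMatrix ι ι B)) =
      ⋂ i, ⋂ j, {x | x i j ∈ (Φ.alg l : Set B)} := by
    ext x
    simp only [Set.mem_iInter]
    rfl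
  rw [hinter]
  exact isClosed_iInter fun i ↦ isClosed_iInter fun j ↦ (Φ.isClosed_alg l).preimage (hcont i j)

variable {ι}

lemma exists_near_matrixAlg (p : CStarMatrix ι ι B) {ε : ℝ} (hε : 0 < ε) :
    ∃ l, ∃ a ∈ Φ.matrixAlg ι l, ‖a - p‖ < ε := by
  have hdense : Dense (X := CStarMatrix ι ι B) (Set.univ.pi fun _ ↦ Set.univ.pi fun _ ↦
      ⋃ l, Set.range (Φ.φ l)) :=
    dense_pi (α := fun _ : ι ↦ ι → B) _ fun _ _ ↦ dense_pi _ fun _ _ ↦ Φ.dense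
  obtain ⟨a, hap, ha⟩ := Metric.dense_iff.1 hdense p ε hε
  have hmem (i j : ι) : ∃ l, a i j ∈ Φ.alg l :=
    Set.mem_iUnion.1 (ha i (Set.mem_univ i) j (Set.mem_univ j))
  choose l hl using hmem
  exact ⟨Finset.univ.sup fun i ↦ Finset.univ.sup fun j ↦ l i j, a, fun i j ↦ Φ.alg_mono
    ((Finset.le_sup (f := l i) (Finset.mem_univ j)).trans
      (Finset.le_sup (f := fun i ↦ Finset.univ.sup (l i)) (Finset.mem_univ i))) (hl i j),
    by rwa [Metric.mem_ball, dist_eq_norm] at hap⟩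

lemma exists_sum_trace_eq_of_isStarProjection_mem_matrixAlg {T : B →ₗ[ℂ] ℂ} (hT : IsTracial T)
    (h1 : T 1 = 1) {l : ℕ} {q : CStarMatrix ι ι B} (hq : IsStarProjection q)
    (hql : q ∈ Φ.matrixAlg ι l) : ∃ r : ℕ, ∑ i, T (q i i) = (r / (k : ℝ) ^ l : ℝ) := by
  choose M hM using hql
  replace hM : ∀ i j, Φ.φ l (M i j) = q i j := hM
  have hidem : IsIdempotentElem (Matrix.of M) := by
    refine Matrix.ext fun i j ↦ Φ.injective l ?_
    have hq' := congrFun (congrFun hq.isIdempotentElem i) j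
    simpa only [CStarMatrix.mul_apply, Matrix.mul_apply, Matrix.of_apply, map_sum, map_mul, hM]
      using hq'
  obtain ⟨r, hr⟩ := exists_natCast_eq_sum_trace_of_isIdempotentElem hidem
  refine ⟨r, ?_⟩
  push_cast
  simp only [← hM, Φ.trace_map hT h1, ← Finset.sum_div, ← hr, Matrix.of_apply]

end TraceK0

include Φ in
lemma re_sum_trace_mem_kAdic {T : B →ₗ[ℂ] ℂ} (hT : IsTracial T) (h1 : T 1 = 1) {ι : Type*}
    [Fintype ι] {p : Matrix ι ι B} (hp : IsStarProjection p) :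
    (∑ i, T (p i i)).re ∈ kAdic k := by
  let _ := CStarAlgebra.spectralOrder B
  have := CStarAlgebra.spectralOrderedRing B
  classical
  rcases isEmpty_or_nonempty ι
  · simp
  have hP : IsStarProjection (CStarMatrix.ofMatrix p) := ⟨hp.isIdempotentElem, hp.isSelfAdjoint⟩
  obtain ⟨l, a, ha, hap⟩ := Φ.exists_near_matrixAlg (CStarMatrix.ofMatrix p)
    (show (0 : ℝ) < 1 / 32 by norm_num)
  obtain ⟨q, hql, hq, hqp⟩ := exists_isStarProjection_mem_near (Φ.isClosed_matrixAlg ι l) ha hP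
    le_rfl hap.le
  have htrace : ∑ i, T (q i i) = ∑ i, T (p i i) :=
    map_eq_of_isStarProjection_near (hT.sum_diag ι) hq hP (hqp.trans_lt (by norm_num))
  obtain ⟨r, hr⟩ := Φ.exists_sum_trace_eq_of_isStarProjection_mem_matrixAlg hT h1 hq hql
  rw [← htrace, hr, Complex.ofReal_re]
  exact natCast_div_pow_mem_kAdic k r l

include Φ in
theorem traceK0_le_kAdic {T : B →ₗ[ℂ] ℂ} (hT : IsTracial T) (h1 : T 1 = 1) :
    traceK0 T ≤ kAdic k := by
  rw [traceK0, AddSubgroup.closure_le]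
  rintro _ ⟨n, p, hp, rfl⟩
  exact Φ.re_sum_trace_mem_kAdic hT h1 hp

section Det

lemma isUnit_of_isUnit_map {l : ℕ} {M : Matrix (Fin (k ^ l)) (Fin (k ^ l)) ℂ}
    (h : IsUnit (Φ.φ l M)) : IsUnit M := by
  refine IsArtinianRing.isUnit_iff_isRightRegular.2 fun x y hxy ↦ Φ.injective l ?_
  refine h.isRegular.right ?_
  simpa only [map_mul] using congrArg (Φ.φ l) hxy

lemma map_lineMap (l : ℕ) (M : Matrix (Fin (k ^ l)) (Fin (k ^ l)) ℂ) (t : ℝ) :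
    Φ.φ l (AffineMap.lineMap 1 M t) = AffineMap.lineMap 1 (Φ.φ l M) t := by
  simp only [AffineMap.lineMap_apply_module', ← Complex.coe_smul, map_add, map_smul, map_sub,
    map_one]

lemma inverse_map {l : ℕ} {M : Matrix (Fin (k ^ l)) (Fin (k ^ l)) ℂ} (hM : IsUnit M) :
    Ring.inverse (Φ.φ l M) = Φ.φ l M⁻¹ := by
  have hdet := (Matrix.isUnit_iff_isUnit_det _).1 hM
  refine Ring.inverse_unit ⟨_, _, ?_, ?_⟩
  · rw [← map_mul, Matrix.mul_nonsing_inv _ hdet, map_one]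
  · rw [← map_mul, Matrix.nonsing_inv_mul _ hdet, map_one]

variable {T : B →L[ℂ] ℂ}

lemma hasDerivWithinAt_traceLog_map_lineMap (hT : IsTracial T) (h1 : T 1 = 1) {l : ℕ}
    {M : Matrix (Fin (k ^ l)) (Fin (k ^ l)) ℂ} (hM : ‖Φ.φ l M - 1‖ < 1) {t : ℝ}
    (ht : t ∈ Set.Icc (0 : ℝ) 1) (hunit : IsUnit (AffineMap.lineMap 1 M t)) :
    HasDerivWithinAt (fun s ↦ traceLog T (Φ.φ l (AffineMap.lineMap 1 M s)))
      (((AffineMap.lineMap 1 M t)⁻¹ * (M - 1)).trace / (k : ℂ) ^ l) (Set.Icc (0 : ℝ) 1) t := by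
  simp only [map_lineMap]
  refine (hasDerivWithinAt_traceLog_lineMap hT hM ht).congr_deriv ?_
  rw [← map_lineMap, Φ.inverse_map hunit, ← map_one (Φ.φ l), ← map_sub, ← map_mul]
  exact Φ.trace_map (T := (T : B →ₗ[ℂ] ℂ)) hT h1 l _

theorem det_eq_exp_traceLog (hT : IsTracial T) (h1 : T 1 = 1) {l : ℕ}
    {M : Matrix (Fin (k ^ l)) (Fin (k ^ l)) ℂ} (hM : ‖Φ.φ l M - 1‖ < 1) :
    M.det = Complex.exp ((k : ℂ) ^ l * traceLog T (Φ.φ l M)) := by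
  have hk : ((k : ℂ) ^ l) ≠ 0 := by exact_mod_cast (Φ.pow_pos l).ne'
  have hderiv : ∀ t ∈ Set.Icc (0 : ℝ) 1, HasDerivWithinAt (fun t : ℝ ↦
      (AffineMap.lineMap 1 M t).det *
        Complex.exp (-((k : ℂ) ^ l * traceLog T (Φ.φ l (AffineMap.lineMap 1 M t)))))
      0 (Set.Icc (0 : ℝ) 1) t := fun t ht ↦ by
    have hunit : IsUnit (AffineMap.lineMap 1 M t) := Φ.isUnit_of_isUnit_map <|
      isUnit_of_norm_sub_one_lt <| by
        rw [map_lineMap]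
        exact (norm_lineMap_one_sub_one_le _ ht).trans_lt hM
    refine ((hasDerivAt_det_lineMap hunit).hasDerivWithinAt.mul
      ((Φ.hasDerivWithinAt_traceLog_map_lineMap hT h1 hM ht hunit).const_mul
        ((k : ℂ) ^ l)).neg.cexp).congr_deriv ?_
    field_simp
    ring
  have hconst := sub_eq_sub_of_hasDerivWithinAt_eq zero_le_one hderiv
    (fun t _ ↦ hasDerivWithinAt_const t _ (0 : ℂ))
  simp only [AffineMap.lineMap_apply_one, AffineMap.lineMap_apply_zero, map_one, traceLog_one,
    Matrix.det_one, mul_zero, neg_zero, Complex.exp_zero, mul_one, sub_self, sub_eq_zero] at hconst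
  rw [Complex.exp_neg] at hconst
  exact (mul_inv_eq_one₀ (Complex.exp_ne_zero _)).1 hconst

end Det

end UHFSystem

section TraceFunctional

variable {B : Type*} [CStarAlgebra B]

/-- A tracial state, bundled as a continuous functional, with positivity weakened to compatibility
with the involution, which is all the determinant needs. -/
structure IsTraceFunctional (T : B →L[ℂ] ℂ) : Prop where
  isTracial : IsTracial T
  map_one : T 1 = 1
  map_star : ∀ a, T (star a) = star (T a)

lemma IsTracialState.exists_isTraceFunctional {τ : B →ₗ[ℂ] ℂ} (hτ : IsTracialState τ) :
    ∃ T : B →L[ℂ] ℂ, IsTraceFunctional T ∧ (T : B →ₗ[ℂ] ℂ) = τ := by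
  let _ := CStarAlgebra.spectralOrder B
  have := CStarAlgebra.spectralOrderedRing B
  let f : B →ₚ[ℂ] ℂ := PositiveLinearMap.mk₀ τ fun x hx ↦ by
    obtain ⟨b, rfl⟩ := CStarAlgebra.nonneg_iff_eq_star_mul_self.1 hx
    exact hτ.nonneg b
  exact ⟨⟨τ, map_continuous f⟩, ⟨hτ.map_mul_comm, hτ.map_one, map_star f⟩, rfl⟩

variable {k : ℕ} {T : B →L[ℂ] ℂ}

lemma IsTraceFunctional.map_starAlgEquiv (hT : IsTraceFunctional T) (Φ : UHFSystem k B)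
    (β : B ≃⋆ₐ[ℂ] B) (a : B) : T (β a) = T a := by
  have hβ : Continuous β := (NonUnitalStarAlgHom.isometry β β.injective).continuous
  have htracial : IsTracial ((T : B →ₗ[ℂ] ℂ) ∘ₗ (β : B →ₗ[ℂ] B)) := fun a b ↦ by
    simp [hT.isTracial (β a)]
  exact LinearMap.congr_fun (Φ.trace_unique htracial (by simp [hT.map_one])
    (T.continuous.comp hβ) hT.isTracial hT.map_one T.continuous) a

lemma traceLog_map (β : B ≃⋆ₐ[ℂ] B) (hβ : ∀ a, T (β a) = T a) (a : B) :
    traceLog T (β a) = traceLog T a := by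
  have hpow (n : ℕ) : T ((1 - β a) ^ n) = T ((1 - a) ^ n) := by
    rw [← hβ ((1 - a) ^ n), map_pow β, map_sub β, map_one β]
  simp only [traceLog, hpow]

end TraceFunctional

variable {B : Type*} [CStarAlgebra B] {k : ℕ}

section Increments

variable {T : B →L[ℂ] ℂ}

lemma norm_star_mul_sub_one {x : B} (hx : x ∈ unitary B) (y : B) :
    ‖star x * y - 1‖ = ‖y - x‖ := by
  rw [← Unitary.star_mul_self_of_mem hx, ← mul_sub,
    CStarRing.norm_mem_unitary_mul _ (Unitary.star_mem hx)]

lemma norm_mul_star_sub_one {x : B} (hx : x ∈ unitary B) (y : B) :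
    ‖y * star x - 1‖ = ‖y - x‖ := by
  rw [← Unitary.mul_star_self_of_mem hx, ← sub_mul,
    CStarRing.norm_mul_mem_unitary _ (Unitary.star_mem hx)]

lemma traceLog_conj_of_mem_unitary (hT : IsTracial T) {u : B} (hu : u ∈ unitary B) (a : B) :
    traceLog T (u * a * star u) = traceLog T a :=
  traceLog_units_conj hT (Unitary.toUnits ⟨u, hu⟩) a

lemma traceLog_mul_of_le (hT : IsTracial T) {a b : B} (ha : ‖a - 1‖ ≤ 2 / 5)
    (hb : ‖b - 1‖ ≤ 2 / 5) : traceLog T (a * b) = traceLog T a + traceLog T b :=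
  traceLog_mul hT (by nlinarith [norm_nonneg (a - 1), norm_nonneg (b - 1)])

lemma traceLog_star_of_mem_unitary (hT : IsTracial T) {a : B} (ha : a ∈ unitary B)
    (h : ‖a - 1‖ ≤ 2 / 5) : traceLog T (star a) = -traceLog T a := by
  have hstar : ‖star a - 1‖ ≤ 2 / 5 := by rwa [← star_one B, ← star_sub, norm_star]
  rw [eq_neg_iff_add_eq_zero, ← traceLog_mul_of_le hT hstar h, Unitary.star_mul_self_of_mem ha,
    traceLog_one]

lemma traceLog_star (hT : IsTraceFunctional T) (a : B) :
    traceLog T (star a) = star (traceLog T a) := by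
  have hpow (n : ℕ) : (1 - star a) ^ (n + 1) = star ((1 - a) ^ (n + 1)) := by
    rw [star_pow, star_sub, star_one]
  rw [traceLog, traceLog, star_neg, ← starRingEnd_apply, Complex.conj_tsum]
  congr 1
  refine tsum_congr fun n ↦ ?_
  rw [hpow, hT.map_star]
  simp

lemma re_traceLog_eq_zero (hT : IsTraceFunctional T) {a : B} (ha : a ∈ unitary B)
    (h : ‖a - 1‖ ≤ 2 / 5) : (traceLog T a).re = 0 := by
  have hre := congrArg Complex.re (traceLog_star hT a)
  rw [traceLog_star_of_mem_unitary hT.isTracial ha h, ← starRingEnd_apply, Complex.conj_re,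
    Complex.neg_re] at hre
  linarith

lemma traceLog_star_mul_add (hT : IsTracial T) {x y z : B} (hx : x ∈ unitary B)
    (hy : y ∈ unitary B) (hxy : ‖y - x‖ ≤ 2 / 5) (hyz : ‖z - y‖ ≤ 2 / 5) :
    traceLog T (star x * y) + traceLog T (star y * z) = traceLog T (star x * z) := by
  rw [← traceLog_mul_of_le hT (by rwa [norm_star_mul_sub_one hx])
    (by rwa [norm_star_mul_sub_one hy]), mul_assoc, ← mul_assoc y, Unitary.mul_star_self_of_mem hy,
    one_mul]

lemma UHFSystem.det_eq_det_mul_exp {k : ℕ} (Φ : UHFSystem k B) (hT : IsTracial T) (h1 : T 1 = 1)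
    {l : ℕ} {M W : Matrix (Fin (k ^ l)) (Fin (k ^ l)) ℂ} (hM : Φ.φ l M ∈ unitary B)
    (hMW : ‖Φ.φ l W - Φ.φ l M‖ < 1) :
    W.det = M.det * Complex.exp ((k : ℂ) ^ l * traceLog T (star (Φ.φ l M) * Φ.φ l W)) := by
  have hmap : Φ.φ l (star M * W) = star (Φ.φ l M) * Φ.φ l W := by rw [map_mul, map_star]
  have hone : M * star M = 1 := Φ.injective l (by
    rw [map_mul, map_star, map_one, Unitary.mul_star_self_of_mem hM])
  rw [← hmap, ← Φ.det_eq_exp_traceLog hT h1 (by rwa [hmap, norm_star_mul_sub_one hM]),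
    ← Matrix.det_mul, ← mul_assoc, hone, one_mul]

end Increments

section HasTraceLog

/-- The unitary `x` is joined to `1` by a chain of unitaries with small steps along which the traces
of the logarithms of the increments add up to `c`. Thus `c` is one of the values of the multivalued
function `T ∘ log` at `x`, and `c / 2πi` represents the determinant of `x`. The bound `1 / 20` only
has to be small enough for `traceLog` to be additive on a few consecutive increments. -/
inductive HasTraceLog (T : B →L[ℂ] ℂ) : B → ℂ → Prop
  | one : HasTraceLog T 1 0
  | step {x y : B} {c : ℂ} : HasTraceLog T x c → y ∈ unitary B → ‖y - x‖ ≤ 1 / 20 →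
      HasTraceLog T y (c + traceLog T (star x * y))

namespace HasTraceLog

variable {T : B →L[ℂ] ℂ} {x y : B} {c d : ℂ}

lemma mem_unitary (h : HasTraceLog T x c) : x ∈ unitary B := by
  cases h with
  | one => exact one_mem _
  | step _ h _ => exact h

lemma of_norm_sub_one_le (hx : x ∈ unitary B) (hx1 : ‖x - 1‖ ≤ 1 / 20) :
    HasTraceLog T x (traceLog T x) := by
  simpa only [star_one, one_mul, zero_add] using one.step (T := T) hx hx1

lemma re_eq_zero (hT : IsTraceFunctional T) (h : HasTraceLog T x c) : c.re = 0 := by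
  induction h with
  | one => rfl
  | step h hy hxy ih =>
    rw [Complex.add_re, ih,
      re_traceLog_eq_zero hT (mul_mem (Unitary.star_mem h.mem_unitary) hy), add_zero]
    rw [norm_star_mul_sub_one h.mem_unitary]
    linarith

lemma mul (hx : HasTraceLog T x c) (hy : HasTraceLog T y d) : HasTraceLog T (x * y) (c + d) := by
  induction hy with
  | one => simpa only [mul_one, add_zero] using hx
  | step _ hz hyz ih =>
    have hstep := ih.step (mul_mem hx.mem_unitary hz)
      (by rwa [← mul_sub, CStarRing.norm_mem_unitary_mul _ hx.mem_unitary])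
    rwa [star_mul, mul_assoc, ← mul_assoc _ x, Unitary.star_mul_self_of_mem hx.mem_unitary,
      one_mul, add_assoc] at hstep

lemma map (h : HasTraceLog T x c) (β : B ≃⋆ₐ[ℂ] B) (hβ : ∀ a, T (β a) = T a) :
    HasTraceLog T (β x) c := by
  induction h with
  | one => simpa only [map_one] using one
  | step _ hy hxy ih =>
    have hstep := ih.step (Unitary.map_mem β hy)
      (by rwa [← map_sub, NonUnitalStarAlgHom.norm_map β β.injective])
    rwa [← map_star, ← map_mul, traceLog_map β hβ] at hstep

protected lemma star (hT : IsTracial T) (h : HasTraceLog T x c) : HasTraceLog T (star x) (-c) := by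
  induction h with
  | one => simpa only [star_one, neg_zero] using one
  | @step x y c h hy hxy ih =>
    have hx := h.mem_unitary
    have hincr : traceLog T (star (star x) * star y) = -traceLog T (star x * y) := by
      have hconj := traceLog_conj_of_mem_unitary hT hx (star y * x)
      rw [← mul_assoc, mul_assoc, Unitary.mul_star_self_of_mem hx, mul_one] at hconj
      rw [star_star, hconj, ← traceLog_star_of_mem_unitary hT (mul_mem (Unitary.star_mem hx) hy),
        star_mul, star_star]
      rw [norm_star_mul_sub_one hx]
      linarith
    rw [neg_add, ← hincr]
    exact ih.step (Unitary.star_mem hy) (by rwa [← star_sub, norm_star])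

lemma exists_pow (hx : HasTraceLog T x c) (n : ℕ) : ∃ d, HasTraceLog T (x ^ n) d := by
  induction n with
  | zero => exact ⟨0, by simpa only [pow_zero] using one⟩
  | succ n ih =>
    obtain ⟨d, hd⟩ := ih
    exact ⟨_, pow_succ x n ▸ hd.mul hx⟩

lemma exists_expI (T : B →L[ℂ] ℂ) {a : B} (ha : IsSelfAdjoint a) :
    ∃ c, HasTraceLog T (expI a 1) c := by
  obtain ⟨n, hn⟩ := exists_nat_gt (20 * ‖a‖)
  have hn0 : (0 : ℝ) < n := lt_of_le_of_lt (by positivity) hn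
  have hsmall : ‖expI a (1 / n) - 1‖ ≤ 1 / 20 := by
    have := norm_expI_sub_expI_le ha (1 / n) 0
    rw [expI_zero, sub_zero, abs_of_pos (by positivity), mul_one_div] at this
    refine this.trans ((div_le_iff₀ hn0).2 ?_)
    linarith
  have hpow : expI a (1 / n) ^ n = expI a 1 := by
    let _ : NormedAlgebra ℚ B := .restrictScalars ℚ ℂ B
    rw [expI, expI, ← NormedSpace.exp_nsmul, ← Nat.cast_smul_eq_nsmul ℝ, smul_smul,
      mul_one_div_cancel hn0.ne']
  exact hpow ▸ (of_norm_sub_one_le (expI_mem_unitary ha _) hsmall).exists_pow n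

lemma exists_of_mem_unitary (T : B →L[ℂ] ℂ) (Φ : UHFSystem k B) (hx : x ∈ unitary B) :
    ∃ c, HasTraceLog T x c := by
  obtain ⟨l, hl⟩ := Φ.exists_unitary_near hx (show (0 : ℝ) < 1 / 20 by norm_num)
  obtain ⟨w, hw, hwl, hwx⟩ := hl l le_rfl
  obtain ⟨a, -, ha, -, rfl⟩ := exists_mem_expI_eq (Φ.isClosed_alg l) hw hwl (Φ.finite_spectrum hwl)
  obtain ⟨c, hc⟩ := exists_expI T ha
  exact ⟨_, hc.step hx (by rw [norm_sub_rev]; exact hwx.le)⟩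

/-- The induction runs over the chain; to pass from `x` to `y`, both are approximated in a common
matrix subalgebra. -/
lemma det_eq_exp (hT : IsTracial T) (h1 : T 1 = 1) (Φ : UHFSystem k B) (h : HasTraceLog T x c) :
    ∃ l₀, ∀ l ≥ l₀, ∀ W, ‖Φ.φ l W - x‖ ≤ 1 / 20 →
      W.det = Complex.exp ((k : ℂ) ^ l * (c + traceLog T (star x * Φ.φ l W))) := by
  induction h with
  | one =>
    refine ⟨0, fun l _ W hW1 ↦ ?_⟩
    rw [star_one, one_mul, zero_add]
    exact Φ.det_eq_exp_traceLog hT h1 (hW1.trans_lt (by norm_num))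
  | @step x y c h hy hxy ih =>
    obtain ⟨l₁, hl₁⟩ := ih
    obtain ⟨l₂, hl₂⟩ := Φ.exists_unitary_near h.mem_unitary (show (0 : ℝ) < 1 / 20 by norm_num)
    refine ⟨max l₁ l₂, fun l hl W hWy ↦ ?_⟩
    obtain ⟨_, hM, ⟨M, rfl⟩, hMx⟩ := hl₂ l (le_of_max_le_right hl)
    change Φ.φ l M ∈ unitary B at hM
    change ‖Φ.φ l M - x‖ < 1 / 20 at hMx
    have hWM : ‖Φ.φ l W - Φ.φ l M‖ ≤ 3 / 20 := by
      have := norm_sub_le_norm_sub_add_norm_sub (Φ.φ l W) y (Φ.φ l M)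
      have := norm_sub_le_norm_sub_add_norm_sub y x (Φ.φ l M)
      rw [norm_sub_rev x] at this
      linarith
    have hxMW := traceLog_star_mul_add hT h.mem_unitary hM (by linarith) (hWM.trans (by norm_num))
    have hxyW := traceLog_star_mul_add hT h.mem_unitary hy (by linarith)
      (hWy.trans (by norm_num))
    rw [Φ.det_eq_det_mul_exp hT h1 hM (hWM.trans_lt (by norm_num)),
      hl₁ l (le_of_max_le_left hl) M hMx.le, ← Complex.exp_add, add_assoc, hxyW, ← hxMW]
    ring_nf

theorem exists_mem_kAdic_of_one (hT : IsTracial T) (h1 : T 1 = 1) (Φ : UHFSystem k B)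
    (h : HasTraceLog T 1 c) : ∃ r ∈ kAdic k, c = 2 * Real.pi * Complex.I * r := by
  obtain ⟨l, hl⟩ := h.det_eq_exp hT h1 Φ
  have hdet := hl l le_rfl 1 (by rw [map_one]; simp)
  rw [Matrix.det_one, map_one, star_one, one_mul, traceLog_one, add_zero] at hdet
  obtain ⟨z, hz⟩ := Complex.exp_eq_one_iff.1 hdet.symm
  have hk : ((k : ℂ) ^ l) ≠ 0 := by exact_mod_cast (Φ.pow_pos l).ne'
  have hk' : ((k : ℝ) ^ l) ≠ 0 := by exact_mod_cast hk
  refine ⟨z / (k : ℝ) ^ l, ⟨l, z, div_mul_cancel₀ _ hk'⟩, ?_⟩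
  push_cast
  field_simp
  linear_combination hz

lemma of_continuousOn {ξ : ℝ → B} {F : ℝ → ℂ} {a b : ℝ} (hab : a ≤ b)
    (hξ : ContinuousOn ξ (Set.Icc a b)) (hu : ∀ t ∈ Set.Icc a b, ξ t ∈ unitary B)
    (hF : ∀ s ∈ Set.Icc a b, ∀ t ∈ Set.Icc s b, (∀ r ∈ Set.Icc s t, ‖ξ r - ξ s‖ < 1) →
      F t - F s = traceLog T (star (ξ s) * ξ t))
    (hc : HasTraceLog T (ξ a) c) : HasTraceLog T (ξ b) (c + (F b - F a)) := by
  obtain ⟨t, ht0, htmono, ⟨m, htm⟩, ht⟩ := exists_monotone_Icc_subset_open_cover_Icc hab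
    (c := fun s : Set.Icc a b ↦ {r | ‖ξ r - ξ s‖ < 1 / 40})
    (fun s ↦ isOpen_lt (hξ.domRestrict.sub continuous_const).norm continuous_const)
    (fun s _ ↦ Set.mem_iUnion.2 ⟨s, by simp⟩)
  have hchain (n : ℕ) : HasTraceLog T (ξ (t n)) (c + (F (t n) - F a)) := by
    induction n with
    | zero => simpa [ht0] using hc
    | succ n ih =>
      have hle : (t n : ℝ) ≤ t (n + 1) := htmono n.le_succ
      obtain ⟨s, hs⟩ := ht n
      have hnear : ∀ r ∈ Set.Icc (t n : ℝ) (t (n + 1)), ‖ξ r - ξ (t n)‖ ≤ 1 / 20 := fun r hr ↦ by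
        have hrs : ‖ξ r - ξ s‖ < 1 / 40 :=
          @hs ⟨r, (t n).2.1.trans hr.1, hr.2.trans (t (n + 1)).2.2⟩ hr
        have hns : ‖ξ (t n) - ξ s‖ < 1 / 40 := @hs (t n) ⟨le_rfl, hle⟩
        have := norm_sub_le_norm_sub_add_norm_sub (ξ r) (ξ s) (ξ (t n))
        rw [norm_sub_rev (ξ s)] at this
        linarith
      have hstep := ih.step (hu _ (t (n + 1)).2) (hnear _ ⟨hle, le_rfl⟩)
      rw [← hF _ (t n).2 _ ⟨hle, (t (n + 1)).2.2⟩
        fun r hr ↦ (hnear r hr).trans_lt (by norm_num)] at hstep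
      convert hstep using 1
      ring
  simpa [htm m le_rfl] using hchain m

end HasTraceLog

end HasTraceLog

section Path

variable {T : B →L[ℂ] ℂ} {ξ : ℝ → B} {a b : ℝ}

lemma hasDerivAt_of_contDiffOn_Icc (h : ContDiffOn ℝ 1 ξ (Set.Icc a b)) {t : ℝ}
    (ht : t ∈ Set.Ioo a b) : HasDerivAt ξ (deriv ξ t) t :=
  ((h.contDiffAt (Icc_mem_nhds ht.1 ht.2)).differentiableAt one_ne_zero).hasDerivAt

lemma intervalIntegrable_deriv_mul_star (T : B →L[ℂ] ℂ) (hab : a < b)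
    (h : ContDiffOn ℝ 1 ξ (Set.Icc a b)) :
    IntervalIntegrable (fun t ↦ T (deriv ξ t * star (ξ t))) MeasureTheory.volume a b := by
  have hwithin : ContinuousOn (fun t ↦ T (derivWithin ξ (Set.Icc a b) t * star (ξ t)))
      (Set.uIcc a b) := by
    rw [Set.uIcc_of_le hab.le]
    exact T.continuous.comp_continuousOn
      ((h.continuousOn_derivWithin (uniqueDiffOn_Icc hab) le_rfl).mul h.continuousOn.star)
  refine hwithin.intervalIntegrable.congr_uIoo fun t ht ↦ ?_
  rw [Set.uIoo_of_le hab.le] at ht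
  simp only [derivWithin_of_mem_nhds (Icc_mem_nhds ht.1 ht.2)]

lemma hasDerivAt_traceLog_star_mul (hT : IsTracial T) {w ξ' : B} {t : ℝ} (hw : w ∈ unitary B)
    (ht : ξ t ∈ unitary B) (hξ : HasDerivAt ξ ξ' t) (hnear : ‖ξ t - w‖ < 1) :
    HasDerivAt (fun t ↦ traceLog T (star w * ξ t)) (T (ξ' * star (ξ t))) t := by
  have hderiv := hasDerivWithinAt_traceLog_comp (s := Set.univ) hT
    (hξ.const_mul (star w)).hasDerivWithinAt (by rwa [norm_star_mul_sub_one hw])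
  have hinv : Ring.inverse (star w * ξ t) = star (ξ t) * w :=
    (Ring.inverse_unit (Unitary.toUnits ⟨_, mul_mem (Unitary.star_mem hw) ht⟩)).trans (by
      change star (star w * ξ t) = _
      rw [star_mul, star_star])
  rwa [hasDerivWithinAt_univ, hinv, mul_assoc, ← mul_assoc w, Unitary.mul_star_self_of_mem hw,
    one_mul, hT] at hderiv

lemma integral_deriv_mul_star_eq_traceLog (hT : IsTracial T) (hab : a ≤ b)
    (hξ : ContinuousOn ξ (Set.Icc a b)) (hderiv : ∀ t ∈ Set.Ioo a b, HasDerivAt ξ (deriv ξ t) t)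
    (hint : IntervalIntegrable (fun t ↦ T (deriv ξ t * star (ξ t))) MeasureTheory.volume a b)
    (hu : ∀ t ∈ Set.Icc a b, ξ t ∈ unitary B) (hnear : ∀ t ∈ Set.Icc a b, ‖ξ t - ξ a‖ < 1) :
    ∫ t in a..b, T (deriv ξ t * star (ξ t)) = traceLog T (star (ξ a) * ξ b) := by
  have ha : ξ a ∈ unitary B := hu a ⟨le_rfl, hab⟩
  rw [intervalIntegral.integral_eq_sub_of_hasDerivAt_of_le hab
    (f := fun t ↦ traceLog T (star (ξ a) * ξ t)) (fun t ht ↦ ?_) (fun t ht ↦ ?_) hint,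
    Unitary.star_mul_self_of_mem ha, traceLog_one, sub_zero]
  · exact (hasFDerivAt_traceLog hT (by
      rw [norm_star_mul_sub_one ha]
      exact hnear t ht)).continuousAt.comp_continuousWithinAt (f := fun t ↦ star (ξ a) * ξ t)
        (continuousWithinAt_const.mul (hξ t ht))
  · exact hasDerivAt_traceLog_star_mul hT ha (hu t (Set.Ioo_subset_Icc_self ht)) (hderiv t ht)
      (hnear t (Set.Ioo_subset_Icc_self ht))

lemma HasTraceLog.of_contDiffOn (hT : IsTracial T) (hab : a < b)
    (h : ContDiffOn ℝ 1 ξ (Set.Icc a b)) (hu : ∀ t ∈ Set.Icc a b, ξ t ∈ unitary B) {c : ℂ}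
    (hc : HasTraceLog T (ξ a) c) :
    HasTraceLog T (ξ b) (c + ∫ t in a..b, T (deriv ξ t * star (ξ t))) := by
  have hint {s t : ℝ} (hs : s ∈ Set.Icc a b) (ht : t ∈ Set.Icc a b) :
      IntervalIntegrable (fun t ↦ T (deriv ξ t * star (ξ t))) MeasureTheory.volume s t :=
    (intervalIntegrable_deriv_mul_star T hab h).mono_set
      (Set.uIcc_subset_uIcc (Set.Icc_subset_uIcc hs) (Set.Icc_subset_uIcc ht))
  have ha : a ∈ Set.Icc a b := ⟨le_rfl, hab.le⟩
  have hchain := hc.of_continuousOn (F := fun t ↦ ∫ r in a..t, T (deriv ξ r * star (ξ r))) hab.le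
    h.continuousOn hu fun s hs t ht hnear ↦ by
      have hsub : Set.Icc s t ⊆ Set.Icc a b := Set.Icc_subset_Icc hs.1 ht.2
      have htmem : t ∈ Set.Icc a b := hsub ⟨ht.1, le_rfl⟩
      rw [intervalIntegral.integral_interval_sub_left (hint ha htmem) (hint ha hs)]
      exact integral_deriv_mul_star_eq_traceLog hT ht.1 (h.continuousOn.mono hsub)
        (fun r hr ↦ hasDerivAt_of_contDiffOn_Icc h ⟨hs.1.trans_lt hr.1, hr.2.trans_le ht.2⟩)
        (hint hs htmem) (fun r hr ↦ hu r (hsub hr)) hnear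
  simpa only [intervalIntegral.integral_same, sub_zero] using hchain

lemma IsUnitaryPath.hasTraceLog_integral (hT : IsTracial T) (hξ : IsUnitaryPath ξ) (h0 : ξ 0 = 1) :
    HasTraceLog T (ξ 1) (∫ t in (0 : ℝ)..1, T (deriv ξ t * star (ξ t))) := by
  obtain ⟨hu, N, s, hs0, hsN, hs⟩ := hξ
  have hmono : MonotoneOn s (Set.Iic N) :=
    monotoneOn_of_le_succ Set.ordConnected_Iic fun j _ _ hj ↦ (hs j hj).1.le
  have hpieces : ∀ j ≤ N, IntervalIntegrable (fun t ↦ T (deriv ξ t * star (ξ t)))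
      MeasureTheory.volume 0 (s j) ∧
      HasTraceLog T (ξ (s j)) (∫ t in (0 : ℝ)..s j, T (deriv ξ t * star (ξ t))) := by
    intro j
    induction j with
    | zero =>
      intro _
      simpa [hs0, h0] using HasTraceLog.one
    | succ j ih =>
      intro hj
      obtain ⟨hint, hreach⟩ := ih (Nat.le_of_succ_le hj)
      obtain ⟨hlt, hC⟩ := hs j hj
      have hint' := intervalIntegrable_deriv_mul_star T hlt hC
      refine ⟨hint.trans hint', ?_⟩
      rw [← intervalIntegral.integral_add_adjacent_intervals hint hint']
      have h0j : 0 ≤ s j := hs0 ▸ hmono (Nat.zero_le N) (Nat.le_of_succ_le hj) (Nat.zero_le j)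
      have hj1 : s (j + 1) ≤ 1 := hsN ▸ hmono hj (le_refl N) hj
      exact hreach.of_contDiffOn hT hlt hC fun r hr ↦ hu r ⟨h0j.trans hr.1, hr.2.trans hj1⟩
  exact hsN ▸ (hpieces N le_rfl).2

lemma eq_two_pi_I_mul_re_inv_mul {c : ℂ} (hc : c.re = 0) :
    c = 2 * Real.pi * Complex.I * (((2 * Real.pi * Complex.I)⁻¹ * c).re : ℝ) := by
  have hreal : (2 * Real.pi * Complex.I)⁻¹ * c = ((c.im / (2 * Real.pi) : ℝ) : ℂ) := by
    have hpi : (Real.pi : ℂ) ≠ 0 := by exact_mod_cast Real.pi_ne_zero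
    have hcI : c = c.im * Complex.I := Complex.ext (by simp [hc]) (by simp)
    conv_lhs => rw [hcI]
    push_cast
    field_simp
  rw [hreal, Complex.ofReal_re, ← hreal, mul_inv_cancel_left₀ Complex.two_pi_I_ne_zero]

theorem HasDeterminant.exists_hasTraceLog {k : ℕ} (Φ : UHFSystem k B) (hT : IsTraceFunctional T)
    {u : unitary B} (hu : HasDeterminant (T : B →ₗ[ℂ] ℂ) u 0) :
    ∃ r ∈ kAdic k, HasTraceLog T (u : B) (2 * Real.pi * Complex.I * r) := by
  obtain ⟨ξ, hξ, h0, h1, hdet⟩ := hu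
  have hlog := hξ.hasTraceLog_integral hT.isTracial h0
  refine ⟨pathDet (T : B →ₗ[ℂ] ℂ) ξ, Φ.traceK0_le_kAdic hT.isTracial hT.map_one
    ((QuotientAddGroup.eq_zero_iff _).1 hdet.symm), ?_⟩
  rw [eq_two_pi_I_mul_re_inv_mul (hlog.re_eq_zero hT), h1] at hlog
  exact hlog

end Path

section Orbit

variable (β : B ≃⋆ₐ[ℂ] B)

lemma norm_map_starAlgEquiv (x : B) : ‖β x‖ = ‖x‖ := NonUnitalStarAlgHom.norm_map β β.injective x

lemma map_starAlgEquiv_real_smul (r : ℝ) (x : B) : β (r • x) = r • β x := map_smul β (r : ℂ) x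

lemma map_expI (a : B) (t : ℝ) : β (expI a t) = expI (β a) t := by
  have hβ : Continuous β := (NonUnitalStarAlgHom.isometry β β.injective).continuous
  let _ : NormedAlgebra ℚ B := .restrictScalars ℚ ℂ B
  rw [expI, expI, ← map_smul β Complex.I a, ← map_starAlgEquiv_real_smul]
  exact NormedSpace.map_exp β hβ _

lemma pow_succ_apply (n : ℕ) (x : B) : (β ^ (n + 1)) x = β ((β ^ n) x) := by
  rw [pow_succ', StarAlgEquiv.mul_apply]

lemma map_pow_apply {X : Type*} {T : B → X} (hβ : ∀ a, T (β a) = T a) (n : ℕ) (a : B) :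
    T ((β ^ n) a) = T a := by
  induction n with
  | zero => rfl
  | succ n ih => rw [pow_succ_apply, hβ, ih]

end Orbit

section AlmostOrthogonal

variable {ι : Type*} {q : ι → B} {s : Finset ι} {κ : ℝ}

lemma norm_sum_smul_commutator_le {f : B} {α : ι → ℝ} {C : ℝ}
    (h : ∀ j ∈ s, ‖q j * f - f * q j‖ ≤ κ) (hα : ∀ j ∈ s, |α j| ≤ C) :
    ‖(∑ j ∈ s, α j • q j) * f - f * ∑ j ∈ s, α j • q j‖ ≤ s.card * (C * κ) := by
  rw [Finset.sum_mul, Finset.mul_sum, ← Finset.sum_sub_distrib]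
  refine (norm_sum_le_of_le s (n := fun _ ↦ C * κ) fun j hj ↦ ?_).trans_eq (by simp)
  rw [smul_mul_assoc, mul_smul_comm, ← smul_sub, norm_smul, Real.norm_eq_abs]
  exact mul_le_mul (hα j hj) (h j hj) (norm_nonneg _) ((abs_nonneg _).trans (hα j hj))

lemma isSelfAdjoint_sum_smul (hq : ∀ j, IsSelfAdjoint (q j)) (α : ι → ℝ) (s : Finset ι) :
    IsSelfAdjoint (∑ j ∈ s, α j • q j) :=
  isSelfAdjoint_sum _ fun j _ ↦ .smul (.all (α j)) (hq j)

lemma norm_sum_mul_self_sub_le (hq : ∀ j ∈ s, IsIdempotentElem (q j))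
    (h : ∀ i ∈ s, ∀ j ∈ s, i ≠ j → ‖q i * q j‖ ≤ κ) (hκ0 : 0 ≤ κ) :
    ‖(∑ j ∈ s, q j) * (∑ j ∈ s, q j) - ∑ j ∈ s, q j‖ ≤ s.card * (s.card * κ) := by
  classical
  rw [Finset.sum_mul, ← Finset.sum_sub_distrib]
  refine (norm_sum_le_of_le s (n := fun _ ↦ s.card * κ) fun i hi ↦ ?_).trans_eq (by simp)
  rw [Finset.mul_sum, ← Finset.add_sum_erase _ _ hi, (hq i hi).eq, add_sub_cancel_left]
  calc ‖∑ j ∈ s.erase i, q i * q j‖ ≤ ∑ _j ∈ s.erase i, κ := norm_sum_le_of_le _ fun j hj ↦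
        h i hi j (Finset.mem_of_mem_erase hj) (Finset.ne_of_mem_erase hj).symm
    _ ≤ ∑ _j ∈ s, κ := Finset.sum_le_sum_of_subset_of_nonneg (s.erase_subset i) fun _ _ _ ↦ hκ0
    _ = s.card * κ := by simp

lemma norm_sum_le_two (hq : ∀ j ∈ s, IsStarProjection (q j))
    (h : ∀ i ∈ s, ∀ j ∈ s, i ≠ j → ‖q i * q j‖ ≤ κ) (hκ0 : 0 ≤ κ)
    (hκ : s.card * (s.card * κ) ≤ 2) : ‖∑ j ∈ s, q j‖ ≤ 2 := by
  have hidem := norm_sum_mul_self_sub_le (fun j hj ↦ (hq j hj).isIdempotentElem) h hκ0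
  have hsa : IsSelfAdjoint (∑ j ∈ s, q j) := isSelfAdjoint_sum _ fun j hj ↦ (hq j hj).isSelfAdjoint
  set x := ∑ j ∈ s, q j
  have hsq : ‖x * x‖ = ‖x‖ * ‖x‖ := by rw [← CStarRing.norm_star_mul_self, hsa.star_eq]
  have hle := norm_le_norm_add_norm_sub' (x * x) x
  rw [norm_sub_rev] at hle
  nlinarith [norm_nonneg x, norm_sub_rev (x * x) x]

end AlmostOrthogonal

section Ramp

variable {T : B →L[ℂ] ℂ} {β : B ≃⋆ₐ[ℂ] B} {n : ℕ} {p : B} {κ : ℝ}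

/-- The self-adjoint element whose coefficients grow linearly from `0` to `2π` along the first `n`
translates of `p`. It differs from its image under `β` by a small element and by `2π` times the
projection `(β ^ n) p`, whose exponential is `1`. -/
noncomputable def orbitRamp (β : B ≃⋆ₐ[ℂ] B) (n : ℕ) (p : B) : B :=
  ∑ j ∈ Finset.range n, (2 * Real.pi * (j + 1) / n) • (β ^ j) p

/-- The average of the first `n` translates of `p`, multiplied by `2π`. -/
noncomputable def orbitMean (β : B ≃⋆ₐ[ℂ] B) (n : ℕ) (p : B) : B :=
  ∑ j ∈ Finset.range n, (2 * Real.pi / n) • (β ^ j) p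

lemma isSelfAdjoint_orbitRamp (hp : IsSelfAdjoint p) : IsSelfAdjoint (orbitRamp β n p) :=
  isSelfAdjoint_sum_smul (fun j ↦ hp.map (β ^ j)) _ _

lemma isSelfAdjoint_orbitMean (hp : IsSelfAdjoint p) : IsSelfAdjoint (orbitMean β n p) :=
  isSelfAdjoint_sum_smul (fun j ↦ hp.map (β ^ j)) _ _

lemma map_orbitRamp (β : B ≃⋆ₐ[ℂ] B) (n : ℕ) (p : B) :
    β (orbitRamp β n p) =
      ∑ j ∈ Finset.range n, (2 * Real.pi * (j + 1) / n) • (β ^ (j + 1)) p := by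
  simp only [orbitRamp, map_sum, map_starAlgEquiv_real_smul, pow_succ_apply]

lemma orbitRamp_sub_map (β : B ≃⋆ₐ[ℂ] B) (hn : n ≠ 0) (p : B) :
    orbitRamp β n p - β (orbitRamp β n p) = orbitMean β n p - (2 * Real.pi) • (β ^ n) p := by
  have htelescope := Finset.sum_range_sub' (fun j ↦ (2 * Real.pi * j / n) • (β ^ j) p) n
  rw [mul_div_cancel_right₀ _ (Nat.cast_ne_zero.2 hn)] at htelescope
  simp only [Nat.cast_zero, mul_zero, zero_div, zero_smul, zero_sub] at htelescope
  rw [map_orbitRamp, sub_eq_add_neg (orbitMean β n p), ← htelescope, orbitRamp, orbitMean,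
    ← Finset.sum_sub_distrib, ← Finset.sum_add_distrib]
  refine Finset.sum_congr rfl fun j _ ↦ ?_
  push_cast
  module

lemma abs_ramp_coeff_le {j : ℕ} (hj : j < n) : |2 * Real.pi * (j + 1) / n| ≤ 7 := by
  have hj' : (j + 1 : ℝ) ≤ n := by exact_mod_cast hj
  rw [abs_of_nonneg (by positivity), div_le_iff₀ (by linarith [(j.cast_nonneg : (0 : ℝ) ≤ j)])]
  exact mul_le_mul (by linarith [Real.pi_lt_d2]) hj' (by positivity) (by norm_num)

lemma norm_orbitRamp_commutator_le {f : B} {δ : ℝ}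
    (hf : ∀ j < n, ‖p * (β ^ j).symm f - (β ^ j).symm f * p‖ ≤ δ) :
    ‖orbitRamp β n p * f - f * orbitRamp β n p‖ ≤ n * (7 * δ) := by
  refine (norm_sum_smul_commutator_le (fun j hj ↦ ?_)
    fun j hj ↦ abs_ramp_coeff_le (Finset.mem_range.1 hj)).trans_eq (by rw [Finset.card_range])
  rw [← (β ^ j).apply_symm_apply f, ← map_mul, ← map_mul, ← map_sub, norm_map_starAlgEquiv]
  exact hf j (Finset.mem_range.1 hj)

lemma map_orbitMean (hβ : ∀ a, T (β a) = T a) (hn : n ≠ 0) (p : B) :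
    T (orbitMean β n p) = 2 * Real.pi * T p := by
  have hn' : (n : ℂ) ≠ 0 := Nat.cast_ne_zero.2 hn
  simp only [orbitMean, map_sum, ← Complex.coe_smul, map_smul, map_pow_apply β hβ,
    Finset.sum_const, Finset.card_range, nsmul_eq_mul, smul_eq_mul]
  push_cast
  field_simp

lemma norm_pow_mul_pow_le (hp : IsSelfAdjoint p) (horth : ∀ d ∈ Finset.Icc 1 n, ‖p * (β ^ d) p‖ ≤ κ)
    {i j : ℕ} (hi : i ≤ n) (hj : j ≤ n) (hij : i ≠ j) : ‖(β ^ i) p * (β ^ j) p‖ ≤ κ := by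
  wlog h : i < j generalizing i j
  · rw [← norm_star, star_mul, (hp.map (β ^ i)).star_eq, (hp.map (β ^ j)).star_eq]
    exact this hj hi hij.symm (by omega)
  obtain ⟨d, rfl⟩ := Nat.exists_eq_add_of_lt h
  rw [add_assoc, pow_add, StarAlgEquiv.mul_apply, ← map_mul, norm_map_starAlgEquiv]
  exact horth _ (Finset.mem_Icc.2 (by omega))

lemma norm_pow_commutator_pow_le (hp : IsSelfAdjoint p) (hκ0 : 0 ≤ κ)
    (horth : ∀ d ∈ Finset.Icc 1 n, ‖p * (β ^ d) p‖ ≤ κ) {i j : ℕ} (hi : i ≤ n) (hj : j ≤ n) :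
    ‖(β ^ i) p * (β ^ j) p - (β ^ j) p * (β ^ i) p‖ ≤ 2 * κ := by
  obtain rfl | hij := eq_or_ne i j
  · rw [sub_self, norm_zero]
    positivity
  · refine (norm_sub_le _ _).trans ?_
    linarith [norm_pow_mul_pow_le hp horth hi hj hij, norm_pow_mul_pow_le hp horth hj hi hij.symm]

lemma norm_orbitMean_le (hp : IsStarProjection p) (hκ0 : 0 ≤ κ) (hκ : n * (n * κ) ≤ 2)
    (horth : ∀ d ∈ Finset.Icc 1 n, ‖p * (β ^ d) p‖ ≤ κ) :
    ‖orbitMean β n p‖ ≤ 4 * Real.pi / n := by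
  have hsum : ‖∑ j ∈ Finset.range n, (β ^ j) p‖ ≤ 2 :=
    norm_sum_le_two (fun j _ ↦ hp.map (β ^ j)) (fun i hi j hj ↦ norm_pow_mul_pow_le
      hp.isSelfAdjoint horth (Finset.mem_range.1 hi).le (Finset.mem_range.1 hj).le) hκ0
      (by rwa [Finset.card_range])
  rw [orbitMean, ← Finset.smul_sum, norm_smul, Real.norm_of_nonneg (by positivity)]
  calc 2 * Real.pi / n * ‖∑ j ∈ Finset.range n, (β ^ j) p‖ ≤ 2 * Real.pi / n * 2 := by gcongr
    _ = 4 * Real.pi / n := by ring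

lemma norm_commutator_le_of_mem_orbitRamp_list (hn : n ≠ 0) {x f : B} {δ : ℝ}
    (hx : x ∈ [orbitRamp β n p, -β (orbitRamp β n p), -orbitMean β n p,
      (2 * Real.pi) • (β ^ n) p]) (hf : ∀ j ≤ n, ‖(β ^ j) p * f - f * (β ^ j) p‖ ≤ δ) :
    ‖x * f - f * x‖ ≤ n * (7 * δ) := by
  have hneg (y : B) : ‖-y * f - f * -y‖ = ‖y * f - f * y‖ := by
    rw [neg_mul, mul_neg, ← neg_sub', norm_neg]
  have hn1 : (1 : ℝ) ≤ n := by exact_mod_cast Nat.one_le_iff_ne_zero.2 hn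
  have hpi : 2 * Real.pi ≤ 7 := by linarith [Real.pi_lt_d2]
  have hδ : 0 ≤ δ := (norm_nonneg _).trans (hf 0 n.zero_le)
  have hcard : ((Finset.range n).card : ℝ) * (7 * δ) = n * (7 * δ) := by rw [Finset.card_range]
  simp only [List.mem_cons, List.not_mem_nil, or_false] at hx
  rcases hx with rfl | rfl | rfl | rfl
  · exact (norm_sum_smul_commutator_le (fun j hj ↦ hf j (Finset.mem_range.1 hj).le)
      fun j hj ↦ abs_ramp_coeff_le (Finset.mem_range.1 hj)).trans_eq hcard
  · rw [hneg, map_orbitRamp]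
    exact (norm_sum_smul_commutator_le (fun j hj ↦ hf (j + 1) (Finset.mem_range.1 hj))
      fun j hj ↦ abs_ramp_coeff_le (Finset.mem_range.1 hj)).trans_eq hcard
  · rw [hneg]
    refine (norm_sum_smul_commutator_le (fun j hj ↦ hf j (Finset.mem_range.1 hj).le)
      fun _ _ ↦ ?_).trans_eq hcard
    rw [abs_of_nonneg (by positivity)]
    exact (div_le_self (by positivity) hn1).trans hpi
  · rw [smul_mul_assoc, mul_smul_comm, ← smul_sub, norm_smul, Real.norm_of_nonneg (by positivity)]
    refine (mul_le_mul hpi (hf n le_rfl) (norm_nonneg _) (by norm_num)).trans ?_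
    exact le_mul_of_one_le_left (by positivity) hn1

/-- The ramp `a` and the mean `S` enter through the almost commuting exponents `a`, `-β a`, `-S` and
`2π (β ^ n) p`, which have sum `0`. -/
lemma traceLog_expI_orbitRamp_mul (hT : IsTracial T) (hn : n ≠ 0) (hp : IsStarProjection p)
    (hκ0 : 0 ≤ κ) (hκ : 600 * (n : ℝ) ^ 2 * κ < 1)
    (horth : ∀ d ∈ Finset.Icc 1 n, ‖p * (β ^ d) p‖ ≤ κ) :
    ‖expI (orbitRamp β n p) 1 * star (β (expI (orbitRamp β n p) 1)) *
        star (expI (orbitMean β n p) 1) - 1‖ ≤ 600 * (n : ℝ) ^ 2 * κ ∧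
      traceLog T (expI (orbitRamp β n p) 1 * star (β (expI (orbitRamp β n p) 1)) *
        star (expI (orbitMean β n p) 1)) = 0 := by
  have hramp : IsSelfAdjoint (orbitRamp β n p) := isSelfAdjoint_orbitRamp hp.isSelfAdjoint
  have hmean : IsSelfAdjoint (orbitMean β n p) := isSelfAdjoint_orbitMean hp.isSelfAdjoint
  have hexp_neg {a : B} (ha : IsSelfAdjoint a) : expI (-a) 1 = star (expI a 1) := by
    rw [star_expI ha, expI, expI, smul_neg, smul_neg, neg_smul]
  have hnonneg : 0 ≤ (n : ℝ) ^ 2 * κ := by positivity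
  set l := [orbitRamp β n p, -β (orbitRamp β n p), -orbitMean β n p, (2 * Real.pi) • (β ^ n) p]
    with hl
  have hprod : (l.map (expI · 1)).prod = expI (orbitRamp β n p) 1 *
      star (β (expI (orbitRamp β n p) 1)) * star (expI (orbitMean β n p) 1) := by
    simp only [hl, List.map_cons, List.map_nil, List.prod_cons, List.prod_nil, mul_one,
      expI_two_pi_smul_of_isStarProjection (hp.map (β ^ n)), hexp_neg (hramp.map β),
      hexp_neg hmean, map_expI, mul_assoc]
  have hsa : ∀ a ∈ l, IsSelfAdjoint a := by
    simp only [hl, List.forall_mem_cons, List.not_mem_nil, false_implies, implies_true, and_true]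
    exact ⟨hramp, (hramp.map β).neg, hmean.neg,
      .smul (.all (2 * Real.pi)) (hp.map (β ^ n)).isSelfAdjoint⟩
  have hsum : l.sum = 0 := by
    simp only [hl, List.sum_cons, List.sum_nil, add_zero]
    rw [← add_assoc, ← sub_eq_add_neg, orbitRamp_sub_map β hn]
    abel
  have hcomm : ∀ a ∈ l, ∀ b ∈ l, ‖a * b - b * a‖ ≤ n * (7 * (n * (7 * (2 * κ)))) :=
    fun a ha b hb ↦ norm_commutator_le_of_mem_orbitRamp_list hn ha fun j hj ↦ by
      rw [norm_sub_rev]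
      exact norm_commutator_le_of_mem_orbitRamp_list hn hb fun i hi ↦
        norm_pow_commutator_pow_le hp.isSelfAdjoint hκ0 horth hi hj
  have hchoose : ((l.length.choose 2 : ℕ) : ℝ) = 6 := by norm_num [hl, Nat.choose]
  have hsmall : ((l.length.choose 2 : ℕ) : ℝ) * (n * (7 * (n * (7 * (2 * κ))))) ≤
      600 * (n : ℝ) ^ 2 * κ := by
    rw [hchoose]
    nlinarith
  obtain ⟨hnorm, htrace⟩ := traceLog_list_prod_expI hT hsa hsum (hsmall.trans_lt hκ) hcomm
  rw [← hprod]
  exact ⟨hnorm.trans hsmall, htrace⟩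

theorem traceLog_expI_orbitRamp_mul_star (hT : IsTracial T) (hβ : ∀ a, T (β a) = T a) (hn : n ≠ 0)
    (hp : IsStarProjection p) {ε : ℝ} (hε : ε ≤ 1 / 10) (hnε : 4 * Real.pi / n ≤ ε / 2)
    (hκ0 : 0 ≤ κ) (hκ : 600 * (n : ℝ) ^ 2 * κ ≤ ε / 2)
    (horth : ∀ d ∈ Finset.Icc 1 n, ‖p * (β ^ d) p‖ ≤ κ) :
    ‖expI (orbitRamp β n p) 1 * star (β (expI (orbitRamp β n p) 1)) - 1‖ ≤ ε ∧
      traceLog T (expI (orbitRamp β n p) 1 * star (β (expI (orbitRamp β n p) 1))) =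
        2 * Real.pi * Complex.I * T p := by
  obtain ⟨hnorm, htrace⟩ := traceLog_expI_orbitRamp_mul hT hn hp hκ0 (hκ.trans_lt (by linarith))
    horth
  have hmean : IsSelfAdjoint (orbitMean β n p) := isSelfAdjoint_orbitMean hp.isSelfAdjoint
  have hmean_norm : ‖orbitMean β n p‖ ≤ ε / 2 :=
    (norm_orbitMean_le hp hκ0 (by nlinarith) horth).trans hnε
  set w := expI (orbitRamp β n p) 1 * star (β (expI (orbitRamp β n p) 1))
  set e := expI (orbitMean β n p) 1
  have he : e ∈ unitary B := expI_mem_unitary hmean 1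
  have he1 : ‖e - 1‖ ≤ ε / 2 := (norm_expI_sub_one_le hmean (by simp)).trans hmean_norm
  have hw : w = w * star e * e := by rw [mul_assoc, Unitary.star_mul_self_of_mem he, mul_one]
  constructor
  · calc ‖w - 1‖ = ‖(w * star e - 1) * e + (e - 1)‖ := by
          rw [sub_mul, ← hw, one_mul, sub_add_sub_cancel]
      _ ≤ ‖w * star e - 1‖ + ‖e - 1‖ := by
          rw [← CStarRing.norm_mul_mem_unitary (w * star e - 1) he]
          exact norm_add_le _ _
      _ ≤ ε := by linarith
  · rw [hw, traceLog_mul_of_le hT (by linarith) (by linarith), htrace, zero_add,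
      traceLog_expI hT hmean (by linarith), map_orbitMean hβ hn]
    ring

end Ramp

lemma exists_eq_natCast_div_pow_of_mem_kAdic (hk : k ≠ 0) {r : ℝ} (hr : r ∈ kAdic k) (hr0 : 0 ≤ r)
    (m : ℕ) : ∃ l ≥ m, ∃ j : ℕ, r = j / (k : ℝ) ^ l := by
  obtain ⟨l, z, hz⟩ := hr
  have hk' (n : ℕ) : (0 : ℝ) < (k : ℝ) ^ n := by positivity
  have hz0 : 0 ≤ z := by
    have : (0 : ℝ) ≤ z := hz ▸ mul_nonneg hr0 (hk' l).le
    exact_mod_cast this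
  lift z to ℕ using hz0 with j
  refine ⟨m + l, m.le_add_right l, k ^ m * j, (eq_div_iff (hk' _).ne').2 ?_⟩
  push_cast at hz ⊢
  rw [← hz]
  ring

namespace UHFSystem

variable (Φ : UHFSystem k B)

section SpreadProjection

variable {m : ℕ} {e q : B}

lemma star_spread (m : ℕ) (q : B) : star (Φ.spread m q) = Φ.spread m (star q) := by
  simp only [spread_apply, star_sum, star_mul, star_matrixUnit, mul_assoc]

lemma spread_mul_of_mem_comm (he : e ∈ Φ.comm m) (q : B) :
    Φ.spread m q * e = Φ.spread m (q * e) := by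
  simp only [spread_apply, Finset.sum_mul, mul_assoc,
    Φ.mem_comm.1 he _ (Φ.matrixUnit_mem_alg le_rfl _ _)]

lemma spread_mul_matrixUnit (he : e ∈ Φ.comm m) :
    Φ.spread m (e * Φ.matrixUnit m (Φ.zero m) (Φ.zero m)) = e := by
  simp only [spread_apply, ← mul_assoc, Φ.mem_comm.1 he _ (Φ.matrixUnit_mem_alg le_rfl _ _)]
  simp only [mul_assoc, matrixUnit_mul_matrixUnit, ← Finset.mul_sum, sum_matrixUnit, mul_one]

lemma isStarProjection_spread (hq : IsStarProjection q)
    (hqm : q * Φ.matrixUnit m (Φ.zero m) (Φ.zero m) = q) : IsStarProjection (Φ.spread m q) := by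
  refine ⟨?_, by rw [isSelfAdjoint_iff, star_spread, hq.isSelfAdjoint.star_eq]⟩
  change Φ.spread m q * Φ.spread m q = Φ.spread m q
  have hzero {i} (hi : i ≠ Φ.zero m) : q * Φ.matrixUnit m i (Φ.zero m) = 0 := by
    rw [← hqm, mul_assoc, Φ.matrixUnit_mul_matrixUnit_of_ne m hi.symm, mul_zero]
  have hmul : q * Φ.spread m q = q := by
    simp only [spread_apply, Finset.mul_sum, ← mul_assoc]
    rw [Finset.sum_eq_single (Φ.zero m) (fun i _ hi ↦ by rw [hzero hi, zero_mul, zero_mul])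
      (by simp), hqm, hq.isIdempotentElem.eq, hqm]
  rw [Φ.spread_mul_of_mem_comm (Φ.spread_mem_comm m q), hmul]

lemma trace_spread {T : B →ₗ[ℂ] ℂ} (hT : IsTracial T)
    (hqm : q * Φ.matrixUnit m (Φ.zero m) (Φ.zero m) = q) :
    T (Φ.spread m q) = (k : ℂ) ^ m * T q := by
  have hterm (i) : T (Φ.matrixUnit m i (Φ.zero m) * q * Φ.matrixUnit m (Φ.zero m) i) = T q := by
    rw [hT, ← mul_assoc, matrixUnit_mul_matrixUnit, hT, hqm]
  simp [spread_apply, hterm]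

end SpreadProjection

lemma exists_mem_comm_isStarProjection_mul_eq {T : B →ₗ[ℂ] ℂ} (hT : IsTracial T) (h1 : T 1 = 1)
    {l m : ℕ} {e : B} (he : IsStarProjection e) (hel : e ∈ Φ.alg l) (hem : e ∈ Φ.comm m) {r : ℝ}
    (hr : r ∈ kAdic k) (hr0 : 0 ≤ r) (hre : r ≤ (T e).re) :
    ∃ p ∈ Φ.comm m, IsStarProjection p ∧ p * e = p ∧ T p = r := by
  set f := Φ.matrixUnit m (Φ.zero m) (Φ.zero m)
  have hf : IsStarProjection f := Φ.isStarProjection_matrixUnit m _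
  have hcomm : f * e = e * f := Φ.mem_comm.1 hem _ (Φ.matrixUnit_mem_alg le_rfl _ _)
  have hef : IsStarProjection (e * f) := he.mul hf hcomm.symm
  have hkm : (0 : ℝ) < (k : ℝ) ^ m := by exact_mod_cast Φ.pow_pos m
  have hTe : (T e).re = (k : ℝ) ^ m * (T (e * f)).re := by
    rw [← Complex.re_ofReal_mul, ← Φ.spread_mul_matrixUnit hem,
      Φ.trace_spread hT (by rw [mul_assoc, hf.isIdempotentElem.eq]), Φ.spread_mul_matrixUnit hem]
    push_cast
    rfl
  obtain ⟨n, hn, j, rfl⟩ :=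
    exists_eq_natCast_div_pow_of_mem_kAdic (by linarith [Φ.two_le]) hr hr0 l
  obtain ⟨q, -, hq, hqe, hTq⟩ := Φ.exists_mem_alg_isStarProjection_mul_eq hT h1 (l := n + m)
    (j := j) hef (mul_mem (Φ.alg_mono (by omega) hel) (Φ.matrixUnit_mem_alg (by omega) _ _))
    (by rwa [pow_add, ← div_div, div_le_iff₀ hkm, mul_comm, ← hTe])
  have hqf : q * f = q := by rw [← hqe, mul_assoc, mul_assoc, hf.isIdempotentElem.eq]
  have hqe' : q * e = q := by
    rw [← hqe, mul_assoc, mul_assoc, hcomm, ← mul_assoc e, he.isIdempotentElem.eq]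
  refine ⟨Φ.spread m q, Φ.spread_mem_comm m q, Φ.isStarProjection_spread hq hqf, ?_, ?_⟩
  · rw [Φ.spread_mul_of_mem_comm hem, hqe']
  · have hkm' : ((k : ℂ) ^ m) ≠ 0 := by exact_mod_cast hkm.ne'
    rw [Φ.trace_spread hT hqf, hTq, pow_add]
    push_cast
    field_simp

lemma exists_forall_near (G : Finset B) {δ : ℝ} (hδ : 0 < δ) :
    ∃ m, ∀ x ∈ G, ∃ y ∈ Φ.alg m, ‖y - x‖ ≤ δ := by
  choose l hl using fun x ↦ Φ.exists_near x hδ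
  refine ⟨G.sup l, fun x hx ↦ ?_⟩
  obtain ⟨y, hy, hyx⟩ := hl x
  exact ⟨y, Φ.alg_mono (Finset.le_sup hx) hy, hyx.le⟩

lemma norm_commutator_le_of_near {m : ℕ} {p f y : B} (hp : p ∈ Φ.comm m) {c : ℝ}
    (hpc : ‖p‖ ≤ c) (hy : y ∈ Φ.alg m) {δ : ℝ} (h : ‖y - f‖ ≤ δ) :
    ‖p * f - f * p‖ ≤ 2 * (c * δ) := by
  calc ‖p * f - f * p‖ = ‖(y - f) * p - p * (y - f)‖ := by
        rw [sub_mul, mul_sub, Φ.mem_comm.1 hp y hy, sub_sub_sub_cancel_left]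
    _ ≤ δ * c + c * δ := norm_sub_le_of_le (norm_mul_le_of_le h hpc) (norm_mul_le_of_le hpc h)
    _ = 2 * (c * δ) := by ring

lemma exists_mem_comm_isStarProjection_near {m : ℕ} {e : B} (he : IsStarProjection e) {η : ℝ}
    (hη0 : 0 < η) (hη : η ≤ 1 / 32)
    (h : ∀ i, ‖e * Φ.matrixUnit m (Φ.zero m) i - Φ.matrixUnit m (Φ.zero m) i * e‖ ≤
      η / 2 / (k : ℝ) ^ m) :
    ∃ l, ∃ e' ∈ Φ.alg l ⊓ Φ.comm m, IsStarProjection e' ∧ ‖e' - e‖ ≤ 9 * η := by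
  obtain ⟨l, -, x, hx, hxe⟩ := Φ.exists_near_mem_comm m e hη0 h
  exact ⟨l, exists_isStarProjection_mem_near (Φ.isClosed_alg_inf_comm l m) hx he hη hxe⟩

end UHFSystem

section Towers

variable {m : ℕ} {h : Fin m → ℕ} {β : B ≃⋆ₐ[ℂ] B}

/-- The cyclic shift by one level on the set of all levels of towers of heights `h i`. -/
def towerShift (h : Fin m → ℕ) : Equiv.Perm (Σ i, Fin (h i)) :=
  Equiv.sigmaCongrRight fun i ↦ finRotate (h i)

lemma towerShift_apply (i : Fin m) (j : Fin (h i)) :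
    towerShift h ⟨i, j⟩ = ⟨i, ⟨(j + 1) % h i, Nat.mod_lt _ j.pos⟩⟩ := by
  change (⟨i, finRotate (h i) j⟩ : Σ i, Fin (h i)) = _
  congr 1
  generalize h i = n at j
  cases n with
  | zero => exact j.elim0
  | succ n =>
    rw [finRotate_apply]
    ext
    simp [Fin.val_add]

/-- `B` has approximately central partitions of unity into projections which `β` approximately
permutes according to `σ`. Rohlin towers of heights `h i` are the case `σ = towerShift h`, where the
projections are indexed by the levels of all towers at once. -/
def HasRohlinPartitions {ι : Type*} [Fintype ι] (β : B ≃⋆ₐ[ℂ] B) (σ : Equiv.Perm ι) : Prop :=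
  ∀ (F : Finset B) (ε : ℝ), 0 < ε →
    ∃ e : ι → B, (∀ a, IsStarProjection (e a)) ∧ ∑ a, e a = 1 ∧
      (∀ a, ‖β (e a) - e (σ a)‖ ≤ ε) ∧ ∀ a, ∀ x ∈ F, ‖x * e a - e a * x‖ ≤ ε

lemma HasRohlinProperty.exists_hasRohlinPartitions (hβ : HasRohlinProperty β) (N : ℕ) :
    ∃ (m : ℕ) (h : Fin m → ℕ), (∀ i, N ≤ h i) ∧ HasRohlinPartitions β (towerShift h) := by
  obtain ⟨m, h, hN, H⟩ := hβ N
  refine ⟨m, h, hN, fun F ε hε ↦ ?_⟩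
  obtain ⟨e, hproj, hsum, hshift, hcomm⟩ := H F ε hε
  refine ⟨fun a ↦ e a.1 a.2, fun a ↦ hproj _ _ a.2.2, ?_, fun ⟨i, j⟩ ↦ ?_,
    fun a x hx ↦ (hcomm _ _ a.2.2 x hx).le⟩
  · rw [Fintype.sum_sigma, ← hsum]
    exact Finset.sum_congr rfl fun i _ ↦ (Finset.sum_range (e i)).symm
  · rw [towerShift_apply]
    exact (hshift i j j.2).le

lemma norm_pow_sub_le_of_towerShift {e : (Σ i, Fin (h i)) → B} {ε : ℝ}
    (he : ∀ a, ‖β (e a) - e (towerShift h a)‖ ≤ ε) (i : Fin m) {j : ℕ} (hj : j < h i) :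
    ‖(β ^ j) (e ⟨i, ⟨0, j.zero_le.trans_lt hj⟩⟩) - e ⟨i, ⟨j, hj⟩⟩‖ ≤ j * ε := by
  induction j with
  | zero => simp
  | succ j ih =>
    have hshift := he ⟨i, ⟨j, by omega⟩⟩
    simp only [towerShift_apply, Nat.mod_eq_of_lt hj] at hshift
    have hih := ih (by omega)
    rw [← norm_map_starAlgEquiv β, map_sub, ← pow_succ_apply] at hih
    refine (norm_sub_le_norm_sub_add_norm_sub _ (β (e ⟨i, ⟨j, by omega⟩⟩)) _).trans ?_
    push_cast
    linarith

lemma exists_le_re_map_of_sum_eq_one {ι : Type*} [Fintype ι] {T : B →L[ℂ] ℂ} (h1 : T 1 = 1)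
    {e : ι → B} (hsum : ∑ a, e a = 1) : ∃ a, 1 / ((Fintype.card ι : ℝ) + 1) ≤ (T (e a)).re := by
  by_contra! hlt
  have hle : ∑ a, (T (e a)).re ≤ ∑ _a : ι, 1 / ((Fintype.card ι : ℝ) + 1) :=
    Finset.sum_le_sum fun a _ ↦ (hlt a).le
  rw [← Complex.re_sum, ← map_sum, hsum, h1, Complex.one_re, Finset.sum_const, Finset.card_univ,
    nsmul_eq_mul, mul_one_div, le_div_iff₀ (by positivity)] at hle
  linarith

/-- The projection is the bottom of the tower containing a level of maximal trace. -/
theorem HasRohlinProperty.exists_isStarProjection_almost_orthogonal (hR : HasRohlinProperty β)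
    {T : B →L[ℂ] ℂ} (hT : IsTracial T) (h1 : T 1 = 1) (hβ : ∀ a, T (β a) = T a) (n : ℕ) :
    ∃ ρ > 0, ∀ (F : Finset B) (ε : ℝ), 0 < ε → ∃ e : B, IsStarProjection e ∧ ρ ≤ (T e).re ∧
      (∀ d ∈ Finset.Icc 1 n, ‖e * (β ^ d) e‖ ≤ ε) ∧ ∀ x ∈ F, ‖x * e - e * x‖ ≤ ε := by
  obtain ⟨m, h, hh, H⟩ := hR.exists_hasRohlinPartitions (n + 1)
  set c : ℕ := Fintype.card (Σ i, Fin (h i)) with hc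
  have hhc (i) : h i ≤ c := by
    simpa [hc] using Fintype.card_le_of_injective (Sigma.mk (β := fun i ↦ Fin (h i)) i)
      sigma_mk_injective
  have hc1 : (0 : ℝ) < (c : ℝ) + 1 := by positivity
  refine ⟨1 / (c + 1), by positivity, fun F ε hε ↦ ?_⟩
  set δ : ℝ := min ε (1 / 4) / (c + 1)
  have hδ0 : 0 < δ := by positivity
  have hδc : (c + 1) * δ ≤ min ε (1 / 4) := (mul_div_cancel₀ _ hc1.ne').le
  have hδle {j : ℕ} {i : Fin m} (hj : j < h i) : j * δ ≤ min ε (1 / 4) := by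
    have hjc : (j : ℝ) ≤ c := by exact_mod_cast hj.le.trans (hhc i)
    nlinarith
  obtain ⟨e, he, hsum, hshift, hcomm⟩ := H F δ hδ0
  obtain ⟨⟨i, j⟩, hij⟩ := exists_le_re_map_of_sum_eq_one h1 hsum
  set e₀ := e ⟨i, ⟨0, j.pos⟩⟩
  have hTe₀ : T e₀ = T (e ⟨i, j⟩) := by
    rw [← map_pow_apply β hβ j e₀]
    refine map_eq_of_isStarProjection_near hT ((he _).map _) (he _) ?_
    have := (norm_pow_sub_le_of_towerShift hshift i j.2).trans
      ((hδle j.2).trans (min_le_right _ _))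
    linarith
  refine ⟨e₀, he _, hTe₀ ▸ hij, fun d hd ↦ ?_, fun x hx ↦ (hcomm _ x hx).trans ?_⟩
  · rw [Finset.mem_Icc] at hd
    have hdi : d < h i := by linarith [hh i]
    have hzero : e₀ * e ⟨i, ⟨d, hdi⟩⟩ = 0 := mul_eq_zero_of_sum_eq_one he hsum (by simp; omega)
    rw [← sub_zero (e₀ * _), ← hzero, ← mul_sub]
    refine (norm_mul_le_of_le (he _).norm_le
      (norm_pow_sub_le_of_towerShift hshift i hdi)).trans ?_
    rw [one_mul]
    exact (hδle hdi).trans (min_le_left _ _)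
  · have : (0 : ℝ) ≤ c := c.cast_nonneg
    nlinarith [min_le_left ε (1 / 4)]

end Towers

section Translates

variable {β : B ≃⋆ₐ[ℂ] B} {T : B →L[ℂ] ℂ}

lemma norm_mul_map_le_of_near {e f : B} (he : ‖e‖ ≤ 1) (hf : ‖f‖ ≤ 1) (γ : B ≃⋆ₐ[ℂ] B) {δ : ℝ}
    (hfe : ‖f - e‖ ≤ δ) : ‖f * γ f‖ ≤ ‖e * γ e‖ + 2 * δ := by
  have hγ : ‖γ f‖ ≤ 1 := (norm_map_starAlgEquiv γ f).trans_le hf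
  have hγfe : ‖γ (f - e)‖ ≤ δ := (norm_map_starAlgEquiv γ _).trans_le hfe
  calc ‖f * γ f‖ = ‖e * γ e + ((f - e) * γ f + e * γ (f - e))‖ := by
        rw [map_sub]
        noncomm_ring
    _ ≤ ‖e * γ e‖ + (δ * 1 + 1 * δ) := norm_add_le_of_le le_rfl
        (norm_add_le_of_le (norm_mul_le_of_le hfe hγ) (norm_mul_le_of_le he hγfe))
    _ = ‖e * γ e‖ + 2 * δ := by ring

lemma norm_mul_map_le_of_mul_eq {p e : B} (hp : IsStarProjection p) (he : IsStarProjection e)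
    (hpe : p * e = p) (γ : B ≃⋆ₐ[ℂ] B) : ‖p * γ p‖ ≤ ‖e * γ e‖ := by
  have hep : e * p = p := by
    rw [← hp.isSelfAdjoint.star_eq, ← he.isSelfAdjoint.star_eq, ← star_mul, hpe]
  calc ‖p * γ p‖ = ‖p * (e * γ e) * γ p‖ := by
        rw [mul_assoc, mul_assoc, ← map_mul, hep, ← mul_assoc, hpe]
    _ ≤ 1 * ‖e * γ e‖ * 1 :=
        norm_mul_le_of_le (norm_mul_le_of_le hp.norm_le le_rfl) (hp.map γ).norm_le
    _ = ‖e * γ e‖ := by ring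

lemma norm_star_commutator_of_mem_unitary {y : B} (hy : y ∈ unitary B) (f : B) :
    ‖star y * f - f * star y‖ = ‖y * f - f * y‖ := by
  have hconj : star y * (y * f - f * y) * star y = -(star y * f - f * star y) := by
    simp only [mul_sub, sub_mul, ← mul_assoc, Unitary.star_mul_self_of_mem hy, one_mul, neg_sub]
    rw [mul_assoc _ y, Unitary.mul_star_self_of_mem hy, mul_one]
  rw [← norm_neg, ← hconj, CStarRing.norm_mul_mem_unitary _ (Unitary.star_mem hy),
    CStarRing.norm_mem_unitary_mul _ (Unitary.star_mem hy)]

lemma HasRohlinProperty.exists_mem_comm_isStarProjection (hR : HasRohlinProperty β)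
    (Φ : UHFSystem k B) (hT : IsTraceFunctional T) (hβ : ∀ a, T (β a) = T a) (n : ℕ) :
    ∃ ρ > 0, ∀ r ∈ kAdic k, 0 ≤ r → r ≤ ρ → ∀ (μ : ℕ) (κ : ℝ), 0 < κ → ∃ p ∈ Φ.comm μ,
      IsStarProjection p ∧ T p = r ∧ ∀ d ∈ Finset.Icc 1 n, ‖p * (β ^ d) p‖ ≤ κ := by
  classical
  obtain ⟨ρ, hρ, H⟩ := hR.exists_isStarProjection_almost_orthogonal hT.isTracial hT.map_one hβ n
  refine ⟨ρ, hρ, fun r hr hr0 hrρ μ κ hκ ↦ ?_⟩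
  set η : ℝ := min (1 / 32) (κ / 36)
  have hη : η ≤ 1 / 32 := min_le_left _ _
  have hηκ : η ≤ κ / 36 := min_le_right _ _
  have hη0 : 0 < η := by positivity
  have hkμ : (0 : ℝ) < (k : ℝ) ^ μ := by exact_mod_cast Φ.pow_pos μ
  obtain ⟨e, he, hTe, horth, hcomm⟩ := H
    (Finset.univ.image fun i ↦ Φ.matrixUnit μ (Φ.zero μ) i) (min (κ / 2) (η / 2 / (k : ℝ) ^ μ))
    (by positivity)
  obtain ⟨l, e', ⟨hl, hμ⟩, he', hnear⟩ := Φ.exists_mem_comm_isStarProjection_near he hη0 hη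
    fun i ↦ by
      rw [norm_sub_rev]
      exact (hcomm _ (Finset.mem_image_of_mem _ (Finset.mem_univ i))).trans (min_le_right _ _)
  have hTe' : T e' = T e := map_eq_of_isStarProjection_near hT.isTracial he' he (by linarith)
  obtain ⟨p, hpμ, hp, hpe, hTp⟩ := Φ.exists_mem_comm_isStarProjection_mul_eq
    (T := (T : B →ₗ[ℂ] ℂ)) hT.isTracial hT.map_one he' hl hμ hr hr0
    (hrρ.trans (hTe.trans_eq (congrArg Complex.re hTe'.symm)))
  refine ⟨p, hpμ, hp, hTp, fun d hd ↦ (norm_mul_map_le_of_mul_eq hp he' hpe _).trans ?_⟩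
  have := norm_mul_map_le_of_near he.norm_le he'.norm_le (β ^ d) hnear
  linarith [(horth d hd).trans (min_le_left _ _)]

theorem HasRohlinProperty.exists_unitary_traceLog_eq_of_nonneg (hR : HasRohlinProperty β)
    (Φ : UHFSystem k B) (hT : IsTraceFunctional T) (hβ : ∀ a, T (β a) = T a) {ε : ℝ} (hε : 0 < ε)
    (hε1 : ε ≤ 1 / 10) :
    ∃ ρ > 0, ∀ r ∈ kAdic k, 0 ≤ r → r ≤ ρ → ∀ (F : Finset B) (η : ℝ), 0 < η →
      ∃ y ∈ unitary B, (∀ f ∈ F, ‖y * f - f * y‖ ≤ η) ∧ ‖y * star (β y) - 1‖ ≤ ε ∧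
        traceLog T (y * star (β y)) = 2 * Real.pi * Complex.I * r := by
  classical
  obtain ⟨n, hn⟩ := exists_nat_gt (4 * Real.pi / (ε / 2))
  have hn0 : (0 : ℝ) < n := (by positivity : (0 : ℝ) ≤ _).trans_lt hn
  have hnε : 4 * Real.pi / n ≤ ε / 2 := (div_le_comm₀ (by positivity) hn0).1 hn.le
  obtain ⟨ρ, hρ, H⟩ := hR.exists_mem_comm_isStarProjection Φ hT hβ n
  refine ⟨ρ, hρ, fun r hr hr0 hrρ F η hη ↦ ?_⟩
  set δ : ℝ := η / (n * 7 * 2) with hδ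
  obtain ⟨μ, hμ⟩ := Φ.exists_forall_near
    ((Finset.range n ×ˢ F).image fun x ↦ (β ^ x.1).symm x.2) (δ := δ) (by positivity)
  obtain ⟨p, hpμ, hp, hTp, horth⟩ := H r hr hr0 hrρ μ (ε / 2 / (600 * (n : ℝ) ^ 2)) (by positivity)
  have hramp := isSelfAdjoint_orbitRamp (β := β) (n := n) hp.isSelfAdjoint
  obtain ⟨hnear, htrace⟩ := traceLog_expI_orbitRamp_mul_star hT.isTracial hβ
    (Nat.cast_pos.1 hn0).ne' hp hε1 hnε (by positivity) (mul_div_cancel₀ _ (by positivity)).le horth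
  refine ⟨_, expI_mem_unitary hramp 1, fun f hf ↦ ?_, hnear, htrace.trans (by rw [hTp])⟩
  calc _ ≤ ‖orbitRamp β n p * f - f * orbitRamp β n p‖ :=
        norm_expI_commutator_le hramp f (Set.right_mem_Icc.2 zero_le_one)
    _ ≤ n * (7 * (2 * (1 * δ))) := norm_orbitRamp_commutator_le fun j hj ↦ by
        obtain ⟨a, ha, haf⟩ := hμ ((β ^ j).symm f)
          (Finset.mem_image.2 ⟨(j, f), Finset.mk_mem_product (Finset.mem_range.2 hj) hf, rfl⟩)
        exact Φ.norm_commutator_le_of_near hpμ hp.norm_le ha haf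
    _ = η := by rw [hδ]; field_simp

theorem HasRohlinProperty.exists_unitary_traceLog_eq (hR : HasRohlinProperty β)
    (Φ : UHFSystem k B) (hT : IsTraceFunctional T) (hβ : ∀ a, T (β a) = T a) {ε : ℝ} (hε : 0 < ε) :
    ∃ ρ > 0, ∀ r ∈ kAdic k, |r| ≤ ρ → ∀ (F : Finset B) (η : ℝ), 0 < η →
      ∃ y ∈ unitary B, (∀ f ∈ F, ‖y * f - f * y‖ ≤ η) ∧ ‖y * star (β y) - 1‖ ≤ ε ∧
        traceLog T (y * star (β y)) = 2 * Real.pi * Complex.I * r := by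
  obtain ⟨ρ, hρ, H⟩ := hR.exists_unitary_traceLog_eq_of_nonneg Φ hT hβ
    (show 0 < min ε (1 / 10) by positivity) (min_le_right _ _)
  refine ⟨ρ, hρ, fun r hr hrρ F η hη ↦ ?_⟩
  obtain hr0 | hr0 := le_total 0 r
  · obtain ⟨y, hy, hcomm, hnear, htrace⟩ := H r hr hr0 (by rwa [abs_of_nonneg hr0] at hrρ) F η hη
    exact ⟨y, hy, hcomm, hnear.trans (min_le_left _ _), htrace⟩
  obtain ⟨y, hy, hcomm, hnear, htrace⟩ :=
    H (-r) (neg_mem hr) (neg_nonneg.2 hr0) (by rwa [abs_of_nonpos hr0] at hrρ) F η hη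
  have hβy : β y ∈ unitary B := Unitary.map_mem β hy
  have hconj : star y * β y = star y * star (y * star (β y)) * star (star y) := by
    rw [star_mul, star_star, star_star, ← mul_assoc (star y), mul_assoc _ (star y) y,
      Unitary.star_mul_self_of_mem hy, mul_one]
  refine ⟨star y, Unitary.star_mem hy, fun f hf ↦ ?_, ?_, ?_⟩
  · exact (norm_star_commutator_of_mem_unitary hy f).trans_le (hcomm f hf)
  · rw [map_star, star_star, norm_star_mul_sub_one hy, norm_sub_rev, ← norm_mul_star_sub_one hβy]
    exact hnear.trans (min_le_left _ _)
  · rw [map_star, star_star, hconj, traceLog_conj_of_mem_unitary hT.isTracial (Unitary.star_mem hy),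
      traceLog_star_of_mem_unitary hT.isTracial (mul_mem hy (Unitary.star_mem hβy))
        (hnear.trans ((min_le_right _ _).trans (by norm_num))), htrace]
    push_cast
    ring

end Translates

section Gluing

variable {ι : Type*} [Fintype ι] {e x y : ι → B}

lemma sum_conj_mul_sum_conj (he : ∀ i, IsStarProjection (e i)) (hsum : ∑ i, e i = 1)
    (x y : ι → B) :
    (∑ a, e a * x a * e a) * ∑ a, e a * y a * e a = ∑ a, e a * (x a * e a * y a) * e a := by
  rw [Finset.sum_mul]
  refine Finset.sum_congr rfl fun a _ ↦ ?_
  rw [mul_assoc (e a * x a), mul_sum_conj he hsum]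
  simp only [mul_assoc]

lemma norm_sum_conj_mul_sum_conj_sub_one_le (he : ∀ i, IsStarProjection (e i))
    (hsum : ∑ i, e i = 1) (hx : ∀ a, x a ∈ unitary B) (hxy : ∀ a, x a * y a = 1) {κ : ℝ}
    (hκ : 0 ≤ κ) (hcomm : ∀ a, ‖y a * e a - e a * y a‖ ≤ κ) :
    ‖(∑ a, e a * x a * e a) * (∑ a, e a * y a * e a) - 1‖ ≤ κ := by
  have hterm (a : ι) : e a * (x a * e a * y a) * e a - e a =
      e a * (x a * (e a * y a - y a * e a)) * e a := by
    rw [mul_sub, mul_sub, sub_mul, ← mul_assoc (x a) (y a), hxy, one_mul,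
      (he a).isIdempotentElem.eq, (he a).isIdempotentElem.eq, mul_assoc (x a)]
  rw [sum_conj_mul_sum_conj he hsum]
  nth_rewrite 1 [← hsum]
  rw [← Finset.sum_sub_distrib]
  simp only [hterm]
  refine norm_sum_conj_le he hsum _ hκ fun a ↦ ?_
  rw [CStarRing.norm_mem_unitary_mul _ (hx a), norm_sub_rev]
  exact hcomm a

lemma norm_star_commutator (a f : B) :
    ‖star a * f - f * star a‖ = ‖a * star f - star f * a‖ := by
  rw [← norm_star, star_sub, star_mul, star_mul, star_star, norm_sub_rev]

lemma isUnit_of_isUnit_mul {M : Type*} [Monoid M] {a b c : M} (hab : IsUnit (a * b))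
    (hca : IsUnit (c * a)) : IsUnit a := by
  obtain ⟨d, hd⟩ := hab.exists_right_inv
  obtain ⟨d', hd'⟩ := hca.exists_left_inv
  exact isUnit_iff_exists_and_exists.2
    ⟨⟨b * d, by rw [← mul_assoc, hd]⟩, ⟨d' * c, by rw [mul_assoc, hd']⟩⟩

lemma exists_unitary_near_sum_conj (he : ∀ i, IsStarProjection (e i)) (hsum : ∑ i, e i = 1)
    (hx : ∀ a, x a ∈ unitary B) {κ : ℝ} (hκ : 0 ≤ κ) (hκ1 : κ ≤ 1 / 8)
    (hcomm : ∀ a, ‖x a * e a - e a * x a‖ ≤ κ) :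
    ∃ v ∈ unitary B, ‖v - ∑ a, e a * x a * e a‖ ≤ κ := by
  set v₀ := ∑ a, e a * x a * e a with hv₀
  have hstar : star v₀ = ∑ a, e a * star (x a) * e a := by
    simp only [hv₀, star_sum, star_mul, (he _).isSelfAdjoint.star_eq, mul_assoc]
  have hcomm_star (a : ι) : ‖star (x a) * e a - e a * star (x a)‖ ≤ κ := by
    rw [norm_star_commutator, (he a).isSelfAdjoint.star_eq]
    exact hcomm a
  have hleft : ‖star v₀ * v₀ - 1‖ ≤ κ := by
    rw [hstar]
    exact norm_sum_conj_mul_sum_conj_sub_one_le he hsum (fun a ↦ Unitary.star_mem (hx a))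
      (fun a ↦ Unitary.star_mul_self_of_mem (hx a)) hκ hcomm
  have hright : ‖v₀ * star v₀ - 1‖ ≤ κ := by
    rw [hstar]
    exact norm_sum_conj_mul_sum_conj_sub_one_le he hsum hx
      (fun a ↦ Unitary.mul_star_self_of_mem (hx a)) hκ hcomm_star
  have hunit : IsUnit v₀ := isUnit_of_isUnit_mul
    (isUnit_of_norm_sub_one_lt (hright.trans_lt (by linarith)))
    (isUnit_of_norm_sub_one_lt (hleft.trans_lt (by linarith)))
  obtain ⟨v, hv, -, hvv₀⟩ := exists_unitary_mem_near_of_isUnit (S := (⊤ : StarSubalgebra ℂ B))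
    (by simp) StarSubalgebra.mem_top hunit (by linarith)
  refine ⟨v, hv, hvv₀.trans ?_⟩
  simpa using mul_le_mul (norm_sum_conj_le he hsum x zero_le_one
    fun a ↦ norm_le_one_of_mem_unitary (hx a)) hleft (norm_nonneg _) zero_le_one

lemma norm_sum_conj_commutator_le (he : ∀ i, IsStarProjection (e i)) (hsum : ∑ i, e i = 1)
    (hx : ∀ a, ‖x a‖ ≤ 1) {κ η : ℝ} (hη : 0 ≤ η) {f : B} (hf : ∀ a, ‖f * e a - e a * f‖ ≤ κ)
    (hxf : ∀ a, ‖x a * f - f * x a‖ ≤ η) :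
    ‖(∑ a, e a * x a * e a) * f - f * ∑ a, e a * x a * e a‖ ≤ η + Fintype.card ι * (2 * κ) := by
  have hsplit : (∑ a, e a * x a * e a) * f - f * ∑ a, e a * x a * e a =
      ∑ a, e a * (x a * f - f * x a) * e a +
        ∑ a, (e a * x a * (e a * f - f * e a) + (e a * f - f * e a) * (x a * e a)) := by
    rw [Finset.sum_mul, Finset.mul_sum, ← Finset.sum_sub_distrib, ← Finset.sum_add_distrib]
    refine Finset.sum_congr rfl fun a _ ↦ ?_
    noncomm_ring
  have hterm (a : ι) :
      ‖e a * x a * (e a * f - f * e a) + (e a * f - f * e a) * (x a * e a)‖ ≤ 2 * κ := by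
    have hef : ‖e a * f - f * e a‖ ≤ κ := by
      rw [norm_sub_rev]
      exact hf a
    refine (norm_add_le_of_le (norm_mul_le_of_le (norm_mul_le_of_le (he a).norm_le (hx a)) hef)
      (norm_mul_le_of_le hef (norm_mul_le_of_le (hx a) (he a).norm_le))).trans_eq ?_
    ring
  rw [hsplit]
  exact norm_add_le_of_le (norm_sum_conj_le he hsum _ hη hxf)
    ((norm_sum_le_of_le _ fun a _ ↦ hterm a).trans_eq (by simp))

lemma norm_mul_conj_sub_conj_le {p q x u : B} (hp : ‖p‖ ≤ 1) (hq : ‖q‖ ≤ 1) (hx : ‖x‖ ≤ 1)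
    (hu : ‖u‖ ≤ 1) {κ : ℝ} (hpq : ‖p - q‖ ≤ κ) (huq : ‖u * q - q * u‖ ≤ κ) :
    ‖u * (p * x * p) - q * (u * x) * q‖ ≤ 3 * κ := by
  calc ‖u * (p * x * p) - q * (u * x) * q‖
      = ‖u * (p - q) * x * p + (u * q - q * u) * x * p + q * (u * x) * (p - q)‖ := by
        congr 1
        noncomm_ring
    _ ≤ 1 * κ * 1 * 1 + κ * 1 * 1 + 1 * (1 * 1) * κ := by
        refine norm_add_le_of_le (norm_add_le_of_le ?_ ?_) ?_
        · exact norm_mul_le_of_le (norm_mul_le_of_le (norm_mul_le_of_le hu hpq) hx) hp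
        · exact norm_mul_le_of_le (norm_mul_le_of_le huq hx) hp
        · exact norm_mul_le_of_le (norm_mul_le_of_le hq (norm_mul_le_of_le hu hx)) hpq
    _ = 3 * κ := by ring

variable {β : B ≃⋆ₐ[ℂ] B} {σ : Equiv.Perm ι} {u : B}

lemma norm_mul_map_sum_conj_sub_le (he : ∀ i, IsStarProjection (e i)) (hsum : ∑ i, e i = 1)
    {δ θ : ℝ} (hθ : 0 ≤ θ) (heσ : ∀ a, ‖β (e a) - e (σ a)‖ ≤ δ) (hu : ‖u‖ ≤ 1)
    (hue : ∀ a, ‖u * e a - e a * u‖ ≤ δ) (hx : ∀ a, ‖x a‖ ≤ 1)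
    (hxσ : ∀ a, ‖u * β (x a) - x (σ a)‖ ≤ θ) :
    ‖u * β (∑ a, e a * x a * e a) - ∑ a, e a * x a * e a‖ ≤ Fintype.card ι * (3 * δ) + θ := by
  have hsplit : u * β (∑ a, e a * x a * e a) - ∑ a, e a * x a * e a =
      ∑ a, (u * (β (e a) * β (x a) * β (e a)) - e (σ a) * (u * β (x a)) * e (σ a)) +
        ∑ a, e a * (u * β (x (σ.symm a)) - x a) * e a := by
    rw [← Equiv.sum_comp σ fun a ↦ e a * (u * β (x (σ.symm a)) - x a) * e a]
    simp only [map_sum, map_mul, mul_sub, sub_mul, Equiv.symm_apply_apply, Finset.sum_sub_distrib,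
      Equiv.sum_comp σ fun a ↦ e a * x a * e a, Finset.mul_sum]
    abel
  rw [hsplit]
  refine norm_add_le_of_le ((norm_sum_le_of_le _ fun a _ ↦ norm_mul_conj_sub_conj_le
    ((he a).map β).norm_le (he _).norm_le ((norm_map_starAlgEquiv β _).trans_le (hx a)) hu (heσ a)
    (hue _)).trans_eq (by simp)) (norm_sum_conj_le he hsum _ hθ fun a ↦ ?_)
  simpa using hxσ (σ.symm a)

lemma norm_commutator_le_of_norm_sub_le {v w f : B} {δ : ℝ} (hvw : ‖v - w‖ ≤ δ) :
    ‖v * f - f * v‖ ≤ ‖w * f - f * w‖ + 2 * (‖f‖ * δ) := by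
  calc ‖v * f - f * v‖ = ‖w * f - f * w + ((v - w) * f - f * (v - w))‖ := by
        congr 1
        noncomm_ring
    _ ≤ ‖w * f - f * w‖ + (δ * ‖f‖ + ‖f‖ * δ) := norm_add_le_of_le le_rfl
        (norm_sub_le_of_le (norm_mul_le_of_le hvw le_rfl) (norm_mul_le_of_le le_rfl hvw))
    _ = ‖w * f - f * w‖ + 2 * (‖f‖ * δ) := by ring

lemma norm_mul_star_map_mul_star_sub_one {v : B} (hu : u ∈ unitary B) (hv : v ∈ unitary B) :
    ‖v * star (β v) * star u - 1‖ = ‖v - u * β v‖ := by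
  rw [mul_assoc, ← star_mul, norm_mul_star_sub_one (mul_mem hu (Unitary.map_mem β hv))]

/-- The unitary is a perturbation of `∑ a, e a * x a * e a`, for a partition of unity `e` which `β`
permutes. -/
theorem HasRohlinPartitions.exists_unitary (H : HasRohlinPartitions β σ) (hu : u ∈ unitary B)
    (hx : ∀ a, x a ∈ unitary B) {η θ : ℝ} (hη : 0 ≤ η) (hθ : 0 ≤ θ)
    (hxσ : ∀ a, ‖u * β (x a) - x (σ a)‖ ≤ θ) {F : Finset B}
    (hF : ∀ a, ∀ f ∈ F, ‖x a * f - f * x a‖ ≤ η) {κ : ℝ} (hκ : 0 < κ) :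
    ∃ v ∈ unitary B, (∀ f ∈ F, ‖v * f - f * v‖ ≤ η + κ) ∧
      ‖v * star (β v) * star u - 1‖ ≤ θ + κ := by
  classical
  set c : ℝ := (Fintype.card ι : ℝ)
  set C : ℝ := ∑ f ∈ F, ‖f‖
  have hc : 0 ≤ c := Nat.cast_nonneg _
  have hC : 0 ≤ C := Finset.sum_nonneg fun _ _ ↦ norm_nonneg _
  set δ : ℝ := min (1 / 8) (κ / (3 * c + 2 * C + 2))
  have hδ : 0 < δ := by positivity
  have hδκ : δ * (3 * c + 2 * C + 2) ≤ κ := (le_div_iff₀ (by positivity)).1 (min_le_right _ _)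
  obtain ⟨e, he, hsum, heσ, hcomm⟩ := H (insert u (F ∪ Finset.univ.image x)) δ hδ
  obtain ⟨v, hv, hvv₀⟩ := exists_unitary_near_sum_conj he hsum hx hδ.le (min_le_left _ _)
    fun a ↦ hcomm a _ (by simp)
  have hx1 (a : ι) : ‖x a‖ ≤ 1 := norm_le_one_of_mem_unitary (hx a)
  set v₀ := ∑ a, e a * x a * e a
  refine ⟨v, hv, fun f hf ↦ ?_, ?_⟩
  · have hcomm₀ : ‖v₀ * f - f * v₀‖ ≤ η + c * (2 * δ) := norm_sum_conj_commutator_le he hsum hx1 hη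
      (fun a ↦ hcomm a f (by simp [hf])) fun a ↦ hF a f hf
    have hfC : ‖f‖ ≤ C := Finset.single_le_sum (f := norm) (fun _ _ ↦ norm_nonneg _) hf
    have := norm_commutator_le_of_norm_sub_le (f := f) hvv₀
    nlinarith
  · have hdefect : ‖u * β v₀ - v₀‖ ≤ c * (3 * δ) + θ := norm_mul_map_sum_conj_sub_le he hsum hθ heσ
      (norm_le_one_of_mem_unitary hu) (fun a ↦ hcomm a u (by simp)) hx1 hxσ
    have hδv : ‖u * β (v - v₀)‖ ≤ δ := by
      rwa [CStarRing.norm_mem_unitary_mul _ hu, norm_map_starAlgEquiv]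
    rw [norm_mul_star_map_mul_star_sub_one hu hv]
    calc ‖v - u * β v‖ = ‖v - v₀ - (u * β v₀ - v₀) - u * β (v - v₀)‖ := by
          rw [map_sub]
          noncomm_ring
      _ ≤ δ + (c * (3 * δ) + θ) + δ := norm_sub_le_of_le (norm_sub_le_of_le hvv₀ hdefect) hδv
      _ ≤ θ + κ := by nlinarith [mul_nonneg hC hδ.le]

end Gluing

section Cocycle

variable {β : B ≃⋆ₐ[ℂ] B} {u : B}

/-- The product `u * β u * ⋯ * β^(n-1) u`, i.e. the value at `n` of the `β`-cocycle with value `u`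
at `1`. -/
def cocycle (β : B ≃⋆ₐ[ℂ] B) (u : B) : ℕ → B
  | 0 => 1
  | n + 1 => u * β (cocycle β u n)

lemma cocycle_mem_unitary (β : B ≃⋆ₐ[ℂ] B) (hu : u ∈ unitary B) (n : ℕ) :
    cocycle β u n ∈ unitary B := by
  induction n with
  | zero => exact one_mem _
  | succ n ih => exact mul_mem hu (Unitary.map_mem β ih)

lemma norm_map_commutator (γ : B ≃⋆ₐ[ℂ] B) (x f : B) :
    ‖γ x * f - f * γ x‖ = ‖x * γ.symm f - γ.symm f * x‖ := by
  rw [← norm_map_starAlgEquiv γ (x * _ - _), map_sub, map_mul, map_mul, γ.apply_symm_apply]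

lemma pow_succ_symm_apply (β : B ≃⋆ₐ[ℂ] B) (n : ℕ) (x : B) :
    (β ^ (n + 1)).symm x = (β ^ n).symm (β.symm x) :=
  (β ^ (n + 1)).symm_apply_eq.2 <| by
    rw [pow_succ_apply, StarAlgEquiv.apply_symm_apply, StarAlgEquiv.apply_symm_apply]

lemma norm_cocycle_commutator_le (hu : u ∈ unitary B) {δ : ℝ} {n : ℕ} {f : B}
    (hf : ∀ j < n, ‖u * (β ^ j).symm f - (β ^ j).symm f * u‖ ≤ δ) :
    ‖cocycle β u n * f - f * cocycle β u n‖ ≤ n * δ := by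
  induction n generalizing f with
  | zero => simp [cocycle]
  | succ n ih =>
    have hfirst := hf 0 n.succ_pos
    have hrest := ih (f := β.symm f) fun j hj ↦ by
      rw [← pow_succ_symm_apply]
      exact hf (j + 1) (by omega)
    calc _ ≤ ‖u * f - f * u‖ + ‖β (cocycle β u n) * f - f * β (cocycle β u n)‖ :=
          norm_mul_commutator_le hu (Unitary.map_mem β (cocycle_mem_unitary β hu n)) f
      _ ≤ δ + n * δ := add_le_add hfirst (by rwa [norm_map_commutator])
      _ = (n + 1 : ℕ) * δ := by push_cast; ring

section Cobounding

variable {m : ℕ} {h : Fin m → ℕ} {a : Fin m → B}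

/-- The elements glued along Rohlin towers. The second factor runs from `1` at the bottom of the
`i`-th tower to an approximate inverse of `cocycle β u (h i)` at its top, so that
`u * β (coboundingLevel β u a (i, j))` is close to the element of the next level. -/
noncomputable def coboundingLevel (β : B ≃⋆ₐ[ℂ] B) (u : B) (a : Fin m → B) (s : Σ i, Fin (h i)) :
    B :=
  cocycle β u s.2 * (β ^ (s.2 : ℕ)) (expI (a s.1) ((s.2 : ℕ) / (h s.1 : ℝ)))

lemma coboundingLevel_mem_unitary (hu : u ∈ unitary B) (ha : ∀ i, IsSelfAdjoint (a i))
    (s : Σ i, Fin (h i)) : coboundingLevel β u a s ∈ unitary B :=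
  mul_mem (cocycle_mem_unitary β hu _) (Unitary.map_mem _ (expI_mem_unitary (ha _) _))

lemma norm_mul_map_coboundingLevel_sub_le (hu : u ∈ unitary B) {ε : ℝ}
    (ha : ∀ i, IsSelfAdjoint (a i)) (haε : ∀ i, ‖a i‖ ≤ ε * h i)
    (hend : ∀ i, ‖expI (a i) 1 - (β ^ h i).symm (star (cocycle β u (h i)))‖ ≤ ε)
    (s : Σ i, Fin (h i)) :
    ‖u * β (coboundingLevel β u a s) - coboundingLevel β u a (towerShift h s)‖ ≤ 2 * ε := by
  obtain ⟨i, j⟩ := s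
  have hi : (0 : ℝ) < h i := Nat.cast_pos.2 j.pos
  set c := cocycle β u (j + 1)
  have hc : c ∈ unitary B := cocycle_mem_unitary β hu _
  have hdist (y z : B) : ‖c * (β ^ (j + 1 : ℕ)) y - c * (β ^ (j + 1 : ℕ)) z‖ = ‖y - z‖ := by
    rw [← mul_sub, CStarRing.norm_mem_unitary_mul _ hc, ← map_sub, norm_map_starAlgEquiv]
  have hstep : ‖expI (a i) (j / h i) - expI (a i) ((j + 1) / h i)‖ ≤ ε := by
    refine (norm_expI_sub_expI_le (ha i) _ _).trans ?_
    rw [← sub_div, sub_add_cancel_left, abs_div, abs_neg, abs_one, abs_of_pos hi, mul_one_div,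
      div_le_iff₀ hi]
    exact haε i
  have hlevel : u * β (coboundingLevel β u a ⟨i, j⟩) =
      c * (β ^ (j + 1 : ℕ)) (expI (a i) (j / h i)) := by
    rw [coboundingLevel, map_mul, ← mul_assoc, pow_succ_apply]
    rfl
  rw [hlevel, towerShift_apply]
  obtain hj | hj := Nat.lt_or_ge (j + 1) (h i)
  · have hnext : coboundingLevel β u a ⟨i, ⟨(j + 1) % h i, Nat.mod_lt _ j.pos⟩⟩ =
        c * (β ^ (j + 1 : ℕ)) (expI (a i) ((j + 1) / h i)) := by
      simp [coboundingLevel, Nat.mod_eq_of_lt hj, c]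
    rw [hnext, hdist]
    linarith [(norm_nonneg _).trans hstep]
  · have hj' : (j : ℕ) + 1 = h i := le_antisymm j.2 hj
    have hnext : coboundingLevel β u a ⟨i, ⟨(j + 1) % h i, Nat.mod_lt _ j.pos⟩⟩ =
        c * (β ^ (j + 1 : ℕ)) ((β ^ h i).symm (star (cocycle β u (h i)))) := by
      rw [hj', StarAlgEquiv.apply_symm_apply, show c = cocycle β u (h i) by rw [← hj'],
        Unitary.mul_star_self_of_mem (cocycle_mem_unitary β hu _)]
      simp [coboundingLevel, cocycle]
    rw [show ((j : ℝ) + 1) / h i = 1 by rw [div_eq_one_iff_eq hi.ne']; exact_mod_cast hj'] at hstep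
    rw [hnext, hdist]
    refine (norm_sub_le_norm_sub_add_norm_sub _ (expI (a i) 1) _).trans ?_
    linarith [hend i]

lemma HasRohlinPartitions.exists_unitary_of_log (H : HasRohlinPartitions β (towerShift h)) {ε : ℝ}
    (hε : 0 < ε) (hu : u ∈ unitary B) {F : Finset B} (ha : ∀ i, IsSelfAdjoint (a i))
    (haε : ∀ i, ‖a i‖ ≤ ε / 4 * h i)
    (hend : ∀ i, ‖expI (a i) 1 - (β ^ h i).symm (star (cocycle β u (h i)))‖ ≤ ε / 4)
    (haF : ∀ i, ∀ j < h i, ∀ f ∈ F, ‖a i * (β ^ j).symm f - (β ^ j).symm f * a i‖ ≤ ε / 4)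
    (huF : ∀ i, ∀ j < h i, ∀ f ∈ F, ‖cocycle β u j * f - f * cocycle β u j‖ ≤ ε / 4) :
    ∃ v ∈ unitary B, (∀ f ∈ F, ‖v * f - f * v‖ ≤ ε) ∧ ‖v * star (β v) * star u - 1‖ ≤ ε := by
  have hF (s : Σ i, Fin (h i)) (f) (hf : f ∈ F) :
      ‖coboundingLevel β u a s * f - f * coboundingLevel β u a s‖ ≤ ε / 2 := by
    obtain ⟨i, j⟩ := s
    have hj : (j / h i : ℝ) ∈ Set.Icc (0 : ℝ) 1 :=
      ⟨by positivity, div_le_one_of_le₀ (by exact_mod_cast j.2.le) (by positivity)⟩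
    refine (norm_mul_commutator_le (cocycle_mem_unitary β hu _)
      (Unitary.map_mem _ (expI_mem_unitary (ha _) _)) f).trans ?_
    rw [norm_map_commutator]
    linarith [huF i j j.2 f hf, haF i j j.2 f hf,
      norm_expI_commutator_le (ha i) ((β ^ (j : ℕ)).symm f) hj]
  obtain ⟨v, hv, hvF, hvu⟩ := H.exists_unitary hu (coboundingLevel_mem_unitary hu ha)
    (half_pos hε).le (by positivity : 0 ≤ 2 * (ε / 4))
    (norm_mul_map_coboundingLevel_sub_le hu ha haε hend) hF (half_pos hε)
  exact ⟨v, hv, fun f hf ↦ (hvF f hf).trans (by linarith), hvu.trans (by linarith)⟩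

end Cobounding

lemma exists_forall_norm_cocycle_commutator_le (β : B ≃⋆ₐ[ℂ] B) (M : ℕ) (G : Finset B) {η : ℝ}
    (hη : 0 < η) : ∃ (F : Finset B) (δ : ℝ), 0 < δ ∧ ∀ u ∈ unitary B,
      (∀ x ∈ F, ‖u * x - x * u‖ ≤ δ) →
      ∀ j ≤ M, ∀ g ∈ G, ‖cocycle β u j * g - g * cocycle β u j‖ ≤ η := by
  classical
  refine ⟨(Finset.range M ×ˢ G).image fun x ↦ (β ^ x.1).symm x.2, η / (M + 1), by positivity,
    fun u hu huF j hj g hg ↦ ?_⟩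
  have hcomm (s : ℕ) (hs : s < j) :
      ‖u * (β ^ s).symm g - (β ^ s).symm g * u‖ ≤ η / (M + 1) :=
    huF _ (Finset.mem_image.2 ⟨(s, g),
      Finset.mem_product.2 ⟨Finset.mem_range.2 (hs.trans_le hj), hg⟩, rfl⟩)
  have hjM : (j : ℝ) ≤ M + 1 := by exact_mod_cast hj.trans M.le_succ
  calc _ ≤ j * (η / (M + 1)) := norm_cocycle_commutator_le hu hcomm
    _ ≤ (M + 1) * (η / (M + 1)) := by gcongr
    _ = η := by field_simp

lemma UHFSystem.exists_mem_comm_norm_expI_sub_symm_star_le (Φ : UHFSystem k B) (m : ℕ) {η : ℝ}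
    (hη : 0 < η) : ∃ δ > 0, ∀ γ : B ≃⋆ₐ[ℂ] B, ∀ w ∈ unitary B,
      (∀ i, ‖w * γ (Φ.matrixUnit m i (Φ.zero m)) - γ (Φ.matrixUnit m i (Φ.zero m)) * w‖ ≤ δ) →
      ∃ a ∈ Φ.comm m, IsSelfAdjoint a ∧ ‖a‖ ≤ Real.pi ∧ ‖expI a 1 - γ.symm (star w)‖ ≤ η := by
  obtain ⟨δ, hδ, hlog⟩ := Φ.exists_mem_comm_norm_expI_sub_le m hη
  refine ⟨δ, hδ, fun γ w hw hwδ ↦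
    hlog _ (Unitary.map_mem _ (Unitary.star_mem hw)) fun i ↦ ?_⟩
  rw [norm_map_commutator, norm_star_commutator, StarAlgEquiv.symm_symm, ← map_star,
    Φ.star_matrixUnit]
  exact hwδ i

lemma HasRohlinProperty.exists_long_towers (hR : HasRohlinProperty β) {ε : ℝ} (hε : 0 < ε) :
    ∃ (m : ℕ) (h : Fin m → ℕ), (∀ i, Real.pi ≤ ε * h i) ∧
      HasRohlinPartitions β (towerShift h) := by
  obtain ⟨N, hN⟩ := exists_nat_ge (Real.pi / ε)
  obtain ⟨m, h, hh, H⟩ := hR.exists_hasRohlinPartitions N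
  refine ⟨m, h, fun i ↦ ?_, H⟩
  rw [← div_le_iff₀' hε]
  exact hN.trans (by exact_mod_cast hh i)

theorem HasRohlinProperty.exists_approx_cobounding_of_mem_unitary (hR : HasRohlinProperty β)
    (Φ : UHFSystem k B) {ε : ℝ} (hε : 0 < ε) (hu : u ∈ unitary B) :
    ∃ v ∈ unitary B, ‖v * star (β v) * star u - 1‖ ≤ ε := by
  obtain ⟨m, h, hπ, H⟩ := hR.exists_long_towers (by positivity : 0 < ε / 4)
  obtain ⟨δ, hδ, hlog⟩ :=
    Φ.exists_mem_comm_norm_expI_sub_symm_star_le 0 (by positivity : 0 < ε / 4)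
  choose a _ ha haπ hend using fun i ↦ hlog (β ^ h i) _ (cocycle_mem_unitary β hu (h i)) fun s ↦ by
    simpa [Φ.matrixUnit_level_zero] using hδ.le
  obtain ⟨v, hv, -, hvu⟩ := H.exists_unitary_of_log hε hu (F := ∅) ha
    (fun i ↦ (haπ i).trans (hπ i)) hend (by simp) (by simp)
  exact ⟨v, hv, hvu⟩

theorem HasRohlinProperty.exists_approx_cobounding (hR : HasRohlinProperty β) (Φ : UHFSystem k B)
    (F : Finset B) {ε : ℝ} (hε : 0 < ε) :
    ∃ (F' : Finset B) (δ : ℝ), 0 < δ ∧ ∀ u ∈ unitary B, (∀ x ∈ F', ‖u * x - x * u‖ ≤ δ) →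
      ∃ v ∈ unitary B, (∀ f ∈ F, ‖v * f - f * v‖ ≤ ε) ∧ ‖v * star (β v) * star u - 1‖ ≤ ε := by
  classical
  obtain ⟨m, h, hπ, H⟩ := hR.exists_long_towers (by positivity : 0 < ε / 4)
  have hsum (i) : h i ≤ ∑ i, h i :=
    Finset.single_le_sum (f := h) (fun _ _ ↦ Nat.zero_le _) (Finset.mem_univ i)
  obtain ⟨l, hl⟩ := Φ.exists_forall_near
    ((Finset.range (∑ i, h i) ×ˢ F).image fun x ↦ (β ^ x.1).symm x.2)
    (by positivity : 0 < ε / (8 * Real.pi))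
  obtain ⟨δ, hδ, hlog⟩ :=
    Φ.exists_mem_comm_norm_expI_sub_symm_star_le l (by positivity : 0 < ε / 4)
  obtain ⟨F', δ', hδ', hF'⟩ := exists_forall_norm_cocycle_commutator_le β (∑ i, h i)
    (F ∪ Finset.univ.image fun x : Fin m × Fin (k ^ l) ↦
      (β ^ h x.1) (Φ.matrixUnit l x.2 (Φ.zero l)))
    (by positivity : 0 < min δ (ε / 4))
  refine ⟨F', δ', hδ', fun u hu huF ↦ ?_⟩
  have hcocycle := hF' u hu huF
  choose a hal ha haπ hend using fun i ↦ hlog (β ^ h i) _ (cocycle_mem_unitary β hu (h i)) fun s ↦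
    (hcocycle _ (hsum i) _ (Finset.mem_union_right _
      (Finset.mem_image_of_mem _ (Finset.mem_univ (i, s))))).trans (min_le_left _ _)
  refine H.exists_unitary_of_log hε hu ha (fun i ↦ (haπ i).trans (hπ i)) hend
    (fun i j hj f hf ↦ ?_) fun i j hj f hf ↦
      (hcocycle j (hj.le.trans (hsum i)) f (Finset.mem_union_left _ hf)).trans (min_le_right _ _)
  obtain ⟨y, hy, hyf⟩ := hl ((β ^ j).symm f) (Finset.mem_image.2 ⟨(j, f),
    Finset.mem_product.2 ⟨Finset.mem_range.2 (hj.trans_le (hsum i)), hf⟩, rfl⟩)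
  calc _ ≤ 2 * (Real.pi * (ε / (8 * Real.pi))) :=
        Φ.norm_commutator_le_of_near (hal i) (haπ i) hy hyf
    _ = ε / 4 := by field_simp; norm_num

end Cocycle

section TracelessCobounding

variable {β : B ≃⋆ₐ[ℂ] B} {T : B →L[ℂ] ℂ}

section Logarithm

variable {g : B}

lemma spectrum_subset_slitPlane_of_norm_sub_one_lt (hg : g ∈ unitary B) (h : ‖g - 1‖ < 1) :
    spectrum ℂ g ⊆ Complex.slitPlane :=
  (Unitary.spectrum_subset_slitPlane_iff_norm_lt_two hg).2 (h.trans one_lt_two)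

lemma inLogDomain_of_norm_sub_one_lt (hg : g ∈ unitary B) (h : ‖g - 1‖ < 1) : InLogDomain g :=
  ⟨⟨by rw [commute_iff_eq, Unitary.star_mul_self_of_mem hg, Unitary.mul_star_self_of_mem hg]⟩,
    spectrum_subset_slitPlane_of_norm_sub_one_lt hg h⟩

lemma clog_eq_I_smul_argSelfAdjoint (hg : g ∈ unitary B) (h : ‖g - 1‖ < 1) :
    clog g = Complex.I • (Unitary.argSelfAdjoint ⟨g, hg⟩ : B) := by
  have harg : ContinuousOn (fun z : ℂ ↦ (z.arg : ℂ)) (spectrum ℂ g) :=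
    Complex.continuous_ofReal.comp_continuousOn
      (Complex.continuousOn_arg.mono (spectrum_subset_slitPlane_of_norm_sub_one_lt hg h))
  rw [Unitary.argSelfAdjoint_coe, ← cfc_smul Complex.I (fun z : ℂ ↦ (z.arg : ℂ)) g harg, clog]
  refine cfc_congr fun z hz ↦ ?_
  have hz1 : ‖z‖ = 1 := spectrum.norm_eq_one_of_unitary hg hz
  exact Complex.ext (by simp [Complex.log_re, hz1]) (by simp [Complex.log_im])

lemma IsTracial.map_clog (hT : IsTracial T) (hg : g ∈ unitary B) (h : ‖g - 1‖ < 1) :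
    T (clog g) = traceLog T g := by
  have hlt : ‖((⟨g, hg⟩ : unitary B) : B) - 1‖ < 2 := h.trans one_lt_two
  have hexp : NormedSpace.exp (clog g) = g := by
    rw [clog_eq_I_smul_argSelfAdjoint hg h, ← selfAdjoint.expUnitary_coe,
      expUnitary_argSelfAdjoint hlt]
  have hpath (t : ℝ) (ht : t ∈ Set.Icc (0 : ℝ) 1) : ‖NormedSpace.exp (t • clog g) - 1‖ < 1 := by
    have hle := Unitary.norm_expUnitary_smul_argSelfAdjoint_sub_one_le ⟨g, hg⟩ ht hlt
    rw [selfAdjoint.expUnitary_coe, selfAdjoint.val_smul, smul_comm,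
      ← clog_eq_I_smul_argSelfAdjoint hg h] at hle
    exact hle.trans_lt h
  rw [← traceLog_exp hT hpath, hexp]

end Logarithm

lemma exists_traceLog_eq_of_hasDeterminant_zero (hT : IsTraceFunctional T) (Φ : UHFSystem k B)
    (hβ : ∀ a, T (β a) = T a) {u : unitary B} (hu : HasDeterminant (T : B →ₗ[ℂ] ℂ) u 0) {v : B}
    (hv : v ∈ unitary B) (h : ‖v * star (β v) * star (u : B) - 1‖ ≤ 1 / 20) :
    ∃ r ∈ kAdic k, traceLog T (v * star (β v) * star (u : B)) = 2 * Real.pi * Complex.I * r := by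
  obtain ⟨r, hr, hru⟩ := HasDeterminant.exists_hasTraceLog Φ hT hu
  obtain ⟨c, hc⟩ := HasTraceLog.exists_of_mem_unitary T Φ hv
  have hg := (hc.mul ((hc.map β hβ).star hT.isTracial)).mul (hru.star hT.isTracial)
  have hclosed := hg.step (one_mem _) (by rwa [norm_sub_rev])
  obtain ⟨s, hs, hcs⟩ := hclosed.exists_mem_kAdic_of_one hT.isTracial hT.map_one Φ
  rw [mul_one, traceLog_star_of_mem_unitary hT.isTracial hg.mem_unitary
    (h.trans (by norm_num))] at hcs
  refine ⟨-(r + s), neg_mem (add_mem hr hs), ?_⟩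
  push_cast
  linear_combination -hcs

section Correction

/-- `v` is a unitary solving the equation `v * star (β v) = u` up to `ε`, such that the logarithm of
the multiplicative error has trace zero. -/
structure IsTracelessCobounding (T : B →L[ℂ] ℂ) (β : B ≃⋆ₐ[ℂ] B) (u : B) (ε : ℝ) (v : B) :
    Prop where
  mem_unitary : v ∈ unitary B
  norm_sub_one_le : ‖v * star (β v) * star u - 1‖ ≤ ε
  traceLog_eq_zero : traceLog T (v * star (β v) * star u) = 0

lemma norm_traceLog_le_two_mul (T : B →L[ℂ] ℂ) {a : B} (ha : ‖a - 1‖ ≤ 1 / 2) :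
    ‖traceLog T a‖ ≤ 2 * ‖T‖ * ‖a - 1‖ := by
  refine (norm_traceLog_le T (by linarith)).trans ?_
  rw [div_le_iff₀ (by linarith)]
  nlinarith [mul_nonneg (norm_nonneg T) (norm_nonneg (a - 1))]

lemma norm_conj_sub_one {v : B} (hv : v ∈ unitary B) (a : B) :
    ‖v * a * star v - 1‖ = ‖a - 1‖ := by
  rw [norm_mul_star_sub_one hv, ← mul_sub_one, CStarRing.norm_mem_unitary_mul _ hv]

lemma norm_mul_sub_one_le_of_mem_unitary {b : B} (hb : b ∈ unitary B) (a : B) :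
    ‖a * b - 1‖ ≤ ‖a - 1‖ + ‖b - 1‖ := by
  rw [← CStarRing.norm_mul_mem_unitary (a - 1) hb, sub_one_mul]
  exact norm_sub_le_norm_sub_add_norm_sub _ b _

lemma mul_mul_star_map_mul {v : B} (hv : v ∈ unitary B) (β : B ≃⋆ₐ[ℂ] B) (y u : B) :
    v * y * star (β (v * y)) * star u =
      v * (y * star (β y)) * star v * (v * star (β v) * star u) := by
  have hcancel (z : B) : star v * (v * z) = z := by
    rw [← mul_assoc, Unitary.star_mul_self_of_mem hv, one_mul]
  simp only [map_mul, star_mul, mul_assoc, hcancel]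

theorem HasRohlinProperty.exists_isTracelessCobounding_of_norm_le (hR : HasRohlinProperty β)
    (Φ : UHFSystem k B) (hT : IsTraceFunctional T) (hβ : ∀ a, T (β a) = T a) {ε : ℝ}
    (hε : 0 < ε) : ∃ θ > 0, ∀ u : unitary B, HasDeterminant (T : B →ₗ[ℂ] ℂ) u 0 →
      ∀ v ∈ unitary B, ‖v * star (β v) * star (u : B) - 1‖ ≤ θ → ∀ (F : Finset B) (η : ℝ), 0 < η →
      ∃ w, IsTracelessCobounding T β (u : B) ε w ∧
        ∀ f ∈ F, ‖w * f - f * w‖ ≤ ‖v * f - f * v‖ + η := by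
  obtain ⟨ρ, hρ, hcorr⟩ :=
    hR.exists_unitary_traceLog_eq Φ hT hβ (by positivity : 0 < min (ε / 2) (2 / 5))
  refine ⟨min (min (ε / 2) (1 / 20)) (ρ / (‖T‖ + 1)), by positivity, fun u hu v hv hvu F η hη ↦ ?_⟩
  simp only [le_min_iff] at hvu
  obtain ⟨⟨hvε, hv20⟩, hvρ⟩ := hvu
  obtain ⟨r, hr, hrv⟩ := exists_traceLog_eq_of_hasDeterminant_zero hT Φ hβ hu hv hv20
  have hrρ : |-r| ≤ ρ := by
    have hT1 : ‖T‖ / (‖T‖ + 1) ≤ 1 := div_le_one_of_le₀ (by linarith) (by positivity)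
    have hnorm : 2 * Real.pi * |r| ≤ 2 * ρ := calc
      2 * Real.pi * |r| = ‖traceLog T (v * star (β v) * star (u : B))‖ := by
        simp [hrv, abs_of_pos Real.pi_pos]
      _ ≤ 2 * ‖T‖ * (ρ / (‖T‖ + 1)) :=
        (norm_traceLog_le_two_mul T (hv20.trans (by norm_num))).trans (by gcongr)
      _ = 2 * (‖T‖ / (‖T‖ + 1)) * ρ := by ring
      _ ≤ 2 * ρ := by nlinarith
    rw [abs_neg]
    nlinarith [Real.pi_gt_three, abs_nonneg r]
  obtain ⟨y, hy, hyF, hyβ, hyT⟩ := hcorr (-r) (neg_mem hr) hrρ F η hη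
  rw [le_min_iff, ← norm_conj_sub_one hv] at hyβ
  refine ⟨v * y, ⟨mul_mem hv hy, ?_, ?_⟩,
    fun f hf ↦ (norm_mul_commutator_le hv hy f).trans (add_le_add le_rfl (hyF f hf))⟩
  · rw [mul_mul_star_map_mul hv]
    refine (norm_mul_sub_one_le_of_mem_unitary (mul_mem (mul_mem hv
      (Unitary.star_mem (Unitary.map_mem β hv))) (Unitary.star_mem u.2)) _).trans ?_
    linarith [hyβ.1]
  · rw [mul_mul_star_map_mul hv, traceLog_mul_of_le hT.isTracial
      hyβ.2 (hv20.trans (by norm_num)), traceLog_conj_of_mem_unitary hT.isTracial hv, hyT, hrv]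
    push_cast
    ring

theorem HasRohlinProperty.exists_isTracelessCobounding (hR : HasRohlinProperty β)
    (Φ : UHFSystem k B) (hT : IsTraceFunctional T) (hβ : ∀ a, T (β a) = T a) {u : unitary B}
    (hu : HasDeterminant (T : B →ₗ[ℂ] ℂ) u 0) {ε : ℝ} (hε : 0 < ε) :
    ∃ v, IsTracelessCobounding T β (u : B) ε v := by
  obtain ⟨θ, hθ, hcorr⟩ := hR.exists_isTracelessCobounding_of_norm_le Φ hT hβ hε
  obtain ⟨v, hv, hvu⟩ := hR.exists_approx_cobounding_of_mem_unitary Φ hθ u.2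
  obtain ⟨w, hw, -⟩ := hcorr u hu v hv hvu ∅ 1 one_pos
  exact ⟨w, hw⟩

theorem HasRohlinProperty.exists_isTracelessCobounding_commutator_le (hR : HasRohlinProperty β)
    (Φ : UHFSystem k B) (hT : IsTraceFunctional T) (hβ : ∀ a, T (β a) = T a) (F : Finset B) {ε : ℝ}
    (hε : 0 < ε) : ∃ (F' : Finset B) (δ : ℝ), 0 < δ ∧ ∀ u : unitary B,
      HasDeterminant (T : B →ₗ[ℂ] ℂ) u 0 → (∀ x ∈ F', ‖(u : B) * x - x * u‖ ≤ δ) →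
      ∃ v, IsTracelessCobounding T β (u : B) ε v ∧ ∀ f ∈ F, ‖v * f - f * v‖ ≤ ε := by
  obtain ⟨θ, hθ, hcorr⟩ := hR.exists_isTracelessCobounding_of_norm_le Φ hT hβ hε
  obtain ⟨F', δ, hδ, happrox⟩ :=
    hR.exists_approx_cobounding Φ F (by positivity : 0 < min θ (ε / 2))
  refine ⟨F', δ, hδ, fun u hu huF ↦ ?_⟩
  obtain ⟨v, hv, hvF, hvu⟩ := happrox u u.2 huF
  obtain ⟨w, hw, hwF⟩ :=
    hcorr u hu v hv (hvu.trans (min_le_left _ _)) F (ε / 2) (half_pos hε)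
  exact ⟨w, hw, fun f hf ↦ by linarith [hwF f hf, (hvF f hf).trans (min_le_right _ _)]⟩

end Correction

namespace IsTracelessCobounding

variable {u v : B} {ε : ℝ}

lemma norm_sub_le (h : IsTracelessCobounding T β u ε v) (hu : u ∈ unitary B) :
    ‖v * star (β v) - u‖ ≤ ε := by
  rw [← norm_mul_star_sub_one hu]
  exact h.norm_sub_one_le

lemma error_mem_unitary (h : IsTracelessCobounding T β u ε v) (hu : u ∈ unitary B) :
    v * star (β v) * star u ∈ unitary B :=
  mul_mem (mul_mem h.mem_unitary (Unitary.star_mem (Unitary.map_mem β h.mem_unitary)))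
    (Unitary.star_mem hu)

lemma inLogDomain (h : IsTracelessCobounding T β u ε v) (hu : u ∈ unitary B) (hε : ε < 1) :
    InLogDomain (v * star (β v) * star u) :=
  inLogDomain_of_norm_sub_one_lt (h.error_mem_unitary hu) (h.norm_sub_one_le.trans_lt hε)

lemma map_clog_eq_zero (h : IsTracelessCobounding T β u ε v) (hT : IsTracial T)
    (hu : u ∈ unitary B) (hε : ε < 1) : T (clog (v * star (β v) * star u)) = 0 :=
  (hT.map_clog (h.error_mem_unitary hu) (h.norm_sub_one_le.trans_lt hε)).trans h.traceLog_eq_zero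

end IsTracelessCobounding

end TracelessCobounding

section Sequences

open Filter Topology

lemma exists_diagonal {α : Type*} {R : ℕ → ℕ → α → Prop} (h0 : ∀ n, ∃ v, R 0 n v)
    (hR : ∀ N, ∀ᶠ n in atTop, ∃ v, R N n v) :
    ∃ (v : ℕ → α) (N : ℕ → ℕ), Tendsto N atTop atTop ∧ ∀ n, R (N n) n (v n) := by
  classical
  let N (n : ℕ) : ℕ := Nat.findGreatest (fun N ↦ ∃ v, R N n v) n
  have hN (n : ℕ) : ∃ v, R (N n) n v :=
    Nat.findGreatest_spec (P := fun N ↦ ∃ v, R N n v) (Nat.zero_le n) (h0 n)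
  choose v hv using hN
  refine ⟨v, N, tendsto_atTop.2 fun M ↦ ?_, hv⟩
  filter_upwards [hR M, eventually_ge_atTop M] with n hn hMn
  exact Nat.le_findGreatest hMn hn

lemma seqEq_of_norm_sub_le {x y : ℕ → B} {N : ℕ → ℕ} (hN : Tendsto N atTop atTop)
    (h : ∀ᶠ n in atTop, ‖x n - y n‖ ≤ ((N n : ℝ) + 2)⁻¹) : SeqEq x y :=
  squeeze_zero' (Eventually.of_forall fun _ ↦ norm_nonneg _) h <| tendsto_inv_atTop_zero.comp <|
    tendsto_atTop_add_const_right _ _ (tendsto_natCast_atTop_atTop.comp hN)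

lemma isCentralSequence_of_dense {x : ℕ → B} {C : ℝ} (hC : ∀ n, ‖x n‖ ≤ C) {S : Set B}
    (hS : Dense S) (h : ∀ b ∈ S, SeqEq (fun n ↦ x n * b) (fun n ↦ b * x n)) :
    IsCentralSequence x := by
  refine ⟨⟨C, hC⟩, fun b ↦ Metric.tendsto_atTop.2 fun ε hε ↦ ?_⟩
  have hC0 : 0 ≤ C := (norm_nonneg _).trans (hC 0)
  obtain ⟨y, hy, hby⟩ := hS.exists_dist_lt b (by positivity : 0 < ε / (4 * (C + 1)))
  obtain ⟨n₀, hn₀⟩ := Metric.tendsto_atTop.1 (h y hy) (ε / 2) (half_pos hε)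
  refine ⟨n₀, fun n hn ↦ ?_⟩
  have hyn := hn₀ n hn
  rw [dist_eq_norm] at hby
  simp only [dist_zero_right, norm_norm] at hyn ⊢
  have hC1 : C * (ε / (4 * (C + 1))) ≤ ε / 4 := calc
    _ ≤ (C + 1) * (ε / (4 * (C + 1))) := by gcongr; linarith
    _ = ε / 4 := by field_simp
  calc ‖x n * b - b * x n‖
      = ‖(x n * y - y * x n) + (x n * (b - y) - (b - y) * x n)‖ := by congr 1; noncomm_ring
    _ ≤ ‖x n * y - y * x n‖ + (C * (ε / (4 * (C + 1))) + ε / (4 * (C + 1)) * C) :=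
      norm_add_le_of_le le_rfl (norm_sub_le_of_le (norm_mul_le_of_le (hC n) hby.le)
        (norm_mul_le_of_le hby.le (hC n)))
    _ < ε := by linarith

lemma IsCentralSequence.eventually_forall_norm_commutator_le {x : ℕ → B}
    (hx : IsCentralSequence x) (F : Finset B) {δ : ℝ} (hδ : 0 < δ) :
    ∀ᶠ n in atTop, ∀ f ∈ F, ‖x n * f - f * x n‖ ≤ δ := by
  rw [eventually_all_finset]
  exact fun f _ ↦ ((hx.2 f).eventually (gt_mem_nhds hδ)).mono fun _ ↦ le_of_lt

namespace UHFSystem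

variable (Φ : UHFSystem k B)

lemma isCentralSequence_of_matrixUnit {x : ℕ → B} {C : ℝ} (hC : ∀ n, ‖x n‖ ≤ C)
    (h : ∀ m i j, SeqEq (fun n ↦ x n * Φ.matrixUnit m i j) (fun n ↦ Φ.matrixUnit m i j * x n)) :
    IsCentralSequence x := by
  refine isCentralSequence_of_dense hC Φ.dense fun b hb ↦ ?_
  obtain ⟨m, M, rfl⟩ := Set.mem_iUnion.1 hb
  refine tendsto_zero_iff_norm_tendsto_zero.1 ?_
  have hcomb (n : ℕ) : x n * Φ.φ m M - Φ.φ m M * x n =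
      ∑ i, ∑ j, M i j • (x n * Φ.matrixUnit m i j - Φ.matrixUnit m i j * x n) := by
    simp only [Φ.map_eq_sum_matrixUnit, Finset.mul_sum, Finset.sum_mul, mul_smul_comm,
      smul_mul_assoc, ← Finset.sum_sub_distrib, ← smul_sub]
  have hlim : Tendsto (fun n ↦ ∑ i, ∑ j, M i j •
      (x n * Φ.matrixUnit m i j - Φ.matrixUnit m i j * x n)) atTop
      (𝓝 (∑ i, ∑ j, M i j • (0 : B))) :=
    tendsto_finsetSum _ fun i _ ↦ tendsto_finsetSum _ fun j _ ↦
      (tendsto_zero_iff_norm_tendsto_zero.2 (h m i j)).const_smul _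
  simpa only [hcomb, smul_zero, Finset.sum_const_zero] using hlim

open Classical in
/-- The finite set of the matrix units of all levels less than `N`; its union over `N` generates a
dense subspace of `B`. -/
noncomputable def matrixUnitsBelow (N : ℕ) : Finset B :=
  Finset.univ.image fun x : Σ m : Fin N, Fin (k ^ (m : ℕ)) × Fin (k ^ (m : ℕ)) ↦
    Φ.matrixUnit x.1 x.2.1 x.2.2

lemma matrixUnit_mem_matrixUnitsBelow {m N : ℕ} (h : m < N) (i j : Fin (k ^ m)) :
    Φ.matrixUnit m i j ∈ Φ.matrixUnitsBelow N := by
  classical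
  exact Finset.mem_image.2 ⟨⟨⟨m, h⟩, i, j⟩, Finset.mem_univ _, rfl⟩

lemma matrixUnitsBelow_zero : Φ.matrixUnitsBelow 0 = ∅ := by
  classical
  rw [matrixUnitsBelow, Finset.univ_eq_empty, Finset.image_empty]

end UHFSystem

lemma UHFSystem.exists_seq_isTracelessCobounding (Φ : UHFSystem k B) {β : B ≃⋆ₐ[ℂ] B}
    {T : B →L[ℂ] ℂ} (hT : IsTraceFunctional T) (hβ : HasRohlinProperty β) {u : ℕ → unitary B}
    (hu : IsCentralSequence (fun n ↦ (u n : B)))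
    (hdet : ∀ n, HasDeterminant (T : B →ₗ[ℂ] ℂ) (u n) 0) :
    ∃ (v : ℕ → B) (N : ℕ → ℕ), Tendsto N atTop atTop ∧
      ∀ n, IsTracelessCobounding T β (u n : B) ((N n : ℝ) + 2)⁻¹ (v n) ∧
        ∀ f ∈ Φ.matrixUnitsBelow (N n), ‖v n * f - f * v n‖ ≤ ((N n : ℝ) + 2)⁻¹ := by
  have hTβ := hT.map_starAlgEquiv Φ β
  refine exists_diagonal (R := fun N n v ↦ IsTracelessCobounding T β (u n : B) ((N : ℝ) + 2)⁻¹ v ∧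
    ∀ f ∈ Φ.matrixUnitsBelow N, ‖v * f - f * v‖ ≤ ((N : ℝ) + 2)⁻¹) (fun n ↦ ?_) fun N ↦ ?_
  · simpa [Φ.matrixUnitsBelow_zero] using
      hβ.exists_isTracelessCobounding Φ hT hTβ (hdet n) (by positivity : (0 : ℝ) < (0 + 2)⁻¹)
  · obtain ⟨F, δ, hδ, hcob⟩ := hβ.exists_isTracelessCobounding_commutator_le Φ hT hTβ
      (Φ.matrixUnitsBelow N) (by positivity : 0 < ((N : ℝ) + 2)⁻¹)
    filter_upwards [hu.eventually_forall_norm_commutator_le F hδ] with n hn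
    exact hcob (u n) (hdet n) hn

end Sequences

end RohlinUHF

theorem mainTheorem8 (k : ℕ) (hk : 2 ≤ k) {B : Type*} [CStarAlgebra B]
    (hB : RohlinUHF.IsUHFPow k B)
    (τ : B →ₗ[ℂ] ℂ) (hτ : RohlinUHF.IsTracialState τ)
    (β : B ≃⋆ₐ[ℂ] B) (hβ : RohlinUHF.HasRohlinProperty β)
    (u : ℕ → unitary B)
    (hu : RohlinUHF.IsCentralSequence (fun n => (u n : B)))
    (hdet : ∀ n, RohlinUHF.HasDeterminant τ (u n) 0) :
    ∃ v : ℕ → unitary B,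
      RohlinUHF.IsCentralSequence (fun n => (v n : B)) ∧
      RohlinUHF.SeqEq (fun n => (v n : B) * star (β (v n : B))) (fun n => (u n : B)) ∧
      ∀ n, RohlinUHF.InLogDomain ((v n : B) * star (β (v n : B)) * star (u n : B)) ∧
        τ (RohlinUHF.clog ((v n : B) * star (β (v n : B)) * star (u n : B))) = 0 := by
  obtain ⟨φ, hinj, hmono, hdense⟩ := hB
  let Φ : RohlinUHF.UHFSystem k B := ⟨φ, hk, hinj, hmono, hdense⟩
  obtain ⟨T, hT, rfl⟩ := hτ.exists_isTraceFunctional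
  obtain ⟨v, N, hN, hv⟩ := Φ.exists_seq_isTracelessCobounding hT hβ hu hdet
  have hunitary (n) : v n ∈ unitary B := (hv n).1.mem_unitary
  have hlt (n) : ((N n : ℝ) + 2)⁻¹ < 1 :=
    inv_lt_one_of_one_lt₀ (by linarith [(N n).cast_nonneg (α := ℝ)])
  refine ⟨fun n ↦ ⟨v n, hunitary n⟩, ?_, ?_, fun n ↦ ⟨(hv n).1.inLogDomain (u n).2 (hlt n),
    (hv n).1.map_clog_eq_zero hT.isTracial (u n).2 (hlt n)⟩⟩
  · refine Φ.isCentralSequence_of_matrixUnit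
      (fun n ↦ RohlinUHF.norm_le_one_of_mem_unitary (hunitary n)) fun m i j ↦
      RohlinUHF.seqEq_of_norm_sub_le hN ?_
    filter_upwards [hN.eventually_gt_atTop m] with n hn
    exact (hv n).2 _ (Φ.matrixUnit_mem_matrixUnitsBelow hn i j)
  · exact RohlinUHF.seqEq_of_norm_sub_le hN <| .of_forall fun n ↦ (hv n).1.norm_sub_le (u n).2
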